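/- Let $p\ge 1$ and let $B$ be a standard $\mathbb{N}^p$-graded algebra over a Noetherian local ring $(R,\mathfrak m)$ with $R=[B]_{(0,\ldots,0)}$ (that is, $B$ is generated over $R$ by finitely many elements, each in some $[B]_{\mathbf e_i}$, where $\mathbf e_1,\ldots,\mathbf e_p$ are the elementary vectors). For $1\le i\le p$ let $H_i\subseteq [B]_{\mathbf e_i}$ be a nonzero $R$-submodule, let $I_i=(H_i)\subset B$ be the ideal generated by it, and let $I=I_1+\cdots+I_p$. Let $X=\mathrm{MultiProj}(B)$ be the set of $\mathbb{N}^p$-graded primes of $B$ not containing $B_{++}=\bigoplus_{v_1,\ldots,v_p\ge 1}[B]_{(v_1,\ldots,v_p)}$, with the Zariski topology. For a finitely generated $\mathbb{Z}^p$-graded $B$-module $M$, let $\mathscr R_M=\bigoplus_{\mathbf n\in\mathbb{N}^p} I_1^{n_1}\cdots I_p^{n_p}M\,T_1^{n_1}\cdots T_p^{n_p}\subset M[T_1,\ldots,T_p]$ and $$\mathfrak G_M=\bigoplus_{k\ge 0} I^k\mathscr R_M/I^{k+1}\mathscr R_M,\qquad [\mathfrak G_M]_{\mathbf v,\mathbf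 n}=\bigoplus_{k\ge 0}\left[\frac{I^kI_1^{n_1}\cdots I_p^{n_p}M}{I^{k+1}I_1^{n_1}\cdots I_p^{n_p}M}\right]_{\mathbf v+\mathbf n}\quad(\mathbf v\in\mathbb{Z}^p,\ \mathbf n\in\mathbb{N}^p).$$ Let $H^0_{\mathfrak m}(\mathfrak G_M)$ be the submodule of elements annihilated by a power of $\mathfrak m$. For $\alpha,\beta\in\mathbb{N}^p$ with $|\alpha|+|\beta|\ge \dim(\mathrm{Supp}(\widetilde M))$, where $\widetilde M$ is the coherent sheaf on $X$ associated to $M$, the mixed $j$-multiplicity $j_{\alpha,\beta}(H_1,\ldots,H_p;M)$ is the mixed multiplicity of type $(\alpha,\beta)$ of $H^0_{\mathfrak m}(\mathfrak G_M)$. That is, it is $\alpha_1!\cdots\alpha_p!\,\beta_1!\cdots\beta_p!$ times the coefficient of $v_1^{\alpha_1}\cdots v_p^{\alpha_p}n_1^{\beta_1}\cdots n_p^{\beta_p}$ in the polynomial $P_M(\mathbf v,\mathbf n)$ that agrees with $\mathrm{length}_R\big([H^0_{\mathfrak m}(\mathfrak G_M)]_{\mathbf v,\mathbf n}\big)$ whenever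 all $v_i$ and $n_i$ are large. Let $0\to M'\to M\to M''\to 0$ be a short exact sequence of finitely generated $\mathbb{Z}^p$-graded $B$-modules, and set $r=\dim(\mathrm{Supp}(\widetilde M))$. Then for all $\alpha,\beta\in\mathbb{N}^p$ with $|\alpha|+|\beta|\ge r$ the polynomials $P_{M'}$, $P_M$, $P_{M''}$ exist and have total degree at most $|\alpha|+|\beta|$ (so the three mixed $j$-multiplicities of type $(\alpha,\beta)$ are well defined), and $$j_{\alpha,\beta}(H_1,\ldots,H_p;M)=j_{\alpha,\beta}(H_1,\ldots,H_p;M')+j_{\alpha,\beta}(H_1,\ldots,H_p;M'').$$ -/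

import Mathlib

open scoped DirectSum

noncomputable section

/-! ### Multigraded rings, modules and multiprojective schemes -/

section Graded

variable {p : ℕ} {R B M : Type*} [CommRing R] [CommRing B] [Algebra R B]
  [AddCommGroup M] [Module R M] [Module B M] [IsScalarTower R B M]

/-- `B` with the grading `𝒜` is a standard `ℕ^p`-graded algebra over `R = [B]_0`: the structure map
identifies `R` with the degree zero part, and `B` is generated as an `R`-algebra by finitely many
elements whose degrees are elementary vectors. -/
structure IsStandardGraded (𝒜 : (Fin p → ℕ) → Submodule R B) [GradedAlgebra 𝒜] : Prop where
  algebraMap_injective : Function.Injective (algebraMap R B)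
  exists_algebraMap_eq : ∀ b ∈ 𝒜 0, ∃ r : R, algebraMap R B r = b
  exists_generators : ∃ S : Finset B,
    (∀ b ∈ S, ∃ i : Fin p, b ∈ 𝒜 (Pi.single i 1)) ∧ Algebra.adjoin R (S : Set B) = ⊤

/-- `ℳ` is a `ℤ^p`-grading of the `B`-module `M`, where `B` is `ℕ^p`-graded by `𝒜`. -/
structure IsGradedModule (𝒜 : (Fin p → ℕ) → Submodule R B)
    (ℳ : (Fin p → ℤ) → Submodule R M) : Prop where
  isInternal : DirectSum.IsInternal ℳ
  smul_mem : ∀ (n : Fin p → ℕ) (v : Fin p → ℤ) (b : B) (x : M),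
    b ∈ 𝒜 n → x ∈ ℳ v → b • x ∈ ℳ (fun i => (n i : ℤ) + v i)

/-- The multigraded irrelevant ideal `B_{++}`, generated by (in fact, the sum of) the `[B]_v` with
`v ≥ (1,…,1)`. -/
def irrelevantIdeal (𝒜 : (Fin p → ℕ) → Submodule R B) : Ideal B :=
  Ideal.span {b | ∃ v : Fin p → ℕ, (∀ i, 1 ≤ v i) ∧ b ∈ 𝒜 v}

/-- `MultiProj(B)`: the multigraded primes not containing `B_{++}`, with the Zariski topology (the
subspace topology of `Spec B`). -/
def multiProj (𝒜 : (Fin p → ℕ) → Submodule R B) [GradedAlgebra 𝒜] : Set (PrimeSpectrum B) :=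
  {P | P.asIdeal.IsHomogeneous 𝒜 ∧ ¬ irrelevantIdeal 𝒜 ≤ P.asIdeal}

variable (M) in
/-- The support of the sheaf associated to the graded module `M` on `MultiProj(B)`. A prime in
`MultiProj(B)` avoids some element of each degree `e_i`, so the stalk of the sheaf, the degree zero
part of the homogeneous localization of `M`, vanishes if and only if `M_P` does. -/
def sheafSupport (𝒜 : (Fin p → ℕ) → Submodule R B) [GradedAlgebra 𝒜] : Set (PrimeSpectrum B) :=
  multiProj 𝒜 ∩ Module.support B M

variable (M) in
/-- The dimension of the support of the sheaf associated to `M` (it is `⊥` when the sheaf is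
zero). -/
def dimSheafSupport (𝒜 : (Fin p → ℕ) → Submodule R B) [GradedAlgebra 𝒜] : WithBot ℕ∞ :=
  topologicalKrullDim ↥(sheafSupport M 𝒜)

end Graded

/-! ### Mixed multiplicities of a numerical function -/

section Multiplicity

variable {σ : Type*}

/-- `P` is the Hilbert polynomial of `F`: all values of `F` at tuples with large enough entries are
finite and given by `P`. -/
def IsHilbertPolynomial (F : (σ → ℕ) → ℕ∞) (P : MvPolynomial σ ℚ) : Prop :=
  ∃ c : ℕ, ∀ w : σ → ℕ, (∀ i, c ≤ w i) →
    ∃ l : ℕ, F w = (l : ℕ∞) ∧ MvPolynomial.eval (fun i => (w i : ℚ)) P = (l : ℚ)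

theorem IsHilbertPolynomial.unique {F : (σ → ℕ) → ℕ∞} {P Q : MvPolynomial σ ℚ}
    (hP : IsHilbertPolynomial F P) (hQ : IsHilbertPolynomial F Q) : P = Q := by
  obtain ⟨c, hc⟩ := hP
  obtain ⟨d, hd⟩ := hQ
  refine MvPolynomial.funext_set (fun _ => (fun n : ℕ => (n : ℚ)) '' Set.Ici (max c d))
    (fun _ => (Set.Ici_infinite _).image Nat.cast_injective.injOn) ?_
  intro x hx
  choose w hw hwx using fun i => hx i (Set.mem_univ i)
  obtain rfl : (fun i => (w i : ℚ)) = x := funext hwx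
  obtain ⟨l, hl, hl'⟩ := hc w fun i => le_trans (le_max_left _ _) (hw i)
  obtain ⟨m, hm, hm'⟩ := hd w fun i => le_trans (le_max_right _ _) (hw i)
  have hlm : l = m := by exact_mod_cast hl.symm.trans hm
  rw [hl', hm', hlm]

open Classical in
/-- The mixed multiplicity of type `γ` of a graded module with Hilbert function `F`: the normalized
coefficient `γ! · [x^γ]` of the Hilbert polynomial. For `|γ|` equal to (larger than) the degree of
the Hilbert polynomial it is a normalized leading coefficient (zero). -/
def mixedMultiplicity [Fintype σ] (F : (σ → ℕ) → ℕ∞) (γ : σ → ℕ) : ℚ :=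
  if h : ∃ P, IsHilbertPolynomial F P then
    (∏ i, ((γ i).factorial : ℚ)) * MvPolynomial.coeff (Finsupp.equivFunOnFinite.symm γ) h.choose
  else 0

end Multiplicity

/-! ### Local cohomology and the joint blow-up modules -/

/-- `H^0_𝔪(N)`: the elements of `N` annihilated by a power of the maximal ideal of `R`. -/
def maxTorsion (R N : Type*) [CommRing R] [IsLocalRing R] [AddCommGroup N] [Module R N] :
    Submodule R N where
  carrier := {x | ∃ s : ℕ, ∀ a ∈ IsLocalRing.maximalIdeal R ^ s, a • x = 0}
  zero_mem' := ⟨0, fun a _ => smul_zero a⟩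
  add_mem' := by
    rintro x y ⟨s, hs⟩ ⟨t, ht⟩
    refine ⟨s + t, fun a ha => ?_⟩
    rw [smul_add, hs a (Ideal.pow_le_pow_right (Nat.le_add_right s t) ha),
      ht a (Ideal.pow_le_pow_right (Nat.le_add_left t s) ha), add_zero]
  smul_mem' := by
    rintro c x ⟨s, hs⟩
    exact ⟨s, fun a ha => by rw [smul_comm, hs a ha, smul_zero]⟩

section JointBlowup

variable {p : ℕ} {R B : Type*} [CommRing R] [CommRing B] [Algebra R B]

/-- The ideal `I_i = (H_i)` of `B`. -/
def formIdeal (H : Fin p → Submodule R B) (i : Fin p) : Ideal B :=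
  Ideal.span (H i : Set B)

/-- The ideal `I = I_1 + ⋯ + I_p` of `B`. -/
def totalIdeal (H : Fin p → Submodule R B) : Ideal B :=
  ⨆ i, formIdeal H i

variable (M : Type*) [AddCommGroup M] [Module R M] [Module B M] [IsScalarTower R B M]

/-- The multi-Rees module `𝓡_M = ⨁_n I_1^{n_1} ⋯ I_p^{n_p} M T^n ⊆ M[T_1,…,T_p]`, where `M[T_1,…,T_p]`
is the module of finitely supported functions from exponents `n ∈ ℕ^p` to `M`. -/
def reesModule (H : Fin p → Submodule R B) : Submodule B ((Fin p → ℕ) →₀ M) where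
  carrier := {f | ∀ n, f n ∈ (∏ i, formIdeal H i ^ n i) • (⊤ : Submodule B M)}
  zero_mem' := fun _ => Submodule.zero_mem _
  add_mem' := by
    intro f g hf hg n
    rw [Finsupp.add_apply]
    exact Submodule.add_mem _ (hf n) (hg n)
  smul_mem' := by
    intro b f hf n
    rw [Finsupp.smul_apply]
    exact Submodule.smul_mem _ b (hf n)

/-- The submodule `I^k 𝓡_M` of `M[T_1,…,T_p]`. -/
def reesFiltration (H : Fin p → Submodule R B) (k : ℕ) : Submodule B ((Fin p → ℕ) →₀ M) :=
  totalIdeal H ^ k • reesModule M H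

/-- The graded piece `I^k 𝓡_M / I^{k+1} 𝓡_M`. -/
def AssocGradedPiece (H : Fin p → Submodule R B) (k : ℕ) : Type _ :=
  ↥(reesFiltration M H k) ⧸ (reesFiltration M H (k + 1)).submoduleOf (reesFiltration M H k)

instance (H : Fin p → Submodule R B) (k : ℕ) : AddCommGroup (AssocGradedPiece M H k) :=
  inferInstanceAs <| AddCommGroup
    (↥(reesFiltration M H k) ⧸ (reesFiltration M H (k + 1)).submoduleOf (reesFiltration M H k))

instance (H : Fin p → Submodule R B) (k : ℕ) : Module B (AssocGradedPiece M H k) :=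
  inferInstanceAs <| Module B
    (↥(reesFiltration M H k) ⧸ (reesFiltration M H (k + 1)).submoduleOf (reesFiltration M H k))

instance (H : Fin p → Submodule R B) (k : ℕ) : Module R (AssocGradedPiece M H k) :=
  inferInstanceAs <| Module R
    (↥(reesFiltration M H k) ⧸ (reesFiltration M H (k + 1)).submoduleOf (reesFiltration M H k))

instance (H : Fin p → Submodule R B) (k : ℕ) : IsScalarTower R B (AssocGradedPiece M H k) :=
  inferInstanceAs <| IsScalarTower R B
    (↥(reesFiltration M H k) ⧸ (reesFiltration M H (k + 1)).submoduleOf (reesFiltration M H k))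

/-- The class map `I^k 𝓡_M → I^k 𝓡_M / I^{k+1} 𝓡_M`. -/
def AssocGradedPiece.mk (H : Fin p → Submodule R B) (k : ℕ) :
    ↥(reesFiltration M H k) →ₗ[B] AssocGradedPiece M H k :=
  ((reesFiltration M H (k + 1)).submoduleOf (reesFiltration M H k)).mkQ

/-- The module `𝔊_M = 𝔊(I_1,…,I_p; M) = ⨁_k I^k 𝓡_M / I^{k+1} 𝓡_M`. -/
abbrev JointBlowupModule (H : Fin p → Submodule R B) : Type _ :=
  ⨁ k : ℕ, AssocGradedPiece M H k

variable {M}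

/-- The part of bidegree `(v, n)` of `I^k 𝓡_M / I^{k+1} 𝓡_M`. It consists of the classes of the
`x T^n` with `x` homogeneous of degree `v + n` in `M`, since an element `x T^n` has bidegree
`(deg x - n, n)` for the internal grading. -/
def assocGradedComponent (H : Fin p → Submodule R B) (ℳ : (Fin p → ℤ) → Submodule R M)
    (k : ℕ) (v : Fin p → ℤ) (n : Fin p → ℕ) : Submodule R (AssocGradedPiece M H k) :=
  (((ℳ (fun i => v i + (n i : ℤ))).map
      (Finsupp.lsingle n : M →ₗ[R] ((Fin p → ℕ) →₀ M))).comap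
    ((reesFiltration M H k).subtype.restrictScalars R)).map
    ((AssocGradedPiece.mk M H k).restrictScalars R)

/-- The part `[𝔊_M]_{v,n}` of bidegree `(v, n)` of `𝔊_M`. -/
def jointBlowupComponent (H : Fin p → Submodule R B) (ℳ : (Fin p → ℤ) → Submodule R M)
    (v : Fin p → ℤ) (n : Fin p → ℕ) : Submodule R (JointBlowupModule M H) where
  carrier := {x | ∀ k, x k ∈ assocGradedComponent H ℳ k v n}
  zero_mem' := fun _ => Submodule.zero_mem _
  add_mem' := by
    intro x y hx hy k
    rw [DirectSum.add_apply]
    exact Submodule.add_mem _ (hx k) (hy k)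
  smul_mem' := by
    intro r x hx k
    rw [DirectSum.smul_apply]
    exact Submodule.smul_mem _ r (hx k)

/-- The Hilbert function `(v, n) ↦ length_R [H^0_𝔪(𝔊_M)]_{v,n}`, for `v, n ∈ ℕ^p`. -/
def jHilbertFunction [IsLocalRing R] (H : Fin p → Submodule R B)
    (ℳ : (Fin p → ℤ) → Submodule R M) (w : Fin p ⊕ Fin p → ℕ) : ℕ∞ :=
  Module.length R
    ↥(maxTorsion R (JointBlowupModule M H) ⊓
      jointBlowupComponent H ℳ (fun i => (w (Sum.inl i) : ℤ)) (fun i => w (Sum.inr i)))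

/-- The mixed `j`-multiplicity `j_{α,β}(H_1,…,H_p; M) = j_{α,β}(𝔊_M) = e(α, β; H^0_𝔪(𝔊_M))`. -/
def mixedJMultiplicity [IsLocalRing R] (H : Fin p → Submodule R B)
    (ℳ : (Fin p → ℤ) → Submodule R M) (α β : Fin p → ℕ) : ℚ :=
  mixedMultiplicity (jHilbertFunction H ℳ) (Sum.elim α β)

/-- `j_{α,β}(H_1,…,H_p; M)` is well defined: `H^0_𝔪(𝔊_M)` has a Hilbert polynomial, and the degree
of this polynomial is at most `|α| + |β|`. -/
def MixedJMultiplicityExists [IsLocalRing R] (H : Fin p → Submodule R B)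
    (ℳ : (Fin p → ℤ) → Submodule R M) (α β : Fin p → ℕ) : Prop :=
  ∃ P : MvPolynomial (Fin p ⊕ Fin p) ℚ, IsHilbertPolynomial (jHilbertFunction H ℳ) P ∧
    P.totalDegree ≤ ∑ i, α i + ∑ i, β i

end JointBlowup

end

/-! Present `B` as a quotient of a polynomial ring `S` over `R` whose variables have elementary
degrees, with a distinguished set `γ` of variables mapping to generators of the ideals `I_i`. Then
`M` is a finitely generated graded `S`-module; let `Q` be the image of `M'`. A larger polynomial
ring, with extra variables `X_a T_i` and `X_a U` for `a ∈ γ`, acts on families of elements of `M`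
indexed by `(n, k)`. Over it there are the bigraded modules `A = ⨁ I^k I^n M`, its shift `A₁ = ⨁
I^{k+1} I^n M`, the analogues `E ⊇ E₁` for `Q`, and `J = ⨁ (I^k I^n M ∩ Q)`. Here `𝔊_M = A/A₁`,
`𝔊_{M'} = E/E₁` and `𝔊_{M''} = A/(A₁ + J)`, so the three Hilbert functions are lengths of
`𝔪`-torsion of subquotients of one ambient module.

Existence. The torsion of a finitely generated subquotient is killed by a power of `𝔪`, so its
graded parts have finite length, and an induction on the number of variables makes the length
eventually polynomial (`exists_polynomial_torLength`).

Degrees. These are controlled by the functions `length [A/(B + 𝔪^s A)]_w` of `(w, s)`; growth of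
order `D` means a bound by a polynomial of degree less than `D`. Dévissage reduces to homogeneous
primes, and a prime grows at most like the length of chains of relevant homogeneous primes above it
(`PrimeChainBound.hasGrowth`). Hence `M` has growth `D + 1` when its sheaf has support of dimension
at most `D`. A linear form of Artin-Rees, `exists_linear_artinRees`, transfers this to `A` (order `D
+ 2`) and, by telescoping over `k`, to `A/A₁` (order `D + 1`).

Additivity modulo growth `D`. The engine is a drop principle: if a homogeneous element of a relevant
prime is a nonzerodivisor modulo a smaller ideal, the prime has growth one less than that ideal
(`HasGrowth.idealHilbSam_drop`). It has two consequences. First, torsion length is additive along `C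
⊆ B ⊆ A` up to an error of growth one less than `A/C` (`hasGrowth_torLength_defect`). Second, `J/E`
grows one order less than `A`, because a power of a product of variables of `γ`, one in each
direction, carries `J` into `E` (`hasGrowth_hilbSam_reesInf`).

By the first consequence, `A/A₁` is compared with `A/(A₁ + J)` and `J/(J ∩ A₁)`. It remains to
compare `J/(J ∩ A₁)` with `E/E₁`. Both chains `J ⊇ E ⊇ E₁` and `J ⊇ J ∩ A₁ ⊇ E₁` compute the torsion
of `J/E₁`. Moreover `(J ∩ A₁)/E₁` is `J/E` with `k` shifted by one, so the two differ by the part `k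
= 0` of `J/E`, which again has small growth. Thus all coefficients of `P_M - P_{M'} - P_{M''}` in
degrees at least `D = |α| + |β|` vanish. -/

/-! ### Relative lengths -/

section RelLength

variable {R N N₂ : Type*} [CommRing R] [AddCommGroup N] [Module R N] [AddCommGroup N₂] [Module R N₂]

/-- The length of `X` modulo `Y`, that is, of `(X + Y) / Y`. -/
noncomputable def relLength (X Y : Submodule R N) : ℕ∞ :=
  Module.length R (X.map Y.mkQ)

theorem relLength_eq_zero_iff {X Y : Submodule R N} : relLength X Y = 0 ↔ X ≤ Y := by
  rw [relLength, Module.length_eq_zero_iff, Submodule.subsingleton_iff_eq_bot,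
    ← LinearMap.le_ker_iff_map, Submodule.ker_mkQ]

theorem relLength_bot (X : Submodule R N) : relLength X ⊥ = Module.length R X := by
  refine (LinearEquiv.length_eq (Submodule.equivMapOfInjective _ ?_ X)).symm
  rw [← LinearMap.ker_eq_bot, Submodule.ker_mkQ]

/-- `φ` induces an injection from the quotient by the preimage of `Y` into the quotient by `Y`. -/
theorem relLength_map (φ : N →ₗ[R] N₂) (X : Submodule R N) (Y : Submodule R N₂) :
    relLength (X.map φ) Y = relLength X (Y.comap φ) := by
  have hinj : Function.Injective ((Y.comap φ).mapQ Y φ le_rfl) := by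
    rw [← LinearMap.ker_eq_bot, Submodule.ker_mapQ, ← LinearMap.le_ker_iff_map, Submodule.ker_mkQ]
  have h : ((X.map (Y.comap φ).mkQ).map ((Y.comap φ).mapQ Y φ le_rfl)) = (X.map φ).map Y.mkQ := by
    rw [← Submodule.map_comp, ← Submodule.map_comp, Submodule.mapQ_mkQ]
  rw [relLength, relLength, ← h]
  exact (LinearEquiv.length_eq (Submodule.equivMapOfInjective _ hinj _)).symm

theorem relLength_congr {X X₂ Y : Submodule R N} (h : X ⊔ Y = X₂ ⊔ Y) :
    relLength X Y = relLength X₂ Y := by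
  have key : ∀ X : Submodule R N, X.map Y.mkQ = (X ⊔ Y).map Y.mkQ := fun X => by
    rw [Submodule.map_sup, LinearMap.le_ker_iff_map.1 (Submodule.ker_mkQ Y).ge, sup_bot_eq]
  rw [relLength, relLength, key, h, ← key]

theorem relLength_mono_left {X X₂ Y : Submodule R N} (h : X ≤ X₂) :
    relLength X Y ≤ relLength X₂ Y :=
  Module.length_le_of_injective (Submodule.inclusion (Submodule.map_mono h))
    (Submodule.inclusion_injective _)

/-- The map `(X + Y)/Y → (X + Z)/Z` is surjective, and its kernel is the image of `X ∩ Z`. -/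
theorem relLength_add {X Y Z : Submodule R N} (h : Y ≤ Z) :
    relLength X Y = relLength X Z + relLength (X ⊓ Z) Y := by
  let f : (X ⊓ Z).map Y.mkQ →ₗ[R] X.map Y.mkQ :=
    Submodule.inclusion (Submodule.map_mono inf_le_left)
  have hq : (X.map Y.mkQ).map (Y.mapQ Z LinearMap.id h) = X.map Z.mkQ := by
    rw [← Submodule.map_comp, Submodule.mapQ_mkQ, LinearMap.comp_id]
  let g : X.map Y.mkQ →ₗ[R] X.map Z.mkQ :=
    (Y.mapQ Z LinearMap.id h).restrict (fun x hx => hq ▸ Submodule.mem_map_of_mem hx)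
  rw [relLength, relLength, relLength, add_comm]
  refine Module.length_eq_add_of_exact f g (Submodule.inclusion_injective _) ?_ ?_
  · rintro ⟨y, hy⟩
    obtain ⟨x, hx, rfl⟩ : ∃ x ∈ X.map Y.mkQ, Y.mapQ Z LinearMap.id h x = y := by
      rwa [← hq] at hy
    exact ⟨⟨x, hx⟩, rfl⟩
  · rintro ⟨y, hy⟩
    constructor
    · intro h0
      obtain ⟨x, hx, rfl⟩ := hy
      have : Y.mapQ Z LinearMap.id h (Y.mkQ x) = 0 := congrArg Subtype.val h0
      have hxZ : x ∈ Z := by simpa using this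
      exact ⟨⟨Y.mkQ x, Submodule.mem_map_of_mem ⟨hx, hxZ⟩⟩, rfl⟩
    · rintro ⟨⟨_, ⟨x, hx, rfl⟩⟩, hxy⟩
      have : y = Y.mkQ x := (congrArg Subtype.val hxy).symm
      subst this
      refine Subtype.ext ?_
      change Y.mapQ Z LinearMap.id h (Y.mkQ x) = 0
      simpa using hx.2

theorem relLength_inf_self (X Y : Submodule R N) : relLength X (X ⊓ Y) = relLength X Y := by
  rw [relLength_add (Z := Y) inf_le_right, relLength_eq_zero_iff.2 le_rfl, add_zero]

/-- Relative lengths only decrease when passing to a submodule or to a quotient. -/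
theorem relLength_le {X X₂ Y Y₂ : Submodule R N} (h : X ≤ X₂) (h' : X ⊓ Y₂ ≤ Y) :
    relLength X Y ≤ relLength X₂ Y₂ := by
  have h1 : X ⊓ Y₂ ≤ X ⊓ Y := le_inf inf_le_left h'
  calc relLength X Y = relLength X (X ⊓ Y) := (relLength_inf_self X Y).symm
    _ ≤ relLength X (X ⊓ Y₂) := by rw [relLength_add h1]; exact le_self_add
    _ = relLength X Y₂ := relLength_inf_self X Y₂
    _ ≤ _ := relLength_mono_left h

theorem relLength_anti {X Y Y₂ : Submodule R N} (h : Y₂ ≤ Y) : relLength X Y ≤ relLength X Y₂ :=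
  relLength_le le_rfl (inf_le_right.trans h)

theorem relLength_le_add {X Y Z : Submodule R N} :
    relLength X Y ≤ relLength X Z + relLength Z Y := by
  calc relLength X Y ≤ relLength X (X ⊓ Y ⊓ Z) := relLength_anti (inf_le_left.trans inf_le_right)
    _ = relLength X Z + relLength (X ⊓ Z) (X ⊓ Y ⊓ Z) := relLength_add inf_le_right
    _ ≤ _ := by
      gcongr
      refine relLength_le inf_le_right ?_
      exact fun x (hx : x ∈ X ⊓ Z ⊓ Y) => ⟨⟨hx.1.1, hx.2⟩, hx.1.2⟩

/-- The length of a submodule with independent coordinates is the sum of the lengths of the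
coordinate parts. -/
theorem relLength_eq_sum {K : Type*} {V : K → Type*} [∀ κ, AddCommGroup (V κ)]
    [∀ κ, Module R (V κ)] (ev : ∀ κ, N →ₗ[R] V κ) (Yc : ∀ κ, Submodule R (V κ)) (F : Finset K) :
    ∀ (X Y : Submodule R N)
    (_ : ∀ κ ∈ F, ∀ x ∈ X, ∃ x' ∈ X, ev κ x' = ev κ x ∧ ∀ κ', κ' ≠ κ → ev κ' x' = 0)
    (_ : ∀ x ∈ X, x ∈ Y ↔ ∀ κ ∈ F, ev κ x ∈ Yc κ),
    relLength X Y = ∑ κ ∈ F, relLength (X.map (ev κ)) (Yc κ) := by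
  classical
  induction F using Finset.induction_on with
  | empty =>
    intro X Y _ hY
    rw [Finset.sum_empty, relLength_eq_zero_iff]
    exact fun x hx => (hY x hx).2 (by simp)
  | insert κ F hκ ih =>
    intro X Y hX hY
    have h1 : relLength X Y = relLength X ((Yc κ).comap (ev κ)) +
        relLength (X ⊓ (Yc κ).comap (ev κ)) Y := by
      rw [← relLength_inf_self X Y, relLength_add (Z := (Yc κ).comap (ev κ))
        (fun x (hx : x ∈ X ⊓ Y) => (hY x hx.1).1 hx.2 κ (Finset.mem_insert_self _ _))]
      congr 1
      refine le_antisymm (relLength_le le_rfl ?_) (relLength_anti inf_le_right)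
      exact fun x (hx : x ∈ X ⊓ _ ⊓ Y) => ⟨hx.1.1, hx.2⟩
    have h2 := ih (X ⊓ (Yc κ).comap (ev κ)) Y ?_ ?_
    · rw [h1, h2, Finset.sum_insert hκ, relLength_map]
      congr 1
      refine Finset.sum_congr rfl fun κ' hκ' => ?_
      congr 1
      refine le_antisymm (Submodule.map_mono inf_le_left) ?_
      rintro _ ⟨x, hx, rfl⟩
      obtain ⟨x', hx', h3, h4⟩ := hX κ' (Finset.mem_insert_of_mem hκ') x hx
      refine ⟨x', ⟨hx', ?_⟩, h3⟩
      have : κ ≠ κ' := fun h => hκ (h ▸ hκ')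
      simp [h4 κ this]
    · rintro κ' hκ' x ⟨hx, -⟩
      obtain ⟨x', hx', h3, h4⟩ := hX κ' (Finset.mem_insert_of_mem hκ') x hx
      have : κ ≠ κ' := fun h => hκ (h ▸ hκ')
      exact ⟨x', ⟨hx', by simp [h4 κ this]⟩, h3, h4⟩
    · rintro x ⟨hx, hxκ⟩
      rw [hY x hx, Finset.forall_mem_insert]
      exact and_iff_right hxκ

end RelLength

/-! ### Torsion relative lengths -/

section TorLength

variable {R N N₂ : Type*} [CommRing R] [IsLocalRing R] [AddCommGroup N] [Module R N]
  [AddCommGroup N₂] [Module R N₂]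

open IsLocalRing

/-- The elements that a power of the maximal ideal of `R` multiplies into `Y`. -/
def maxSaturation (Y : Submodule R N) : Submodule R N where
  carrier := {x | ∃ s : ℕ, ∀ a ∈ maximalIdeal R ^ s, a • x ∈ Y}
  zero_mem' := ⟨0, fun a _ => by simp⟩
  add_mem' := by
    rintro x y ⟨s, hs⟩ ⟨t, ht⟩
    refine ⟨s + t, fun a ha => ?_⟩
    rw [smul_add]
    exact Y.add_mem (hs a (Ideal.pow_le_pow_right (Nat.le_add_right s t) ha))
      (ht a (Ideal.pow_le_pow_right (Nat.le_add_left t s) ha))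
  smul_mem' := by
    rintro c x ⟨s, hs⟩
    exact ⟨s, fun a ha => by rw [smul_comm]; exact Y.smul_mem _ (hs a ha)⟩

theorem mem_maxSaturation {Y : Submodule R N} {x : N} :
    x ∈ maxSaturation Y ↔ ∃ s : ℕ, ∀ a ∈ maximalIdeal R ^ s, a • x ∈ Y := Iff.rfl

theorem le_maxSaturation (Y : Submodule R N) : Y ≤ maxSaturation Y :=
  fun _ hx => ⟨0, fun a _ => Y.smul_mem a hx⟩

theorem maxSaturation_mono {Y Z : Submodule R N} (h : Y ≤ Z) : maxSaturation Y ≤ maxSaturation Z :=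
  fun _ ⟨s, hs⟩ => ⟨s, fun a ha => h (hs a ha)⟩

theorem maxSaturation_bot : maxSaturation (⊥ : Submodule R N) = maxTorsion R N := by
  ext x
  exact exists_congr fun s => forall₂_congr fun a _ => Submodule.mem_bot R

theorem comap_maxSaturation (φ : N →ₗ[R] N₂) (Y : Submodule R N₂) :
    (maxSaturation Y).comap φ = maxSaturation (Y.comap φ) := by
  ext x
  simp [mem_maxSaturation]

/-- The length of the `𝔪`-power torsion of `X` modulo `Y`. -/
noncomputable def torLength (X Y : Submodule R N) : ℕ∞ := relLength (X ⊓ maxSaturation Y) Y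

/-- Saturation commutes with preimages, so torsion lengths inherit the projection formula of
relative lengths. -/
theorem torLength_map (φ : N →ₗ[R] N₂) (X : Submodule R N) (Y : Submodule R N₂) :
    torLength (X.map φ) Y = torLength X (Y.comap φ) := by
  rw [torLength, torLength, ← comap_maxSaturation, ← relLength_map]
  congr 1
  ext y
  constructor
  · rintro ⟨⟨x, hx, rfl⟩, hy⟩
    exact ⟨x, ⟨hx, hy⟩, rfl⟩
  · rintro ⟨x, ⟨hx, hy⟩, rfl⟩
    exact ⟨⟨x, hx, rfl⟩, hy⟩

theorem torLength_inf_self (X Y : Submodule R N) : torLength X (X ⊓ Y) = torLength X Y := by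
  rw [torLength, torLength, ← relLength_inf_self _ Y, ← relLength_inf_self _ (X ⊓ Y)]
  have h : X ⊓ maxSaturation (X ⊓ Y) = X ⊓ maxSaturation Y := by
    refine le_antisymm (inf_le_inf le_rfl (maxSaturation_mono inf_le_right)) ?_
    rintro x ⟨hx, s, hs⟩
    exact ⟨hx, s, fun a ha => ⟨X.smul_mem a hx, hs a ha⟩⟩
  rw [h]
  congr 1
  ext x
  simp only [Submodule.mem_inf]
  tauto

theorem torLength_congr_right {X Y Y₂ : Submodule R N} (h : X ⊓ Y = X ⊓ Y₂) :
    torLength X Y = torLength X Y₂ := by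
  rw [← torLength_inf_self, h, torLength_inf_self]

theorem torLength_map_of_injective (φ : N →ₗ[R] N₂) (hφ : Function.Injective φ)
    (X Y : Submodule R N) : torLength (X.map φ) (Y.map φ) = torLength X Y := by
  rw [torLength_map, Submodule.comap_map_eq_of_injective hφ]

theorem torLength_bot (X : Submodule R N) :
    torLength X ⊥ = Module.length R ↥(maxTorsion R N ⊓ X) := by
  rw [torLength, relLength_bot, maxSaturation_bot, inf_comm]

theorem torLength_eq_zero {X Y : Submodule R N} (h : X ≤ Y) : torLength X Y = 0 :=
  relLength_eq_zero_iff.2 (inf_le_left.trans h)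

/-- Since a single coordinate of an element of `X` can be isolated inside `X`, torsion is detected
coordinatewise; the sum formula for relative lengths then applies to the torsion part of `X`. -/
theorem torLength_eq_sum {K : Type*} {V : K → Type*} [∀ κ, AddCommGroup (V κ)]
    [∀ κ, Module R (V κ)] (ev : ∀ κ, N →ₗ[R] V κ) (Yc : ∀ κ, Submodule R (V κ)) (F : Finset K)
    (X Y : Submodule R N)
    (hX : ∀ κ ∈ F, ∀ x ∈ X, ∃ x' ∈ X, ev κ x' = ev κ x ∧ ∀ κ', κ' ≠ κ → ev κ' x' = 0)
    (hY : ∀ x ∈ X, x ∈ Y ↔ ∀ κ ∈ F, ev κ x ∈ Yc κ) :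
    torLength X Y = ∑ κ ∈ F, torLength (X.map (ev κ)) (Yc κ) := by
  have key : ∀ κ ∈ F, ∀ x' ∈ X, (∀ κ', κ' ≠ κ → ev κ' x' = 0) →
      ev κ x' ∈ maxSaturation (Yc κ) → x' ∈ maxSaturation Y := by
    rintro κ hκ x' hx' h0 ⟨s, hs⟩
    refine ⟨s, fun a ha => (hY _ (X.smul_mem a hx')).2 fun κ' _ => ?_⟩
    by_cases h : κ' = κ
    · subst h
      simpa using hs a ha
    · simp [h0 κ' h]
  have key2 : ∀ κ ∈ F, ∀ x ∈ X, x ∈ maxSaturation Y → ev κ x ∈ maxSaturation (Yc κ) := by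
    rintro κ hκ x hx ⟨s, hs⟩
    refine ⟨s, fun a ha => ?_⟩
    simpa using (hY _ (X.smul_mem a hx)).1 (hs a ha) κ hκ
  rw [torLength, relLength_eq_sum ev Yc F]
  · refine Finset.sum_congr rfl fun κ hκ => ?_
    rw [torLength]
    congr 1
    refine le_antisymm ?_ ?_
    · rintro _ ⟨x, ⟨hx, hxs⟩, rfl⟩
      exact ⟨⟨x, hx, rfl⟩, key2 κ hκ x hx hxs⟩
    · rintro _ ⟨⟨x, hx, rfl⟩, hxs⟩
      obtain ⟨x', hx', h3, h4⟩ := hX κ hκ x hx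
      exact ⟨x', ⟨hx', key κ hκ x' hx' h4 (h3 ▸ hxs)⟩, h3⟩
  · rintro κ hκ x ⟨hx, hxs⟩
    obtain ⟨x', hx', h3, h4⟩ := hX κ hκ x hx
    exact ⟨x', ⟨hx', key κ hκ x' hx' h4 (h3 ▸ key2 κ hκ x hx hxs)⟩, h3, h4⟩
  · exact fun x hx => hY x hx.1

/-- Finitely generated modules over a Noetherian local ring have finite length modulo powers of the
maximal ideal. -/
theorem relLength_lt_top [IsNoetherianRing R] {X Y : Submodule R N} (hX : X.FG) (s : ℕ)
    (hs : ∀ a ∈ maximalIdeal R ^ s, ∀ x ∈ X, a • x ∈ Y) : relLength X Y < ⊤ := by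
  induction s generalizing X Y with
  | zero =>
    rw [relLength_eq_zero_iff.2 (fun x hx => by simpa using hs 1 (by simp) x hx)]
    simp
  | succ s ih =>
    have h1 : relLength X Y ≤ relLength X (maximalIdeal R • X) + relLength (maximalIdeal R • X) Y :=
      relLength_le_add
    refine h1.trans_lt (ENat.add_lt_top.2 ⟨?_, ?_⟩)
    -- `X / 𝔪X` is a finite-dimensional vector space over the residue field.
    · have : IsArtinian R (X.map (maximalIdeal R • X).mkQ) := by
        have hfin : Module.Finite R (X.map (maximalIdeal R • X).mkQ) :=
          Module.Finite.iff_fg.2 (hX.map _)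
        have htor : Module.IsTorsionBySet R (X.map (maximalIdeal R • X).mkQ) (maximalIdeal R) := by
          rintro ⟨_, ⟨x, hx, rfl⟩⟩ ⟨a, ha⟩
          refine Subtype.ext ?_
          change a • (maximalIdeal R • X).mkQ x = 0
          rw [← map_smul, Submodule.mkQ_apply, Submodule.Quotient.mk_eq_zero]
          exact Submodule.smul_mem_smul ha hx
        let := htor.module
        let : Field (R ⧸ maximalIdeal R) := Ideal.Quotient.field _
        have : IsScalarTower R (R ⧸ maximalIdeal R) (X.map (maximalIdeal R • X).mkQ) :=
          htor.isScalarTower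
        have : Module.Finite (R ⧸ maximalIdeal R) (X.map (maximalIdeal R • X).mkQ) :=
          Module.Finite.of_restrictScalars_finite R _ _
        have : IsArtinian (R ⧸ maximalIdeal R) (X.map (maximalIdeal R • X).mkQ) := inferInstance
        exact isArtinian_of_surjective_algebraMap (S := R) (R := R ⧸ maximalIdeal R)
          Ideal.Quotient.mk_surjective
      have hfin : Module.Finite R (X.map (maximalIdeal R • X).mkQ) :=
        Module.Finite.iff_fg.2 (hX.map _)
      exact lt_top_iff_ne_top.2 Module.length_ne_top
    · refine ih (Submodule.FG.smul (IsNoetherian.noetherian _) hX) fun a ha x hx => ?_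
      induction hx using Submodule.smul_induction_on' with
      | smul r hr x hx =>
        rw [smul_smul]
        exact hs _ (by rw [pow_succ]; exact Ideal.mul_mem_mul ha hr) x hx
      | add x _ y _ hx hy => rw [smul_add]; exact Y.add_mem hx hy

end TorLength

/-! ### Graded modules over multigraded polynomial rings -/

noncomputable section GradedPoly

set_option linter.unusedSectionVars false

open MvPolynomial IsLocalRing

variable {R σ ι N : Type*} [CommRing R] [DecidableEq ι] {δ : σ → ι} [AddCommGroup N] [Module R N]
  [Module (MvPolynomial σ R) N]

/-- The degree of the variable `X j` is the elementary vector in direction `δ j`. -/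
def dirWeight (δ : σ → ι) (j : σ) : ι → ℤ := Pi.single (δ j) 1

/-- The family `π` consists of the projections to the homogeneous parts of a grading of `N` by
`ι → ℤ` for which `X j` has the elementary degree in direction `δ j`. -/
structure IsGradingProj (δ : σ → ι) (π : (ι → ℤ) → N →ₗ[R] N) : Prop where
  proj_self : ∀ w x, π w (π w x) = π w x
  proj_ne : ∀ w w' x, w ≠ w' → π w (π w' x) = 0
  exists_sum : ∀ x, ∃ s : Finset (ι → ℤ), ∑ w ∈ s, π w x = x
  X_smul : ∀ j w x, (X j : MvPolynomial σ R) • π w x = π (dirWeight δ j + w) ((X j : MvPolynomial σ R) • x)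

/-- A submodule is homogeneous if it contains the homogeneous components of its elements. -/
def IsHomog (π : (ι → ℤ) → N →ₗ[R] N) (A : Submodule (MvPolynomial σ R) N) : Prop :=
  ∀ w, ∀ x ∈ A, π w x ∈ A

namespace IsHomog

variable {π : (ι → ℤ) → N →ₗ[R] N} {A B : Submodule (MvPolynomial σ R) N}

theorem sup (hA : IsHomog π A) (hB : IsHomog π B) : IsHomog π (A ⊔ B) := by
  intro w x hx
  obtain ⟨a, ha, b, hb, rfl⟩ := Submodule.mem_sup.1 hx
  rw [map_add]
  exact Submodule.add_mem_sup (hA w a ha) (hB w b hb)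

theorem inf (hA : IsHomog π A) (hB : IsHomog π B) : IsHomog π (A ⊓ B) :=
  fun w x hx => ⟨hA w x hx.1, hB w x hx.2⟩

theorem bot : IsHomog π (⊥ : Submodule (MvPolynomial σ R) N) := by
  rintro w x rfl
  simp

theorem top : IsHomog π (⊤ : Submodule (MvPolynomial σ R) N) := fun _ _ _ => trivial

end IsHomog

variable [IsScalarTower R (MvPolynomial σ R) N]

/-- The homogeneous part of degree `w` of a submodule. -/
def homogPart (π : (ι → ℤ) → N →ₗ[R] N) (A : Submodule (MvPolynomial σ R) N) (w : ι → ℤ) :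
    Submodule R N :=
  A.restrictScalars R ⊓ LinearMap.eqLocus (π w) LinearMap.id

theorem mem_homogPart {π : (ι → ℤ) → N →ₗ[R] N} {A : Submodule (MvPolynomial σ R) N} {w : ι → ℤ}
    {x : N} : x ∈ homogPart π A w ↔ x ∈ A ∧ π w x = x := Iff.rfl

theorem homogPart_mono {π : (ι → ℤ) → N →ₗ[R] N} {A B : Submodule (MvPolynomial σ R) N} {w : ι → ℤ}
    (h : A ≤ B) : homogPart π A w ≤ homogPart π B w := fun _ hx => ⟨h hx.1, hx.2⟩

section LocalMax

variable [IsLocalRing R]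

/-- The ideal generated by the `s`-th power of the maximal ideal of the coefficient ring. -/
def maxPow (R σ : Type*) [CommRing R] [IsLocalRing R] (s : ℕ) : Ideal (MvPolynomial σ R) :=
  (maximalIdeal R ^ s).map (algebraMap R (MvPolynomial σ R))

theorem maxPow_add (s t : ℕ) : maxPow R σ (s + t) = maxPow R σ s * maxPow R σ t := by
  rw [maxPow, pow_add, Ideal.map_mul]; rfl

theorem maxPow_anti {s t : ℕ} (h : s ≤ t) : maxPow R σ t ≤ maxPow R σ s :=
  Ideal.map_mono (Ideal.pow_le_pow_right h)

/-- The ideal is extended from `R`, so scalars from `R` suffice as generators of the product. -/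
theorem maxPow_smul_induction {A : Submodule (MvPolynomial σ R) N} {s : ℕ} {motive : N → Prop}
    {x : N} (hx : x ∈ maxPow R σ s • A)
    (smul : ∀ a ∈ maximalIdeal R ^ s, ∀ x ∈ A, motive (a • x))
    (add : ∀ x y, motive x → motive y → motive (x + y)) : motive x := by
  have : x ∈ (maximalIdeal R ^ s) • A.restrictScalars R := by
    rw [← Ideal.smul_restrictScalars]; exact hx
  exact Submodule.smul_induction_on this smul (fun x y => add x y)

theorem smul_mem_maxPow_smul {A : Submodule (MvPolynomial σ R) N} {s : ℕ} {a : R}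
    (ha : a ∈ maximalIdeal R ^ s) {x : N} (hx : x ∈ A) : a • x ∈ maxPow R σ s • A := by
  rw [← algebraMap_smul (MvPolynomial σ R) a x]
  exact Submodule.smul_mem_smul (Ideal.mem_map_of_mem _ ha) hx

theorem maxPow_smul_le {A B : Submodule (MvPolynomial σ R) N} {s : ℕ} :
    maxPow R σ s • A ≤ B ↔ ∀ a ∈ maximalIdeal R ^ s, ∀ x ∈ A, a • x ∈ B :=
  ⟨fun h _ ha _ hx => h (smul_mem_maxPow_smul ha hx),
    fun h _ hx => maxPow_smul_induction hx h fun _ _ => B.add_mem⟩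

theorem IsHomog.maxPow_smul {π : (ι → ℤ) → N →ₗ[R] N} {A : Submodule (MvPolynomial σ R) N}
    (hA : IsHomog π A) (s : ℕ) : IsHomog π (maxPow R σ s • A) := by
  intro w x hx
  refine maxPow_smul_induction (motive := fun x => π w x ∈ maxPow R σ s • A) hx ?_ ?_
  · intro a ha x hx
    rw [map_smul]
    exact smul_mem_maxPow_smul ha (hA w x hx)
  · intro x y hx hy
    rw [map_add]
    exact Submodule.add_mem _ hx hy

/-- **Artin-Rees** for the powers of the maximal ideal of the coefficient ring. -/
theorem exists_maxPow_smul_inf_le [IsNoetherianRing R] [Finite σ]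
    {A : Submodule (MvPolynomial σ R) N} (hA : A.FG) (A₂ : Submodule (MvPolynomial σ R) N) :
    ∃ c, ∀ s, maxPow R σ (s + c) • A ⊓ A₂ ≤ maxPow R σ s • A₂ := by
  have : Module.Finite (MvPolynomial σ R) A := Module.Finite.iff_fg.2 hA
  obtain ⟨c, hc⟩ := Ideal.exists_pow_inf_eq_pow_smul
    ((maximalIdeal R).map (algebraMap R (MvPolynomial σ R))) (A₂.submoduleOf A)
  refine ⟨c, fun s => ?_⟩
  have h1 := hc (s + c) (by omega)
  have hp : ∀ n, (maximalIdeal R).map (algebraMap R (MvPolynomial σ R)) ^ n = maxPow R σ n :=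
    fun n => (Ideal.map_pow _ _ _).symm
  rw [hp, hp, hp, Nat.add_sub_cancel] at h1
  have h2 : maxPow R σ (s + c) • A = (maxPow R σ (s + c) • (⊤ : Submodule _ A)).map A.subtype := by
    rw [Submodule.map_smul'', Submodule.map_subtype_top]
  rintro x ⟨hx, hx2⟩
  rw [h2] at hx
  obtain ⟨y, hy, rfl⟩ := hx
  have h3 : y ∈ maxPow R σ s • (maxPow R σ c • ⊤ ⊓ A₂.submoduleOf A) := by
    rw [← h1]; exact ⟨hy, hx2⟩
  have h4 : A.subtype y ∈ (maxPow R σ s • A₂.submoduleOf A).map A.subtype :=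
    ⟨y, Submodule.smul_mono le_rfl inf_le_right h3, rfl⟩
  rw [Submodule.map_smul''] at h4
  refine Submodule.smul_mono le_rfl ?_ h4
  rintro _ ⟨z, hz, rfl⟩
  exact hz

end LocalMax

namespace IsGradingProj

variable {π : (ι → ℤ) → N →ₗ[R] N} (hπ : IsGradingProj δ π)

include hπ

theorem C_smul (r : R) (w : ι → ℤ) (x : N) :
    (C r : MvPolynomial σ R) • π w x = π w ((C r : MvPolynomial σ R) • x) := by
  rw [← algebraMap_eq, algebraMap_smul, algebraMap_smul, map_smul]

theorem monomial_smul (n : σ →₀ ℕ) (r : R) (w : ι → ℤ) (x : N) :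
    monomial n r • π w x = π (Finsupp.weight (dirWeight δ) n + w) (monomial n r • x) := by
  induction n using Finsupp.induction_linear generalizing r w x with
  | zero => simpa using hπ.C_smul r w x
  | add n m hn hm =>
    have : monomial (n + m) r = monomial n r * monomial m (1 : R) := by
      rw [monomial_mul, mul_one]
    rw [this, mul_smul, hm, hn, mul_smul, map_add, add_assoc]
  | single j k =>
    have : monomial (Finsupp.single j k) r = C r * X j ^ k := by
      rw [C_mul_X_pow_eq_monomial]
    rw [this, mul_smul, mul_smul, ← hπ.C_smul]
    congr 1
    rw [Finsupp.weight_single]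
    induction k generalizing w x with
    | zero => simp
    | succ k ih =>
      rw [pow_succ, mul_smul, mul_smul, hπ.X_smul, ih _ _ (by rw [C_mul_X_pow_eq_monomial])]
      congr 2
      rw [succ_nsmul, add_assoc]

theorem smul_proj {g : MvPolynomial σ R} {u : ι → ℤ}
    (hg : IsWeightedHomogeneous (dirWeight δ) g u) (w : ι → ℤ) (x : N) :
    g • π w x = π (u + w) (g • x) := by
  refine IsWeightedHomogeneous.induction_on
    (motive := fun g _ => g • π w x = π (u + w) (g • x)) ?_ ?_ ?_ hg
  · simp
  · intro p q _ _ hp hq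
    rw [add_smul, hp, hq, add_smul, map_add]
  · rintro d r rfl
    exact hπ.monomial_smul d r w x

theorem proj_eq_zero {w w' : ι → ℤ} {x : N} (hx : π w' x = x) (h : w ≠ w') : π w x = 0 := by
  rw [← hx, hπ.proj_ne w w' x h]

/-- For homogeneous `x`, taking components of `g • x` amounts to taking components of `g`. Questions
about cyclic homogeneous submodules thereby become questions about polynomials. -/
theorem proj_smul {a : ι → ℤ} {x : N} (hx : π a x = x) (w : ι → ℤ) (g : MvPolynomial σ R) :
    π w (g • x) = weightedHomogeneousComponent (dirWeight δ) (w - a) g • x := by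
  induction g using MvPolynomial.induction_on' with
  | monomial n r =>
    have hhom := isWeightedHomogeneous_monomial (R := R) (dirWeight δ) n r rfl
    have h1 := hπ.smul_proj hhom a x
    rw [hx] at h1
    by_cases hw : w - a = Finsupp.weight (dirWeight δ) n
    · rw [hw, hhom.weightedHomogeneousComponent_same]
      rw [← hw, sub_add_cancel] at h1
      exact h1.symm
    · rw [hhom.weightedHomogeneousComponent_ne _ hw, zero_smul]
      exact hπ.proj_eq_zero h1.symm (fun h => hw (by rw [h]; abel))
  | add p q hp hq => rw [add_smul, map_add, hp, hq, map_add, add_smul]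

theorem mem_of_forall_proj {A : Submodule (MvPolynomial σ R) N} {x : N} (h : ∀ w, π w x ∈ A) :
    x ∈ A := by
  obtain ⟨s, hs⟩ := hπ.exists_sum x
  rw [← hs]
  exact A.sum_mem fun w _ => h w

theorem isHomog_span_singleton {a : ι → ℤ} {x : N} (hx : π a x = x) :
    IsHomog π (Submodule.span (MvPolynomial σ R) {x}) := by
  intro w y hy
  obtain ⟨g, rfl⟩ := Submodule.mem_span_singleton.1 hy
  rw [hπ.proj_smul hx]
  exact Submodule.mem_span_singleton.2 ⟨_, rfl⟩

/-- A degreewise modular law: in `x = b + c`, replace `b` by its component of degree `w`. The rest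
is a component of `c`, and it lies in `A` because `x` and `b` do. -/
theorem homogPart_inf_sup {A B C : Submodule (MvPolynomial σ R) N} (hB : IsHomog π B)
    (hC : IsHomog π C) (hBA : B ≤ A) (w : ι → ℤ) :
    homogPart π A w ⊓ (B ⊔ C).restrictScalars R ≤
      homogPart π B w ⊔ (A ⊓ C).restrictScalars R := by
  rintro x ⟨⟨hxA, hxw⟩, hx⟩
  replace hxw : π w x = x := hxw
  obtain ⟨b, hb, c, hc, rfl⟩ := Submodule.mem_sup.1 (show x ∈ B ⊔ C from hx)
  rw [← hxw, map_add]
  refine Submodule.add_mem_sup ⟨hB w b hb, hπ.proj_self w b⟩ ⟨?_, hC w c hc⟩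
  have : π w c = (b + c) - π w b := by
    rw [eq_sub_iff_add_eq, add_comm, ← map_add, hxw]
  rw [this]
  exact A.sub_mem hxA (hBA (hB w b hb))

theorem homogPart_span_singleton {a : ι → ℤ} {x : N} (hx : π a x = x) (w : ι → ℤ) :
    homogPart π (Submodule.span (MvPolynomial σ R) {x}) w =
      (weightedHomogeneousSubmodule R (dirWeight δ) (w - a)).map
        ((LinearMap.toSpanSingleton (MvPolynomial σ R) N x).restrictScalars R) := by
  ext y
  constructor
  · rintro ⟨hy, hyw⟩
    obtain ⟨g, rfl⟩ := Submodule.mem_span_singleton.1 (show y ∈ Submodule.span _ {x} from hy)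
    replace hyw : π w (g • x) = g • x := hyw
    rw [hπ.proj_smul hx] at hyw
    exact ⟨_, weightedHomogeneousComponent_mem _ _ _, hyw⟩
  · rintro ⟨g, hg, rfl⟩
    refine ⟨Submodule.mem_span_singleton.2 ⟨g, rfl⟩, ?_⟩
    change π w (g • x) = g • x
    rw [hπ.proj_smul hx, IsWeightedHomogeneous.weightedHomogeneousComponent_same hg]

/-- A finitely generated homogeneous submodule has finitely many homogeneous generators. -/
theorem exists_homog_generators {A : Submodule (MvPolynomial σ R) N} (hA : IsHomog π A)
    (hfg : A.FG) : ∃ T : Finset N, (∀ t ∈ T, ∃ a, π a t = t) ∧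
      Submodule.span (MvPolynomial σ R) (T : Set N) = A := by
  classical
  obtain ⟨S, rfl⟩ := hfg
  choose s hs using hπ.exists_sum
  refine ⟨S.biUnion fun x => (s x).image fun w => π w x, ?_, le_antisymm ?_ ?_⟩
  · intro t ht
    simp only [Finset.mem_biUnion, Finset.mem_image] at ht
    obtain ⟨x, _, w, _, rfl⟩ := ht
    exact ⟨w, hπ.proj_self w x⟩
  · rw [Submodule.span_le]
    intro t ht
    simp only [Finset.coe_biUnion, Set.mem_iUnion, Finset.coe_image] at ht
    obtain ⟨x, hx, w, _, rfl⟩ := ht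
    exact hA w x (Submodule.subset_span hx)
  · rw [Submodule.span_le]
    intro x hx
    rw [← hs x]
    refine Submodule.sum_mem _ fun w hw => Submodule.subset_span ?_
    simp only [Finset.coe_biUnion, Set.mem_iUnion, Finset.coe_image]
    exact ⟨x, hx, w, hw, rfl⟩

theorem exists_sum_of_mem_homogPart {T : Finset N} {a : N → ι → ℤ}
    (ha : ∀ t ∈ T, π (a t) t = t) {w : ι → ℤ} {x : N}
    (hx : x ∈ homogPart π (Submodule.span (MvPolynomial σ R) (T : Set N)) w) :
    ∃ g : N → MvPolynomial σ R, (∀ t, IsWeightedHomogeneous (dirWeight δ) (g t) (w - a t)) ∧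
      ∑ t ∈ T, g t • t = x := by
  obtain ⟨f, -, hf⟩ := Submodule.mem_span_finset.1 hx.1
  refine ⟨fun t => weightedHomogeneousComponent (dirWeight δ) (w - a t) (f t), fun t =>
    weightedHomogeneousComponent_isWeightedHomogeneous _ _, ?_⟩
  rw [← (mem_homogPart.1 hx).2, ← hf, map_sum]
  exact Finset.sum_congr rfl fun t ht => (hπ.proj_smul (ha t ht) w (f t)).symm

end IsGradingProj

section Weights

variable [Fintype σ]

omit [DecidableEq ι] in
theorem weight_dirWeight_apply [DecidableEq ι] (n : σ →₀ ℕ) (i : ι) :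
    Finsupp.weight (dirWeight δ) n i = ∑ j, if δ j = i then (n j : ℤ) else 0 := by
  rw [Finsupp.weight_eq_sum, Finset.sum_apply]
  refine Finset.sum_congr rfl fun j _ => ?_
  simp only [dirWeight, Pi.smul_apply, Pi.single_apply, eq_comm (a := i)]
  split_ifs <;> simp

theorem eq_C_of_isWeightedHomogeneous_zero {g : MvPolynomial σ R}
    (hg : IsWeightedHomogeneous (dirWeight δ) g 0) : g = C (coeff 0 g) := by
  classical
  ext n
  rw [coeff_C]
  split_ifs with h
  · rw [h]
  · by_contra hn
    refine h (Eq.symm (Finsupp.ext fun j => ?_))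
    have h1 := congrFun (hg hn) (δ j)
    rw [weight_dirWeight_apply, Pi.zero_apply, Finset.sum_eq_zero_iff_of_nonneg
      (fun j _ => by split_ifs <;> simp)] at h1
    simpa using h1 j (Finset.mem_univ j)

/-- Every monomial of positive degree in direction `i` is divisible by a variable of that direction.
-/
theorem mem_span_X_of_pos {g : MvPolynomial σ R} {u : ι → ℤ} {i : ι}
    (hg : IsWeightedHomogeneous (dirWeight δ) g u) (hu : 0 < u i) :
    g ∈ Ideal.span {f : MvPolynomial σ R | ∃ j, δ j = i ∧ f = X j} := by
  rw [g.as_sum]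
  refine Ideal.sum_mem _ fun n hn => ?_
  have h1 := congrFun (hg (mem_support_iff.1 hn)) i
  rw [weight_dirWeight_apply] at h1
  obtain ⟨j, -, hj⟩ : ∃ j ∈ Finset.univ, (if δ j = i then (n j : ℤ) else 0) ≠ 0 :=
    Finset.exists_ne_zero_of_sum_ne_zero (by omega)
  simp only [ne_eq, ite_eq_right_iff, Nat.cast_eq_zero, Classical.not_imp] at hj
  have : monomial n (coeff n g) = monomial (n - Finsupp.single j 1) (coeff n g) * X j := by
    rw [X, monomial_mul, mul_one, Finsupp.sub_add_single_one_cancel hj.2]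
  rw [this]
  exact Ideal.mul_mem_left _ _ (Ideal.subset_span ⟨j, hj.1, rfl⟩)

theorem eq_zero_of_isWeightedHomogeneous_neg {g : MvPolynomial σ R} {u : ι → ℤ} {i : ι}
    (hg : IsWeightedHomogeneous (dirWeight δ) g u) (hu : u i < 0) : g = 0 := by
  ext n
  by_contra hn
  have h1 := congrFun (hg hn) i
  rw [weight_dirWeight_apply] at h1
  have : 0 ≤ ∑ j, if δ j = i then (n j : ℤ) else 0 :=
    Finset.sum_nonneg fun j _ => by split_ifs <;> simp
  omega

end Weights

omit [DecidableEq ι] in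
theorem isGradingProj_weightedHomogeneousComponent [DecidableEq ι] (δ : σ → ι) :
    IsGradingProj (R := R) (N := MvPolynomial σ R) δ
      (weightedHomogeneousComponent (dirWeight δ)) where
  proj_self w x := (weightedHomogeneousComponent_isWeightedHomogeneous _
    x).weightedHomogeneousComponent_same
  proj_ne w w' x h := (weightedHomogeneousComponent_isWeightedHomogeneous _
    x).weightedHomogeneousComponent_ne _ h
  exists_sum x := by
    refine ⟨(weightedHomogeneousComponent_finsupp (w := dirWeight δ) x).toFinset, ?_⟩
    conv_rhs => rw [← finsum_weightedHomogeneousComponent (dirWeight δ) x]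
    rw [finsum_eq_sum _ (weightedHomogeneousComponent_finsupp x)]
  X_smul j w x := by
    classical
    induction x using MvPolynomial.induction_on' with
    | add p q hp hq => simp only [map_add, smul_add, hp, hq]
    | monomial n r =>
      have h1 := isWeightedHomogeneous_monomial (R := R) (dirWeight δ) n r rfl
      have h2 := (isWeightedHomogeneous_X R (dirWeight δ) j).mul h1
      rw [smul_eq_mul, smul_eq_mul, weightedHomogeneousComponent_of_mem h1,
        weightedHomogeneousComponent_of_mem h2, mul_ite, mul_zero]
      simp only [add_right_inj]

theorem homogPart_top (w : ι → ℤ) :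
    homogPart (N := MvPolynomial σ R) (weightedHomogeneousComponent (R := R) (dirWeight δ))
      (⊤ : Submodule (MvPolynomial σ R) (MvPolynomial σ R)) w =
      weightedHomogeneousSubmodule R (dirWeight δ) w := by
  ext g
  refine ⟨fun h => ?_, fun h => ⟨trivial, IsWeightedHomogeneous.weightedHomogeneousComponent_same h⟩⟩
  have h2 : weightedHomogeneousComponent (dirWeight δ) w g = g := h.2
  rw [← h2]
  exact weightedHomogeneousComponent_mem _ _ _

namespace IsGradingProj

variable {π : (ι → ℤ) → N →ₗ[R] N} (hπ : IsGradingProj δ π)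

include hπ

/-- The submodule generated by the degree `w` part has finitely many generators lying in that part.
The coefficients needed to reach other elements of degree `w` have degree zero, so they are
constants. -/
theorem homogPart_fg [IsNoetherianRing R] [Fintype σ] {A : Submodule (MvPolynomial σ R) N}
    (hfg : A.FG) (w : ι → ℤ) : (homogPart π A w).FG := by
  have h1 : (Submodule.span (MvPolynomial σ R) (homogPart π A w : Set N)).FG :=
    hfg.of_le (Submodule.span_le.2 fun x hx => hx.1)
  obtain ⟨T, hT, hTs⟩ := (Submodule.fg_span_iff_fg_span_finset_subset _).1 h1
  refine ⟨T, le_antisymm (Submodule.span_le.2 hT) fun x hx => ?_⟩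
  have hx2 : x ∈ homogPart π (Submodule.span (MvPolynomial σ R) (T : Set N)) w :=
    ⟨by rw [← hTs]; exact Submodule.subset_span hx, hx.2⟩
  obtain ⟨g, hg, rfl⟩ := hπ.exists_sum_of_mem_homogPart (a := fun _ => w)
    (fun t ht => (hT ht).2) hx2
  refine Submodule.sum_mem _ fun t ht => ?_
  have h2 := hg t
  rw [sub_self] at h2
  rw [eq_C_of_isWeightedHomogeneous_zero h2, ← algebraMap_eq, algebraMap_smul]
  exact Submodule.smul_mem _ _ (Submodule.subset_span ht)

theorem exists_homogPart_eq_bot [Fintype σ] [Fintype ι] {A : Submodule (MvPolynomial σ R) N}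
    (hA : IsHomog π A) (hfg : A.FG) :
    ∃ c : ℕ, ∀ w : ι → ℤ, ∀ i, w i < -c → homogPart π A w = ⊥ := by
  obtain ⟨T, hT, rfl⟩ := hπ.exists_homog_generators hA hfg
  choose! a ha using hT
  refine ⟨∑ t ∈ T, ∑ i, (a t i).natAbs, fun w i hw => ?_⟩
  rw [eq_bot_iff]
  intro x hx
  obtain ⟨g, hg, rfl⟩ := hπ.exists_sum_of_mem_homogPart ha hx
  refine Submodule.sum_mem _ fun t ht => ?_
  rw [eq_zero_of_isWeightedHomogeneous_neg (hg t) (i := i), zero_smul]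
  · exact Submodule.zero_mem _
  have h1 : ∑ i, (a t i).natAbs ≤ ∑ t ∈ T, ∑ i, (a t i).natAbs :=
    Finset.single_le_sum (f := fun t => ∑ i, (a t i).natAbs) (fun _ _ => Nat.zero_le _) ht
  have h2 : (a t i).natAbs ≤ ∑ i, (a t i).natAbs :=
    Finset.single_le_sum (f := fun i => (a t i).natAbs) (fun _ _ => Nat.zero_le _)
      (Finset.mem_univ i)
  simp only [Pi.sub_apply]
  omega

/-- If all variables in direction `i` multiply `A` into `B`, then the parts of `A` of large degree
in direction `i` are contained in `B`. -/
theorem exists_homogPart_le [Fintype σ] {A B : Submodule (MvPolynomial σ R) N}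
    (hA : IsHomog π A) (hfg : A.FG) (i : ι)
    (h : ∀ j, δ j = i → ∀ x ∈ A, (X j : MvPolynomial σ R) • x ∈ B) :
    ∃ c : ℕ, ∀ w : ι → ℤ, c ≤ w i → homogPart π A w ≤ B.restrictScalars R := by
  obtain ⟨T, hT, rfl⟩ := hπ.exists_homog_generators hA hfg
  choose! a ha using hT
  -- Beyond the degrees of all generators, the `+ 1` makes every coefficient have positive degree in
  -- direction `i`, so each coefficient involves a variable of that direction.
  refine ⟨∑ t ∈ T, (a t i).toNat + 1, fun w hw x hx => ?_⟩
  obtain ⟨g, hg, rfl⟩ := hπ.exists_sum_of_mem_homogPart ha hx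
  refine Submodule.sum_mem _ fun t ht => ?_
  have h1 : (a t i).toNat ≤ ∑ t ∈ T, (a t i).toNat :=
    Finset.single_le_sum (f := fun t => (a t i).toNat) (fun _ _ => Nat.zero_le _) ht
  have h2 := mem_span_X_of_pos (hg t) (i := i) (by simp only [Pi.sub_apply]; omega)
  have h3 : t ∈ Submodule.span (MvPolynomial σ R) (T : Set N) := Submodule.subset_span ht
  change g t • t ∈ B
  generalize g t = f at h2 ⊢
  induction h2 using Submodule.span_induction with
  | mem f hf =>
    obtain ⟨j, hj, rfl⟩ := hf
    exact h j hj t h3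
  | zero => simp
  | add p q _ _ hp hq => rw [add_smul]; exact B.add_mem hp hq
  | smul c p _ hp => rw [smul_assoc]; exact B.smul_mem _ hp

end IsGradingProj

end GradedPoly

/-! ### Growth of numerical functions -/

section Growth

variable {ι κ : Type*} [Fintype ι] [Fintype κ]

/-- The comparison function for growth of order `D`: zero for `D = 0` and `n ^ (D - 1)` for
positive `D`. -/
def growthBound : ℕ → ℕ → ℕ
  | 0, _ => 0
  | D + 1, n => n ^ D

/-- The size of an argument of a numerical function. -/
def argSize (w : ι → ℤ) (s : ℕ) : ℕ := 1 + ∑ i, (w i).toNat + s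

/-- For large arguments, `F` is bounded by a polynomial of degree less than `D`. -/
def HasGrowth (D : ℕ) (F : (ι → ℤ) → ℕ → ℕ∞) : Prop :=
  ∃ C c : ℕ, ∀ w s, (∀ i, (c : ℤ) ≤ w i) → c ≤ s →
    F w s ≤ ((C * growthBound D (argSize w s) : ℕ) : ℕ∞)

theorem growthBound_mono (D : ℕ) {m n : ℕ} (h : m ≤ n) : growthBound D m ≤ growthBound D n := by
  cases D with
  | zero => exact le_rfl
  | succ D => exact Nat.pow_le_pow_left h D

theorem growthBound_mul_le (D K n : ℕ) :
    growthBound D (K * n) ≤ (K + 1) ^ D * growthBound D n := by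
  cases D with
  | zero => simp [growthBound]
  | succ D =>
    simp only [growthBound, mul_pow]
    refine Nat.mul_le_mul_right _ ?_
    calc K ^ D ≤ (K + 1) ^ D := Nat.pow_le_pow_left (Nat.le_succ K) D
      _ ≤ (K + 1) ^ (D + 1) := Nat.pow_le_pow_right (Nat.succ_pos K) (Nat.le_succ D)

theorem mul_growthBound_le (D n : ℕ) : n * growthBound D n ≤ growthBound (D + 1) n := by
  cases D with
  | zero => simp [growthBound]
  | succ D => simp only [growthBound, pow_succ]; rw [mul_comm]

theorem one_le_argSize (w : ι → ℤ) (s : ℕ) : 1 ≤ argSize w s := by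
  unfold argSize; omega

theorem le_argSize (w : ι → ℤ) (s : ℕ) : s < argSize w s := by
  unfold argSize; omega

namespace HasGrowth

variable {D : ℕ} {F G : (ι → ℤ) → ℕ → ℕ∞}

theorem of_le (hG : HasGrowth D G)
    (h : ∃ c : ℕ, ∀ w s, (∀ i, (c : ℤ) ≤ w i) → c ≤ s → F w s ≤ G w s) : HasGrowth D F := by
  obtain ⟨C, c, hc⟩ := hG
  obtain ⟨c', hc'⟩ := h
  refine ⟨C, max c c', fun w s hw hs => (hc' w s (fun i => ?_) ?_).trans (hc w s (fun i => ?_) ?_)⟩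
  · have := hw i; push_cast at this; omega
  · omega
  · have := hw i; push_cast at this; omega
  · omega

theorem mono (hG : HasGrowth D G) (h : ∀ w s, F w s ≤ G w s) : HasGrowth D F :=
  hG.of_le ⟨0, fun w s _ _ => h w s⟩

theorem of_eventually_zero (h : ∃ c : ℕ, ∀ w s, (∀ i, (c : ℤ) ≤ w i) → c ≤ s → F w s = 0) :
    HasGrowth D F := by
  obtain ⟨c, hc⟩ := h
  exact ⟨0, c, fun w s hw hs => by simp [hc w s hw hs]⟩

theorem add (hF : HasGrowth D F) (hG : HasGrowth D G) :
    HasGrowth D fun w s => F w s + G w s := by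
  obtain ⟨C, c, hc⟩ := hF
  obtain ⟨C', c', hc'⟩ := hG
  refine ⟨C + C', max c c', fun w s hw hs => ?_⟩
  rw [add_mul, Nat.cast_add]
  refine add_le_add (hc w s (fun i => ?_) ?_) (hc' w s (fun i => ?_) ?_)
  · have := hw i; push_cast at this; omega
  · omega
  · have := hw i; push_cast at this; omega
  · omega

/-- A substitution that preserves largeness and enlarges the size at most linearly changes only the
constant. -/
theorem comp {G : (κ → ℤ) → ℕ → ℕ∞} (hG : HasGrowth D G) (φ : (ι → ℤ) → ℕ → κ → ℤ)
    (ψ : (ι → ℤ) → ℕ → ℕ) (K : ℕ)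
    (h : ∀ c : ℕ, ∃ c' : ℕ, ∀ w s, (∀ i, (c' : ℤ) ≤ w i) → c' ≤ s →
      (∀ i, (c : ℤ) ≤ φ w s i) ∧ c ≤ ψ w s ∧ argSize (φ w s) (ψ w s) ≤ K * argSize w s) :
    HasGrowth D fun w s => G (φ w s) (ψ w s) := by
  obtain ⟨C, c, hc⟩ := hG
  obtain ⟨c', hc'⟩ := h c
  refine ⟨C * (K + 1) ^ D, c', fun w s hw hs => ?_⟩
  obtain ⟨h1, h2, h3⟩ := hc' w s hw hs
  refine (hc _ _ h1 h2).trans (Nat.cast_le.2 ?_)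
  rw [mul_assoc]
  exact Nat.mul_le_mul_left _ ((growthBound_mono D h3).trans (growthBound_mul_le D K _))

theorem shift (hF : HasGrowth D F) (a : ι → ℤ) (t : ℕ) :
    HasGrowth D fun w s => F (w - a) (s + t) := by
  refine hF.comp (fun w _ => w - a) (fun _ s => s + t) (1 + ∑ i, (a i).natAbs + t) fun c => ?_
  refine ⟨c + ∑ i, (a i).natAbs, fun w s hw hs => ⟨fun i => ?_, by omega, ?_⟩⟩
  · have h1 := hw i
    have h2 := Finset.single_le_sum (f := fun i => (a i).natAbs) (fun _ _ => Nat.zero_le _)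
      (Finset.mem_univ i)
    simp only [Pi.sub_apply] at h2 ⊢
    push_cast at h1
    simp only [← Int.natCast_natAbs] at h1
    have h3 : ((a i).natAbs : ℤ) ≤ ∑ i, ((a i).natAbs : ℤ) := by exact_mod_cast h2
    omega
  · have h4 : ∑ i, ((w - a) i).toNat ≤ ∑ i, (w i).toNat + ∑ i, (a i).natAbs := by
      rw [← Finset.sum_add_distrib]
      refine Finset.sum_le_sum fun i _ => ?_
      simp only [Pi.sub_apply]
      omega
    have h5 := one_le_argSize w s
    calc argSize (w - a) (s + t) ≤ argSize w s + (∑ i, (a i).natAbs + t) := by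
          unfold argSize; omega
      _ ≤ argSize w s + (∑ i, (a i).natAbs + t) * argSize w s := by
          gcongr; exact Nat.le_mul_of_pos_right _ h5
      _ = _ := by ring

theorem of_shift {a : ι → ℤ} (hF : HasGrowth D fun w s => F (w - a) s) : HasGrowth D F := by
  simpa using hF.shift (-a) 0

/-- Divides a bound of order `D + 1` by the size of the argument; this is how a family of `n`
disjoint copies lowers the order of growth. -/
theorem of_mul (hF : HasGrowth (D + 1) fun w s => (argSize w s : ℕ∞) * F w s) :
    HasGrowth D F := by
  obtain ⟨C, c, hc⟩ := hF
  -- Requiring `s ≥ C` makes the size exceed `C`; for `D = 0` a nonzero value would then contradict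
  -- the bound by the constant `C`.
  refine ⟨C, max C c, fun w s hw hs => ?_⟩
  have h1 : (argSize w s : ℕ∞) * F w s ≤ _ :=
    hc w s (fun i => by have := hw i; push_cast at this; omega) (by omega)
  have h2 := le_argSize w s
  have h3 := one_le_argSize w s
  generalize argSize w s = n at h1 h2 h3 ⊢
  have h4 : F w s ≠ ⊤ := by
    rintro h
    rw [h, ENat.mul_top (by simp; omega), top_le_iff] at h1
    exact ENat.natCast_ne_top _ h1
  obtain ⟨l, hl⟩ := ENat.ne_top_iff_exists.1 h4
  rw [← hl] at h1 ⊢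
  have h5 : n * l ≤ C * growthBound (D + 1) n := by exact_mod_cast h1
  refine Nat.cast_le.2 ?_
  cases D with
  | zero =>
    simp only [growthBound, pow_zero, mul_one, mul_zero] at h5 ⊢
    by_contra hl0
    have : n * 1 ≤ C := (Nat.mul_le_mul_left _ (by omega)).trans h5
    omega
  | succ D =>
    simp only [growthBound, pow_succ] at h5 ⊢
    refine Nat.le_of_mul_le_mul_left (c := n) ?_ h3
    calc n * l ≤ C * (n ^ D * n) := h5
      _ = n * (C * n ^ D) := by ring

/-- A function all of whose partial differences have growth of order `D` has growth of order
`D + 1`. -/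
theorem of_differences [DecidableEq ι] (hfin : ∀ w s, F w s ≠ ⊤)
    (hw : ∀ i, ∃ G, HasGrowth D G ∧ ∀ w s, F w s ≤ F (w - Pi.single i 1) s + G w s)
    (hs : ∃ G, HasGrowth D G ∧ ∀ w s, 1 ≤ s → F w (s + 1) ≤ F w s + G w (s + 1)) :
    HasGrowth (D + 1) F := by
  choose G hG hFG using hw
  obtain ⟨G', hG', hFG'⟩ := hs
  choose C c hC using hG
  obtain ⟨C', c', hC'⟩ := hG'
  let C₀ := C' + ∑ i, C i
  -- The extra `1` guarantees the positivity of `s` that the difference inequality in `s` requires.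
  let c₀ := c' + ∑ i, c i + 1
  have hc'' : c' ≤ c₀ := by simp only [c₀]; omega
  have hCi : ∀ i, C i ≤ C₀ := fun i =>
    (Finset.single_le_sum (f := C) (fun _ _ => Nat.zero_le _) (Finset.mem_univ i)).trans
      (Nat.le_add_left _ _)
  have hci : ∀ i, c i ≤ c₀ := fun i =>
    (Finset.single_le_sum (f := c) (fun _ _ => Nat.zero_le _) (Finset.mem_univ i)).trans
      (by simp only [c₀]; omega)
  obtain ⟨l, hl⟩ := ENat.ne_top_iff_exists.1 (hfin (fun _ => (c₀ : ℤ)) c₀)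
  -- Walk from the corner where all arguments equal `c₀` to `(w, s)` in `n` unit steps. By
  -- monotonicity in the size, each step costs at most `C₀ * growthBound D` at the endpoint.
  have key : ∀ (n : ℕ) (w : ι → ℤ) (s : ℕ), (∀ i, (c₀ : ℤ) ≤ w i) → c₀ ≤ s → ∑ i, (w i - c₀).toNat + (s - c₀) = n →
      F w s ≤ ((l + n * (C₀ * growthBound D (argSize w s)) : ℕ) : ℕ∞) := by
    intro n
    induction n with
    | zero =>
      intro w s hw hs hn
      have h1 : s = c₀ := by omega
      have h2 : w = fun _ => (c₀ : ℤ) := by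
        funext i
        have h3 : ∑ i, (w i - c₀).toNat = 0 := by omega
        have h4 := (Finset.sum_eq_zero_iff.1 h3) i (Finset.mem_univ i)
        have h5 := hw i
        omega
      rw [h1, h2, ← hl]
      simp
    | succ n ih =>
      intro w s hw hs hn
      by_cases hs0 : s = c₀
      · have h1 : ∑ i, (w i - c₀).toNat ≠ 0 := by omega
        obtain ⟨i, -, hi⟩ := Finset.exists_ne_zero_of_sum_ne_zero h1
        obtain ⟨w', hw'⟩ : ∃ w' : ι → ℤ, w' = w - Pi.single i 1 := ⟨_, rfl⟩
        have hwi : ∀ k, w' k = if k = i then w k - 1 else w k := by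
          intro k
          simp only [hw', Pi.sub_apply, Pi.single_apply]
          split_ifs <;> simp
        have h2 := ih w' s (fun k => ?_) hs ?_
        · have h0 := hFG i w s
          rw [← hw'] at h0
          refine h0.trans ?_
          have h3 := hC i w s (fun k => le_trans (by exact_mod_cast hci i) (hw k))
            ((hci i).trans hs)
          refine (add_le_add h2 h3).trans ?_
          rw [← Nat.cast_add]
          refine Nat.cast_le.2 ?_
          have h4 : growthBound D (argSize w' s) ≤
              growthBound D (argSize w s) := by
            refine growthBound_mono D ?_
            unfold argSize
            gcongr with k
            rw [hwi]
            split_ifs <;> omega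
          calc _ ≤ l + n * (C₀ * growthBound D (argSize w s)) +
                C₀ * growthBound D (argSize w s) := by
                gcongr
                exact hCi i
            _ = _ := by ring
        · rw [hwi]
          split_ifs with hk
          · subst hk; omega
          · exact hw k
        · have h5 : ∑ k, (w k - c₀).toNat =
              ∑ k, (w' k - c₀).toNat + 1 := by
            rw [← Finset.add_sum_erase Finset.univ (fun k => (w k - (c₀ : ℤ)).toNat)
                (Finset.mem_univ i),
              ← Finset.add_sum_erase Finset.univ (fun k => (w' k - (c₀ : ℤ)).toNat)
                (Finset.mem_univ i)]
            have h6 : ∀ k ∈ Finset.univ.erase i,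
                (w' k - c₀).toNat = (w k - c₀).toNat := by
              intro k hk
              rw [hwi, if_neg (Finset.ne_of_mem_erase hk)]
            rw [Finset.sum_congr rfl h6, hwi, if_pos rfl]
            omega
          omega
      · obtain ⟨s, rfl⟩ : ∃ s', s = s' + 1 := ⟨s - 1, by omega⟩
        have hs' : c₀ ≤ s := by omega
        have h2 := ih w s hw hs' (by omega)
        refine (hFG' w s (by simp only [c₀] at hs'; omega)).trans ?_
        have h3 := hC' w (s + 1) (fun k => le_trans (Nat.cast_le.2 hc'') (hw k))
          (hc''.trans hs)
        refine (add_le_add h2 h3).trans ?_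
        rw [← Nat.cast_add]
        refine Nat.cast_le.2 ?_
        have h4 : growthBound D (argSize w s) ≤ growthBound D (argSize w (s + 1)) :=
          growthBound_mono D (by unfold argSize; omega)
        calc _ ≤ l + n * (C₀ * growthBound D (argSize w (s + 1))) +
              C₀ * growthBound D (argSize w (s + 1)) := by
              gcongr
              exact Nat.le_add_right _ _
          _ = _ := by ring
  refine ⟨l + C₀, c₀, fun w s hw hs => (key _ w s hw hs rfl).trans (Nat.cast_le.2 ?_)⟩
  have h1 : ∑ i, (w i - c₀).toNat + (s - c₀) ≤ argSize w s := by
    have : ∑ i, (w i - c₀).toNat ≤ ∑ i, (w i).toNat :=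
      Finset.sum_le_sum fun i _ => by omega
    unfold argSize; omega
  calc _ ≤ l + argSize w s * (C₀ * growthBound D (argSize w s)) := by gcongr
    _ = l + C₀ * (argSize w s * growthBound D (argSize w s)) := by ring
    _ ≤ l + C₀ * growthBound (D + 1) (argSize w s) := by
        gcongr; exact mul_growthBound_le D _
    _ ≤ l * growthBound (D + 1) (argSize w s) + C₀ * growthBound (D + 1) (argSize w s) := by
        gcongr
        exact Nat.le_mul_of_pos_right _ (Nat.pow_pos (one_le_argSize w s))
    _ = _ := by ring

end HasGrowth

end Growth

/-! ### Hilbert-Samuel functions of graded subquotients -/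

noncomputable section HilbertSamuel

set_option linter.unusedSectionVars false

open MvPolynomial IsLocalRing

variable {R σ ι N : Type*} [CommRing R] [IsLocalRing R] [DecidableEq ι] {δ : σ → ι}
  [AddCommGroup N] [Module R N] [Module (MvPolynomial σ R) N] [IsScalarTower R (MvPolynomial σ R) N]

/-- The Hilbert-Samuel function of `A / B` with respect to the maximal ideal of `R`. -/
def hilbSam (π : (ι → ℤ) → N →ₗ[R] N) (A B : Submodule (MvPolynomial σ R) N) (w : ι → ℤ) (s : ℕ) :
    ℕ∞ :=
  relLength (homogPart π A w) ((B ⊔ maxPow R σ s • A).restrictScalars R)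

/-- The Hilbert-Samuel function of the residue class ring of a homogeneous ideal. -/
def idealHilbSam (δ : σ → ι) (𝔞 : Ideal (MvPolynomial σ R)) (w : ι → ℤ) (s : ℕ) : ℕ∞ :=
  relLength (weightedHomogeneousSubmodule R (dirWeight δ) w)
    ((𝔞 ⊔ maxPow R σ s).restrictScalars R)

/-- The ideal of the polynomials that multiply `x` into `C`. -/
def colonElem (C : Submodule (MvPolynomial σ R) N) (x : N) : Ideal (MvPolynomial σ R) :=
  C.comap (LinearMap.toSpanSingleton (MvPolynomial σ R) N x)

theorem mem_colonElem {C : Submodule (MvPolynomial σ R) N} {x : N} {g : MvPolynomial σ R} :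
    g ∈ colonElem C x ↔ g • x ∈ C := Iff.rfl

theorem idealHilbSam_eq (𝔞 : Ideal (MvPolynomial σ R)) (w : ι → ℤ) (s : ℕ) :
    idealHilbSam δ 𝔞 w s = hilbSam (weightedHomogeneousComponent (dirWeight δ))
      (⊤ : Ideal (MvPolynomial σ R)) 𝔞 w s := by
  rw [idealHilbSam, hilbSam, homogPart_top, Ideal.smul_eq_mul, Ideal.mul_top]

theorem idealHilbSam_mono_right (𝔞 : Ideal (MvPolynomial σ R)) (w : ι → ℤ) {s t : ℕ} (h : s ≤ t) :
    idealHilbSam δ 𝔞 w s ≤ idealHilbSam δ 𝔞 w t :=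
  relLength_anti (sup_le_sup_left (α := Ideal (MvPolynomial σ R)) (maxPow_anti h) _)

variable {π : (ι → ℤ) → N →ₗ[R] N}

theorem hilbSam_self (A : Submodule (MvPolynomial σ R) N) (w : ι → ℤ) (s : ℕ) :
    hilbSam π A A w s = 0 :=
  relLength_eq_zero_iff.2 fun _ hx => Submodule.mem_sup_left hx.1

/-- Monotonicity of Hilbert-Samuel functions up to a shift. -/
theorem exists_hilbSam_le [IsNoetherianRing R] [Finite σ] {A C A₂ C₂ : Submodule (MvPolynomial σ R) N}
    (hA : A.FG) (h₁ : A₂ ≤ A) (h₂ : C ⊓ A₂ ≤ C₂) :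
    ∃ c, ∀ w s, hilbSam π A₂ C₂ w s ≤ hilbSam π A C w (s + c) := by
  -- If `z + y` lies in `A₂` with `z ∈ C` and `y ∈ 𝔪^(s+c) A`, then `y` lies in `A₂ + C`, and
  -- Artin-Rees splits it into pieces of `𝔪^s A₂` and `𝔪^s C`.
  obtain ⟨c, hc⟩ := exists_maxPow_smul_inf_le hA (A₂ ⊔ C)
  refine ⟨c, fun w s => relLength_le (homogPart_mono h₁) ?_⟩
  rintro x ⟨⟨hx, -⟩, hx2⟩
  obtain ⟨z, hz, y, hy, rfl⟩ := Submodule.mem_sup.1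
    (show x ∈ C ⊔ maxPow R σ (s + c) • A from hx2)
  have h3 : y ∈ maxPow R σ s • (A₂ ⊔ C) := by
    refine hc s ⟨hy, ?_⟩
    have : y = (z + y) - z := by abel
    rw [this]
    exact sub_mem (Submodule.mem_sup_left hx) (Submodule.mem_sup_right hz)
  rw [Submodule.smul_sup] at h3
  obtain ⟨y₁, hy₁, y₂, hy₂, rfl⟩ := Submodule.mem_sup.1 h3
  have h4 : z + y₂ ∈ C₂ := by
    refine h₂ ⟨add_mem hz (Submodule.smul_le_right hy₂), ?_⟩
    have : z + y₂ = (z + (y₁ + y₂)) - y₁ := by abel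
    rw [this]
    exact sub_mem hx (Submodule.smul_le_right hy₁)
  have : z + (y₁ + y₂) = (z + y₂) + y₁ := by abel
  change z + (y₁ + y₂) ∈ C₂ ⊔ maxPow R σ s • A₂
  rw [this]
  exact Submodule.add_mem_sup h4 hy₁

/-- The hypotheses make `A₂ / C₂` a subquotient of `A / C`; changing the `𝔪`-adic filtration costs
only a bounded shift of `s`. -/
theorem HasGrowth.hilbSam_of_le [Fintype ι] [IsNoetherianRing R] [Finite σ] {D : ℕ}
    {A C A₂ C₂ : Submodule (MvPolynomial σ R) N} (h : HasGrowth D (hilbSam π A C))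
    (hA : A.FG) (h₁ : A₂ ≤ A) (h₂ : C ⊓ A₂ ≤ C₂) : HasGrowth D (hilbSam π A₂ C₂) := by
  obtain ⟨c, hc⟩ := exists_hilbSam_le (π := π) hA h₁ h₂
  refine (h.shift 0 c).mono fun w s => ?_
  rw [sub_zero]
  exact hc w s

namespace IsGradingProj

variable (hπ : IsGradingProj δ π)

include hπ

/-- Only an inequality: `A / C` induces on `B / C` a filtration that is coarser than the `𝔪`-adic
one. -/
theorem hilbSam_le_add {A B C : Submodule (MvPolynomial σ R) N} (hA : IsHomog π A)
    (hB : IsHomog π B) (hBA : B ≤ A) (hCB : C ≤ B) (w : ι → ℤ) (s : ℕ) :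
    hilbSam π A C w s ≤ hilbSam π A B w s + hilbSam π B C w s := by
  have h1 : (C ⊔ maxPow R σ s • A).restrictScalars R ≤ (B ⊔ maxPow R σ s • A).restrictScalars R :=
    sup_le_sup_right (α := Submodule (MvPolynomial σ R) N) hCB _
  rw [hilbSam, relLength_add h1]
  refine add_le_add le_rfl ?_
  refine (relLength_mono_left (hπ.homogPart_inf_sup hB (hA.maxPow_smul s) hBA w)).trans ?_
  have h2 : (A ⊓ maxPow R σ s • A).restrictScalars R ≤
      (C ⊔ maxPow R σ s • A).restrictScalars R := fun x hx => Submodule.mem_sup_right hx.2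
  rw [relLength_congr (X₂ := homogPart π B w) (by rw [sup_assoc, sup_eq_right.2 h2])]
  refine relLength_anti ?_
  exact sup_le_sup_left (α := Submodule (MvPolynomial σ R) N)
    (Submodule.smul_mono le_rfl hBA) _

/-- Multiplication by `x` identifies the residue ring of the colon ideal, shifted by `a`, with the
cyclic module generated by `x` modulo `C`. -/
theorem hilbSam_sup_span_singleton {C : Submodule (MvPolynomial σ R) N} (hC : IsHomog π C)
    {a : ι → ℤ} {x : N} (hx : π a x = x) (w : ι → ℤ) (s : ℕ) :
    hilbSam π (C ⊔ Submodule.span (MvPolynomial σ R) {x}) C w s =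
      idealHilbSam δ (colonElem C x) (w - a) s := by
  set V := C ⊔ Submodule.span (MvPolynomial σ R) {x} with hV
  have h1 : homogPart π V w ⊔ (C ⊔ maxPow R σ s • V).restrictScalars R =
      homogPart π (Submodule.span (MvPolynomial σ R) {x}) w ⊔
        (C ⊔ maxPow R σ s • V).restrictScalars R := by
    refine le_antisymm (sup_le ?_ le_sup_right)
      (sup_le_sup_right (homogPart_mono le_sup_right) _)
    rintro y ⟨hy, hyw⟩
    obtain ⟨c, hc, z, hz, rfl⟩ := Submodule.mem_sup.1 (show y ∈ V from hy)
    replace hyw : π w (c + z) = c + z := hyw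
    rw [← hyw, map_add, add_comm]
    exact Submodule.add_mem_sup ⟨hπ.isHomog_span_singleton hx w z hz, hπ.proj_self w z⟩
      (Submodule.mem_sup_left (hC w c hc))
  rw [hilbSam, relLength_congr h1, hπ.homogPart_span_singleton hx, relLength_map, idealHilbSam]
  congr 1
  ext g
  change g • x ∈ C ⊔ maxPow R σ s • V ↔ g ∈ colonElem C x ⊔ maxPow R σ s
  constructor
  · intro hg
    have h2 : C ⊔ maxPow R σ s • V ≤
        C ⊔ maxPow R σ s • Submodule.span (MvPolynomial σ R) {x} := by
      rw [hV, Submodule.smul_sup]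
      exact sup_le le_sup_left (sup_le (Submodule.smul_le_right.trans le_sup_left) le_sup_right)
    obtain ⟨c, hc, y, hy, hcy⟩ := Submodule.mem_sup.1 (h2 hg)
    obtain ⟨h, hh, rfl⟩ := Submodule.mem_smul_span_singleton.1 hy
    have : g = (g - h) + h := by abel
    rw [this]
    refine Submodule.add_mem_sup ?_ hh
    rw [mem_colonElem, sub_smul, ← hcy, add_sub_cancel_right]
    exact hc
  · intro hg
    obtain ⟨f, hf, h, hh, rfl⟩ := Submodule.mem_sup.1 hg
    rw [add_smul]
    exact Submodule.add_mem_sup hf (Submodule.smul_mem_smul hh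
      (Submodule.mem_sup_right (Submodule.mem_span_singleton_self x)))

theorem isHomog_colonElem {C : Submodule (MvPolynomial σ R) N} (hC : IsHomog π C)
    {a : ι → ℤ} {x : N} (hx : π a x = x) :
    IsHomog (weightedHomogeneousComponent (R := R) (dirWeight δ)) (colonElem C x) := by
  intro w g hg
  have := hC (w + a) _ (mem_colonElem.1 hg)
  rw [hπ.proj_smul hx, add_sub_cancel_right] at this
  exact this

end IsGradingProj

section HomogPrime

variable [Fintype ι]

theorem isPrime_of_weightedHomogeneous {Γ : Type*} [AddCommMonoid Γ] [LinearOrder Γ]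
    [IsOrderedCancelAddMonoid Γ] (w : σ → Γ) {𝔓 : Ideal (MvPolynomial σ R)}
    (h𝔓 : ∀ v, ∀ g ∈ 𝔓, weightedHomogeneousComponent w v g ∈ 𝔓) (h1 : 𝔓 ≠ ⊤)
    (h : ∀ u v (f g : MvPolynomial σ R), IsWeightedHomogeneous w f u →
      IsWeightedHomogeneous w g v → f * g ∈ 𝔓 → f ∈ 𝔓 ∨ g ∈ 𝔓) : 𝔓.IsPrime := by
  let _ := weightedGradedAlgebra R w
  have hhom : 𝔓.IsHomogeneous (weightedHomogeneousSubmodule R w) := by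
    intro v g hg
    exact (weightedDecomposition.decompose'_apply R w g v).symm ▸ h𝔓 v g hg
  refine hhom.isPrime_of_homogeneous_mem_or_mem h1 ?_
  rintro f g ⟨u, hu⟩ ⟨v, hv⟩ hfg
  exact h u v f g hu hv hfg

/-- A homogeneous ideal is prime if it satisfies the defining condition for homogeneous elements. -/
theorem isPrime_of_homogeneous {𝔓 : Ideal (MvPolynomial σ R)}
    (h𝔓 : IsHomog (weightedHomogeneousComponent (R := R) (dirWeight δ)) 𝔓) (h1 : 𝔓 ≠ ⊤)
    (h : ∀ u v (f g : MvPolynomial σ R), IsWeightedHomogeneous (dirWeight δ) f u →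
      IsWeightedHomogeneous (dirWeight δ) g v → f * g ∈ 𝔓 → f ∈ 𝔓 ∨ g ∈ 𝔓) : 𝔓.IsPrime := by
  classical
  -- The criterion for primality on homogeneous elements needs a linearly ordered grading group, so
  -- the weights are transported to the lexicographic order on `ℤ^ι`.
  let e := Fintype.equivFin ι
  obtain ⟨E⟩ : Nonempty ((ι → ℤ) ≃+ Lex (Fin (Fintype.card ι) → ℤ)) :=
    ⟨{toFun := fun w => toLex fun k => w (e.symm k)
      invFun := fun v k => ofLex v (e k)
      left_inv := fun w => by ext; simp
      right_inv := fun v => by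
        change toLex (fun k => ofLex v (e (e.symm k))) = v
        simp only [Equiv.apply_symm_apply]
        rfl
      map_add' := fun _ _ => rfl }⟩
  let w' : σ → Lex (Fin (Fintype.card ι) → ℤ) := fun j => E (dirWeight δ j)
  have hw : ∀ n : σ →₀ ℕ, Finsupp.weight w' n = E (Finsupp.weight (dirWeight δ) n) := by
    intro n
    rw [Finsupp.weight_apply, Finsupp.weight_apply, map_finsuppSum, Finsupp.sum, Finsupp.sum]
    exact Finset.sum_congr rfl fun j _ => (map_nsmul E _ _).symm
  have hcomp : ∀ v g, weightedHomogeneousComponent (R := R) w' v g =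
      weightedHomogeneousComponent (dirWeight δ) (E.symm v) g := by
    intro v g
    ext n
    rw [coeff_weightedHomogeneousComponent, coeff_weightedHomogeneousComponent, hw]
    simp only [AddEquiv.eq_symm_apply]
  refine isPrime_of_weightedHomogeneous w' (fun v g hg => ?_) h1 fun u v f g hf hg => ?_
  · rw [hcomp]
    exact h𝔓 _ g hg
  · refine h (E.symm u) (E.symm v) f g (fun n hn => ?_) (fun n hn => ?_)
    · rw [AddEquiv.eq_symm_apply, ← hw]
      exact hf hn
    · rw [AddEquiv.eq_symm_apply, ← hw]
      exact hg hn

variable [IsNoetherianRing R] [Fintype σ]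

namespace IsGradingProj

variable (hπ : IsGradingProj δ π)

include hπ

/-- Dévissage: the growth of a subquotient is controlled by homogeneous primes. -/
theorem hasGrowth_hilbSam_of_primes {D : ℕ} {A B : Submodule (MvPolynomial σ R) N} (hfg : A.FG)
    (hA : IsHomog π A) (hB : IsHomog π B) (hBA : B ≤ A)
    (h : ∀ C, IsHomog π C → B ≤ C → C ≤ A → ∀ a x, π a x = x → x ∈ A →
      (colonElem C x).IsPrime →
      IsHomog (weightedHomogeneousComponent (R := R) (dirWeight δ)) (colonElem C x) →
      HasGrowth D (idealHilbSam δ (colonElem C x))) :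
    HasGrowth D (hilbSam π A B) := by
  have hnoeth : IsNoetherian (MvPolynomial σ R) A := isNoetherian_of_fg_of_noetherian A hfg
  -- Take a maximal homogeneous `C` between `B` and `A` for which `C / B` has the wanted growth; if
  -- `C ≠ A`, a cyclic extension with prime colon ideal enlarges it.
  let S : Set (Submodule (MvPolynomial σ R) A) :=
    {C | IsHomog π (C.map A.subtype) ∧ B ≤ C.map A.subtype ∧
      HasGrowth D (hilbSam π (C.map A.subtype) B)}
  have hS : S.Nonempty := by
    refine ⟨B.comap A.subtype, ?_⟩
    have h1 : (B.comap A.subtype).map A.subtype = B := by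
      rw [Submodule.map_comap_eq, Submodule.range_subtype, inf_eq_right.2 hBA]
    simp only [S, Set.mem_ofPred_eq, h1]
    exact ⟨hB, le_rfl, HasGrowth.of_eventually_zero ⟨0, fun w s _ _ => hilbSam_self B w s⟩⟩
  obtain ⟨C', ⟨hC, hBC, hgr⟩, hmax⟩ := (wellFounded_gt (α := Submodule _ A)).has_min S hS
  set C := C'.map A.subtype with hCdef
  have hCA : C ≤ A := Submodule.map_subtype_le A C'
  by_cases hCA' : C = A
  · rwa [hCA'] at hgr
  exfalso
  -- A maximal colon ideal of a homogeneous element outside `C` is prime, by the usual argument for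
  -- associated primes.
  let T : Set (Ideal (MvPolynomial σ R)) :=
    {𝔞 | ∃ a x, π a x = x ∧ x ∈ A ∧ x ∉ C ∧ 𝔞 = colonElem C x}
  have hT : T.Nonempty := by
    obtain ⟨x, hx, hxC⟩ := SetLike.exists_of_lt (lt_of_le_of_ne hCA hCA')
    obtain ⟨w, hw⟩ : ∃ w, π w x ∉ C := by
      by_contra! hcon
      exact hxC (hπ.mem_of_forall_proj hcon)
    exact ⟨_, w, π w x, hπ.proj_self w x, hA w x hx, hw, rfl⟩
  obtain ⟨_, ⟨a, x, hx, hxA, hxC, rfl⟩, hmax2⟩ :=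
    (wellFounded_gt (α := Ideal (MvPolynomial σ R))).has_min T hT
  have hhom := hπ.isHomog_colonElem hC hx
  have hprime : (colonElem C x).IsPrime := by
    refine isPrime_of_homogeneous hhom ?_ ?_
    · intro h1
      have : (1 : MvPolynomial σ R) ∈ colonElem C x := by rw [h1]; trivial
      rw [mem_colonElem, one_smul] at this
      exact hxC this
    · intro u v f g hf hg hfg
      by_contra! hcon
      have hfx : π (v + a) (g • x) = g • x := by
        rw [← hπ.smul_proj hg, hx]
      refine hmax2 (colonElem C (g • x)) ⟨_, g • x, hfx, A.smul_mem g hxA, hcon.2, rfl⟩ ?_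
      refine lt_of_le_of_ne ?_ ?_
      · intro q hq
        rw [mem_colonElem, smul_comm]
        exact C.smul_mem g hq
      · intro heq
        refine hcon.1 ?_
        rw [heq, mem_colonElem, ← mul_smul]
        exact hfg
  have hgr2 := h C hC hBC hCA a x hx hxA hprime hhom
  have hV : (C ⊔ Submodule.span (MvPolynomial σ R) {x}) ≤ A :=
    sup_le hCA (Submodule.span_le.2 (by simpa using hxA))
  have hVhom : IsHomog π (C ⊔ Submodule.span (MvPolynomial σ R) {x}) :=
    hC.sup (hπ.isHomog_span_singleton hx)
  have hgr3 : HasGrowth D (hilbSam π (C ⊔ Submodule.span (MvPolynomial σ R) {x}) B) := by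
    refine ((hgr2.shift a 0).add hgr).mono fun w s => ?_
    refine (hπ.hilbSam_le_add hVhom hC le_sup_left hBC w s).trans ?_
    rw [hπ.hilbSam_sup_span_singleton hC hx]
    rfl
  have hmapcomap : ((C ⊔ Submodule.span (MvPolynomial σ R) {x}).comap A.subtype).map A.subtype =
      C ⊔ Submodule.span (MvPolynomial σ R) {x} := by
    rw [Submodule.map_comap_eq, Submodule.range_subtype, inf_eq_right.2 hV]
  refine hmax ((C ⊔ Submodule.span (MvPolynomial σ R) {x}).comap A.subtype) ?_ ?_
  · simp only [S, Set.mem_ofPred_eq, hmapcomap]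
    exact ⟨hVhom, hBC.trans le_sup_left, hgr3⟩
  · refine lt_of_le_of_ne ?_ ?_
    · rw [← Submodule.map_le_iff_le_comap]
      exact le_sup_left
    · intro heq
      refine hxC ?_
      rw [hCdef, heq, hmapcomap]
      exact Submodule.mem_sup_right (Submodule.mem_span_singleton_self x)

end IsGradingProj

end HomogPrime

end HilbertSamuel

/-! ### Drop of growth and additivity of torsion lengths -/

noncomputable section Additivity

set_option linter.unusedSectionVars false

open MvPolynomial IsLocalRing

variable {R σ ι N : Type*} [CommRing R] [IsLocalRing R] [IsNoetherianRing R] [Fintype σ]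
  [DecidableEq ι] [Fintype ι] {δ : σ → ι}

/-- An ideal is relevant if in every direction some variable is not contained in it. -/
def IsRelevant (δ : σ → ι) (𝔓 : Ideal (MvPolynomial σ R)) : Prop :=
  ∀ i, ∃ j, δ j = i ∧ X j ∉ 𝔓

/-- If the ideal contains all variables of some direction, it contains everything of positive degree
in that direction. -/
theorem hasGrowth_of_not_isRelevant {𝔓 : Ideal (MvPolynomial σ R)} (h : ¬ IsRelevant δ 𝔓) (D : ℕ) :
    HasGrowth D (idealHilbSam δ 𝔓) := by
  simp only [IsRelevant, not_forall, not_exists, not_and, not_not] at h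
  obtain ⟨i, hi⟩ := h
  refine HasGrowth.of_eventually_zero ⟨1, fun w s hw _ => relLength_eq_zero_iff.2 fun g hg => ?_⟩
  refine Submodule.mem_sup_left ?_
  have h1 := mem_span_X_of_pos (i := i) hg (by have := hw i; omega)
  refine (Ideal.span_le.2 ?_) h1
  rintro _ ⟨j, hj, rfl⟩
  exact hi j hj

/-- A nonzerodivisor modulo `𝔞` stays one modulo the powers of `𝔪`, up to a bounded loss in the
exponent: apply Artin-Rees to `𝔞 + (f)`. -/
theorem exists_colon_sup_maxPow {𝔞 : Ideal (MvPolynomial σ R)} {f : MvPolynomial σ R}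
    (hf : ∀ g, f * g ∈ 𝔞 → g ∈ 𝔞) :
    ∃ c, ∀ s g, f * g ∈ 𝔞 ⊔ maxPow R σ (s + c) → g ∈ 𝔞 ⊔ maxPow R σ s := by
  obtain ⟨c, hc⟩ := exists_maxPow_smul_inf_le (R := R) (σ := σ) (N := MvPolynomial σ R)
    (A := ⊤) (IsNoetherian.noetherian _) (𝔞 ⊔ Ideal.span {f})
  refine ⟨c, fun s g hg => ?_⟩
  obtain ⟨a, ha, m, hm, ham⟩ := Submodule.mem_sup.1 hg
  have h1 : m ∈ maxPow R σ s • (𝔞 ⊔ Ideal.span {f}) := by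
    refine hc s ⟨by rwa [Ideal.smul_eq_mul, Ideal.mul_top], ?_⟩
    have : m = f * g - a := by rw [← ham]; ring
    rw [this]
    exact sub_mem (Submodule.mem_sup_right (Ideal.mul_mem_right _ _
      (Ideal.mem_span_singleton_self f))) (Submodule.mem_sup_left ha)
  rw [Submodule.smul_sup] at h1
  obtain ⟨m₁, hm₁, m₂, hm₂, rfl⟩ := Submodule.mem_sup.1 h1
  obtain ⟨q, hq, rfl⟩ := Submodule.mem_smul_span_singleton.1 hm₂
  have h2 : f * (g - q) = a + m₁ := by
    rw [smul_eq_mul] at ham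
    rw [mul_sub, ← ham]; ring
  have h3 : g - q ∈ 𝔞 := hf _ (h2 ▸ add_mem ha (Submodule.smul_le_right hm₁))
  have : g = (g - q) + q := by ring
  rw [this]
  exact Submodule.add_mem_sup h3 hq

theorem map_mulLeft_le {f : MvPolynomial σ R} {d : ι → ℤ}
    (hd : IsWeightedHomogeneous (dirWeight δ) f d) (u : ι → ℤ) :
    (weightedHomogeneousSubmodule R (dirWeight δ) u).map (LinearMap.mulLeft R f) ≤
      weightedHomogeneousSubmodule R (dirWeight δ) (d + u) := by
  rintro _ ⟨g, hg, rfl⟩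
  exact hd.mul hg

theorem idealHilbSam_le_relLength_map {𝔞 : Ideal (MvPolynomial σ R)} {f : MvPolynomial σ R}
    {s t : ℕ} (h : ∀ g, f * g ∈ 𝔞 ⊔ maxPow R σ t → g ∈ 𝔞 ⊔ maxPow R σ s) (u : ι → ℤ) :
    idealHilbSam δ 𝔞 u s ≤
      relLength ((weightedHomogeneousSubmodule R (dirWeight δ) u).map (LinearMap.mulLeft R f))
        ((𝔞 ⊔ maxPow R σ t).restrictScalars R) := by
  rw [relLength_map]
  exact relLength_anti fun g hg => h g hg

/-- Multiplication by a homogeneous non-zero-divisor makes the growth of a residue class ring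
drop. -/
theorem HasGrowth.idealHilbSam_drop {D : ℕ} {𝔞 𝔓 : Ideal (MvPolynomial σ R)} [h𝔓 : 𝔓.IsPrime]
    (hrel : IsRelevant δ 𝔓) (hle : 𝔞 ≤ 𝔓) {f : MvPolynomial σ R} {d : ι → ℤ}
    (hd : IsWeightedHomogeneous (dirWeight δ) f d) (hd0 : ∀ i, 0 ≤ d i) (hf𝔓 : f ∈ 𝔓)
    (hf : ∀ g, f * g ∈ 𝔞 → g ∈ 𝔞) (hgr : HasGrowth (D + 1) (idealHilbSam δ 𝔞)) :
    HasGrowth D (idealHilbSam δ 𝔓) := by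
  choose j hj hj𝔓 using hrel
  -- A monomial of the same degree as `f` in variables outside `𝔓`. Multiplication by it compares
  -- the values for `𝔓` along multiples of `d`.
  let y : MvPolynomial σ R := ∏ i, X (j i) ^ (d i).toNat
  have hy : IsWeightedHomogeneous (dirWeight δ) y d := by
    have h1 := IsWeightedHomogeneous.prod Finset.univ (w := dirWeight δ)
      (fun i => (X (j i) : MvPolynomial σ R) ^ (d i).toNat)
      (fun i => (d i).toNat • dirWeight δ (j i))
      (fun i _ => (isWeightedHomogeneous_X R _ _).pow _)
    convert h1 using 1
    funext i
    rw [Finset.sum_apply, Finset.sum_eq_single i]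
    · simp [dirWeight, hj, hd0]
    · intro k _ hk
      simp [dirWeight, hj, Ne.symm hk]
    · simp
  have hy𝔓 : ∀ g, y * g ∈ 𝔓 → g ∈ 𝔓 := by
    intro g hg
    refine (h𝔓.mem_or_mem hg).resolve_left fun hy => ?_
    obtain ⟨i, -, hi⟩ := (h𝔓.prod_mem_iff).1 hy
    exact hj𝔓 i (h𝔓.mem_of_pow_mem _ hi)
  obtain ⟨c₁, hc₁⟩ := exists_colon_sup_maxPow hf
  obtain ⟨c₂, hc₂⟩ := exists_colon_sup_maxPow hy𝔓
  let c := c₁ + c₂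
  have hstep𝔓 : ∀ u s, idealHilbSam δ 𝔓 u s ≤ idealHilbSam δ 𝔓 (d + u) (s + c) := fun u s => by
    refine (idealHilbSam_le_relLength_map (hc₂ s) u).trans ?_
    refine (relLength_mono_left (map_mulLeft_le hy u)).trans ?_
    exact idealHilbSam_mono_right 𝔓 _ (by omega)
  -- Since `f ∈ 𝔓`, the multiples of `f` modulo `𝔞` contribute to the kernel of the passage to `𝔓`;
  -- since `f` is a nonzerodivisor, they account for a shifted copy of the values for `𝔞`.
  have hstep𝔞 : ∀ u s, idealHilbSam δ 𝔓 (d + u) (s + c) + idealHilbSam δ 𝔞 u s ≤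
      idealHilbSam δ 𝔞 (d + u) (s + c) := fun u s => by
    have h1 : (𝔞 ⊔ maxPow R σ (s + c)).restrictScalars R ≤
        (𝔓 ⊔ maxPow R σ (s + c)).restrictScalars R :=
      sup_le_sup_right (α := Ideal (MvPolynomial σ R)) hle _
    rw [idealHilbSam, idealHilbSam, idealHilbSam, relLength_add h1]
    refine add_le_add le_rfl ?_
    have h2 := idealHilbSam_le_relLength_map (δ := δ) (𝔞 := 𝔞) (f := f) (s := s) (t := s + c)
      (fun g hg => hc₁ s g (sup_le_sup_left (α := Ideal (MvPolynomial σ R))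
        (maxPow_anti (by omega)) _ hg)) u
    refine h2.trans (relLength_mono_left (le_inf (map_mulLeft_le hd u) ?_))
    rintro _ ⟨g, -, rfl⟩
    exact Submodule.mem_sup_left (Ideal.mul_mem_right _ _ hf𝔓)
  have hiter𝔓 : ∀ n u s, idealHilbSam δ 𝔓 u s ≤ idealHilbSam δ 𝔓 (n • d + u) (s + n * c) := by
    intro n u s
    induction n with
    | zero => simp
    | succ n ih =>
      refine ih.trans ((hstep𝔓 _ _).trans_eq ?_)
      congr 1
      · rw [succ_nsmul]; abel
      · ring
  have hiter : ∀ (n : ℕ) (u : ι → ℤ) (s : ℕ), (n : ℕ∞) * idealHilbSam δ 𝔓 u s ≤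
      idealHilbSam δ 𝔞 (n • d + u) (s + n * c) := by
    intro n u s
    induction n with
    | zero => simp
    | succ n ih =>
      have h1 := hstep𝔞 (n • d + u) (s + n * c)
      have h2 := hiter𝔓 (n + 1) u s
      have e1 : d + (n • d + u) = (n + 1) • d + u := by rw [succ_nsmul]; abel
      have e2 : s + n * c + c = s + (n + 1) * c := by ring
      rw [e1, e2] at h1
      refine le_trans ?_ h1
      rw [Nat.cast_succ, add_mul, one_mul, add_comm]
      exact add_le_add h2 ih
  -- Iterate as many times as the size of the argument: the size of the new argument stays linear in
  -- the old one, while the values for `𝔓` gain the factor needed to divide.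
  refine HasGrowth.of_mul (HasGrowth.mono (hgr.comp (fun u s => argSize u s • d + u)
    (fun u s => s + argSize u s * c) (1 + ∑ i, (d i).toNat + c) ?_)
    fun u s => hiter (argSize u s) u s)
  intro c'
  refine ⟨c', fun u s hu hs => ⟨fun i => ?_, by omega, ?_⟩⟩
  · have h1 : 0 ≤ argSize u s • d i := nsmul_nonneg (hd0 i) _
    have h2 := hu i
    simp only [Pi.add_apply, Pi.smul_apply]
    omega
  · have h1 : ∑ i, ((argSize u s • d + u) i).toNat ≤
        argSize u s * ∑ i, (d i).toNat + ∑ i, (u i).toNat := by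
      rw [Finset.mul_sum, ← Finset.sum_add_distrib]
      refine Finset.sum_le_sum fun i _ => ?_
      have h4 : (argSize u s • d + u) i = argSize u s * d i + u i := by
        rw [Pi.add_apply, Pi.smul_apply, nsmul_eq_mul]
      rw [h4]
      have h3 : (argSize u s * d i : ℤ) ≤ ((argSize u s * (d i).toNat : ℕ) : ℤ) := by
        push_cast
        gcongr
        exact Int.self_le_toNat _
      omega
    calc argSize (argSize u s • d + u) (s + argSize u s * c)
        ≤ 1 + (argSize u s * ∑ i, (d i).toNat + ∑ i, (u i).toNat) + (s + argSize u s * c) := by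
          rw [argSize]; omega
      _ = (1 + ∑ i, (u i).toNat + s) + argSize u s * (∑ i, (d i).toNat + c) := by ring
      _ = argSize u s + argSize u s * (∑ i, (d i).toNat + c) := rfl
      _ = _ := by ring

variable [AddCommGroup N] [Module R N] [Module (MvPolynomial σ R) N]
  [IsScalarTower R (MvPolynomial σ R) N] {π : (ι → ℤ) → N →ₗ[R] N}

/-- The submodule of elements that a power of the maximal ideal of `R` multiplies into `C`. -/
def polySaturation (C : Submodule (MvPolynomial σ R) N) : Submodule (MvPolynomial σ R) N where
  __ := maxSaturation (C.restrictScalars R)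
  smul_mem' := by
    rintro g x ⟨s, hs⟩
    refine ⟨s, fun a ha => ?_⟩
    rw [smul_comm]
    exact C.smul_mem g (hs a ha)

theorem mem_polySaturation {C : Submodule (MvPolynomial σ R) N} {x : N} :
    x ∈ polySaturation C ↔ ∃ s : ℕ, ∀ a ∈ maximalIdeal R ^ s, a • x ∈ C := Iff.rfl

theorem le_polySaturation (C : Submodule (MvPolynomial σ R) N) : C ≤ polySaturation C :=
  fun _ hx => ⟨0, fun a _ => Submodule.smul_of_tower_mem C a hx⟩

theorem polySaturation_mono {B C : Submodule (MvPolynomial σ R) N} (h : B ≤ C) :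
    polySaturation B ≤ polySaturation C :=
  fun _ ⟨s, hs⟩ => ⟨s, fun a ha => h (hs a ha)⟩

theorem IsHomog.polySaturation {C : Submodule (MvPolynomial σ R) N} (hC : IsHomog π C) :
    IsHomog π (polySaturation C) := by
  rintro w x ⟨s, hs⟩
  exact ⟨s, fun a ha => by rw [← map_smul]; exact hC w _ (hs a ha)⟩

/-- One exponent works for all of `A` because it works for finitely many generators. -/
theorem exists_maxPow_smul_le {A C : Submodule (MvPolynomial σ R) N} (hA : A.FG)
    (h : A ≤ polySaturation C) : ∃ s, maxPow R σ s • A ≤ C := by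
  obtain ⟨T, rfl⟩ := hA
  have h' : ∀ t ∈ T, ∃ s : ℕ, ∀ a ∈ maximalIdeal R ^ s, a • t ∈ C :=
    fun t ht => h (Submodule.subset_span ht)
  choose! s hs using h'
  refine ⟨∑ t ∈ T, s t, maxPow_smul_le.2 fun a ha x hx => ?_⟩
  induction hx using Submodule.span_induction with
  | mem t ht =>
    exact hs t ht a (Ideal.pow_le_pow_right
      (Finset.single_le_sum (f := s) (fun _ _ => Nat.zero_le _) ht) ha)
  | zero => simp
  | add x y _ _ hx hy => rw [smul_add]; exact C.add_mem hx hy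
  | smul g x _ hx => rw [smul_comm]; exact C.smul_mem g hx

theorem homogPart_inf_polySaturation (A C : Submodule (MvPolynomial σ R) N) (w : ι → ℤ) :
    homogPart π A w ⊓ maxSaturation (C.restrictScalars R) =
      homogPart π (A ⊓ polySaturation C) w := by
  ext x
  constructor
  · rintro ⟨⟨h1, h2⟩, h3⟩
    exact ⟨⟨h1, h3⟩, h2⟩
  · rintro ⟨⟨h1, h3⟩, h2⟩
    exact ⟨⟨h1, h2⟩, h3⟩

/-- For finitely generated modules, the length of the torsion of `A / B` is bounded by the
Hilbert-Samuel function. -/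
theorem exists_torLength_le_hilbSam {A B : Submodule (MvPolynomial σ R) N} (hA : A.FG)
    (hBA : B ≤ A) : ∃ c, ∀ w s, c ≤ s →
      torLength (homogPart π A w) (B.restrictScalars R) ≤ hilbSam π A B w s := by
  obtain ⟨s₀, hs₀⟩ := exists_maxPow_smul_le (A := A ⊓ polySaturation B) (C := B)
    (hA.of_le inf_le_left) inf_le_right
  obtain ⟨c, hc⟩ := exists_maxPow_smul_inf_le hA (A ⊓ polySaturation B)
  refine ⟨s₀ + c, fun w s hs => relLength_le inf_le_left ?_⟩
  rw [homogPart_inf_polySaturation]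
  rintro x ⟨⟨hx, -⟩, hx2⟩
  obtain ⟨b, hb, y, hy, rfl⟩ := Submodule.mem_sup.1 (show x ∈ B ⊔ maxPow R σ s • A from hx2)
  refine B.add_mem hb (hs₀ (hc s₀ ⟨Submodule.smul_mono (maxPow_anti hs) le_rfl hy, ?_⟩))
  have : y = (b + y) - b := by abel
  rw [this]
  exact sub_mem hx ⟨hBA hb, le_polySaturation B hb⟩

theorem HasGrowth.torLength {D : ℕ} {A B : Submodule (MvPolynomial σ R) N}
    (h : HasGrowth D (hilbSam π A B)) (hA : A.FG) (hBA : B ≤ A) :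
    HasGrowth D fun w _ => torLength (homogPart π A w) (B.restrictScalars R) := by
  obtain ⟨c, hc⟩ := exists_torLength_le_hilbSam (π := π) hA hBA
  exact h.of_le ⟨c, fun w s _ hs => hc w s hs⟩

namespace IsGradingProj

variable (hπ : IsGradingProj δ π)

include hπ

/-- A relevant homogeneous prime either has small growth, or it is minimal in the support in the
sense that powers of its homogeneous elements locally annihilate. -/
theorem hasGrowth_or_exists_smul_mem {D : ℕ} {A Z : Submodule (MvPolynomial σ R) N}
    (hgr : HasGrowth (D + 1) (hilbSam π A Z)) (hA : A.FG) (hZ : IsHomog π Z) (hZA : Z ≤ A)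
    {𝔓 : Ideal (MvPolynomial σ R)} [h𝔓 : 𝔓.IsPrime] (hrel : IsRelevant δ 𝔓)
    {f : MvPolynomial σ R} {d : ι → ℤ} (hd : IsWeightedHomogeneous (dirWeight δ) f d)
    (hd0 : ∀ i, 0 ≤ d i) (hf𝔓 : f ∈ 𝔓) {a : ι → ℤ} {x : N} (hx : π a x = x) (hxA : x ∈ A) :
    HasGrowth D (idealHilbSam δ 𝔓) ∨ ∃ h ∉ 𝔓, ∃ k, h • f ^ k • x ∈ Z := by
  by_cases hcon : ∃ h ∉ 𝔓, ∃ k, h • f ^ k • x ∈ Z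
  · exact Or.inr hcon
  left
  push Not at hcon
  -- Once the chain of colon ideals of `f ^ k • x` is stationary, `f` is a nonzerodivisor modulo its
  -- limit. By the assumption on `h`, the limit lies in `𝔓`.
  let e : ℕ →o Ideal (MvPolynomial σ R) :=
    ⟨fun k => colonElem Z (f ^ k • x), monotone_nat_of_le_succ fun k g hg => by
      rw [mem_colonElem, pow_succ', mul_smul, smul_comm]
      exact Z.smul_mem f hg⟩
  obtain ⟨k, hk⟩ := (monotone_stabilizes_iff_noetherian (R := MvPolynomial σ R)
    (M := MvPolynomial σ R)).2 inferInstance e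
  have hy : ∃ b, π b (f ^ k • x) = f ^ k • x :=
    ⟨k • d + a, by rw [← hπ.smul_proj (hd.pow k), hx]⟩
  obtain ⟨b, hb⟩ := hy
  have hle : colonElem Z (f ^ k • x) ≤ 𝔓 := by
    intro h hh
    by_contra hh𝔓
    exact hcon h hh𝔓 k hh
  have hf : ∀ g, f * g ∈ colonElem Z (f ^ k • x) → g ∈ colonElem Z (f ^ k • x) := by
    intro g hg
    have h1 : e k = e (k + 1) := hk (k + 1) (Nat.le_succ k)
    change g ∈ e k
    rw [h1]
    change g • f ^ (k + 1) • x ∈ Z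
    rw [mem_colonElem, mul_smul] at hg
    rwa [pow_succ', mul_smul, smul_comm]
  -- The residue ring of the limit ideal embeds, up to a shift, into `A / Z` and inherits its
  -- growth.
  have h1 : HasGrowth (D + 1)
      (hilbSam π (Z ⊔ Submodule.span (MvPolynomial σ R) {f ^ k • x}) Z) :=
    hgr.hilbSam_of_le hA (sup_le hZA (by
      rw [Submodule.span_singleton_le_iff_mem]; exact A.smul_mem _ hxA)) inf_le_left
  have h2 : HasGrowth (D + 1) (idealHilbSam δ (colonElem Z (f ^ k • x))) := by
    refine HasGrowth.of_shift (a := b) (h1.mono fun w s => ?_)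
    rw [hπ.hilbSam_sup_span_singleton hZ hb]
  exact h2.idealHilbSam_drop hrel hle hd hd0 hf𝔓 hf

/-- Torsion is left exact along `B/C ⊆ A/C → A/B`. The last term measures the torsion of `A/B` that
does not lift to torsion of `A/C`. -/
theorem torLength_add {A B C : Submodule (MvPolynomial σ R) N} (hA : IsHomog π A)
    (hB : IsHomog π B) (hC : IsHomog π C) (hBA : B ≤ A) (hCB : C ≤ B) (w : ι → ℤ) :
    torLength (homogPart π A w) (B.restrictScalars R) +
        torLength (homogPart π B w) (C.restrictScalars R) =
      torLength (homogPart π A w) (C.restrictScalars R) +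
        relLength (homogPart π (A ⊓ polySaturation B) w)
          ((B ⊔ (A ⊓ polySaturation C)).restrictScalars R) := by
  have h1 : torLength (homogPart π A w) (C.restrictScalars R) =
      relLength (homogPart π (A ⊓ polySaturation C) w) (B.restrictScalars R) +
        torLength (homogPart π B w) (C.restrictScalars R) := by
    rw [torLength, torLength, homogPart_inf_polySaturation, homogPart_inf_polySaturation,
      relLength_add (Z := B.restrictScalars R) (fun x hx => hCB hx)]
    congr 2
    ext x
    constructor
    · rintro ⟨⟨⟨_, h2⟩, h3⟩, h4⟩
      exact ⟨⟨h4, h2⟩, h3⟩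
    · rintro ⟨⟨h4, h2⟩, h3⟩
      exact ⟨⟨⟨hBA h4, h2⟩, h3⟩, h4⟩
  have h2 : torLength (homogPart π A w) (B.restrictScalars R) =
      relLength (homogPart π (A ⊓ polySaturation B) w)
          ((B ⊔ (A ⊓ polySaturation C)).restrictScalars R) +
      relLength (homogPart π (A ⊓ polySaturation C) w) (B.restrictScalars R) := by
    rw [torLength, homogPart_inf_polySaturation,
      relLength_add (Z := (B ⊔ (A ⊓ polySaturation C)).restrictScalars R)
        (fun x hx => Submodule.mem_sup_left hx)]
    congr 1
    have hCB' : A ⊓ polySaturation C ≤ A ⊓ polySaturation B :=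
      inf_le_inf le_rfl (polySaturation_mono hCB)
    refine le_antisymm ?_ (relLength_mono_left (le_inf (homogPart_mono hCB')
      fun x hx => Submodule.mem_sup_right hx.1))
    rw [sup_comm B]
    refine (relLength_mono_left (hπ.homogPart_inf_sup (hA.inf hC.polySaturation) hB hCB'
      w)).trans_eq (relLength_congr ?_)
    rw [sup_assoc]
    congr 1
    exact sup_eq_right.2 fun x hx => hx.2
  rw [h1, h2]
  ring

/-- A relevant prime of the defect contains `𝔪`. If its growth did not drop, every element of `𝔪`
would act nilpotently on `A/C` locally at the prime, so torsion of `A/B` would already be torsion of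
`A/C` there and the defect would vanish. -/
theorem hasGrowth_torLength_defect {D : ℕ} {A B C : Submodule (MvPolynomial σ R) N}
    (hfg : A.FG) (hA : IsHomog π A) (hB : IsHomog π B) (hC : IsHomog π C) (hBA : B ≤ A)
    (hCB : C ≤ B) (hgr : HasGrowth (D + 1) (hilbSam π A C)) :
    HasGrowth D fun w _ => relLength (homogPart π (A ⊓ polySaturation B) w)
      ((B ⊔ (A ⊓ polySaturation C)).restrictScalars R) := by
  have hfg' : (A ⊓ polySaturation B).FG := hfg.of_le inf_le_left
  obtain ⟨s₀, hs₀⟩ := exists_maxPow_smul_le hfg' inf_le_right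
  have hle : B ⊔ (A ⊓ polySaturation C) ≤ A ⊓ polySaturation B :=
    sup_le (le_inf hBA (le_polySaturation B)) (inf_le_inf le_rfl (polySaturation_mono hCB))
  suffices h : HasGrowth D (hilbSam π (A ⊓ polySaturation B) (B ⊔ (A ⊓ polySaturation C))) by
    refine h.of_le ⟨s₀, fun w s _ hs => relLength_anti ?_⟩
    intro x hx
    have hx' : x ∈ (B ⊔ (A ⊓ polySaturation C)) ⊔ maxPow R σ s • (A ⊓ polySaturation B) := hx
    refine (sup_le le_rfl ?_ : _ ≤ B ⊔ (A ⊓ polySaturation C)) hx'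
    exact ((Submodule.smul_mono (maxPow_anti hs) le_rfl).trans hs₀).trans le_sup_left
  refine hπ.hasGrowth_hilbSam_of_primes hfg' (hA.inf hB.polySaturation)
    (hB.sup (hA.inf hC.polySaturation)) hle ?_
  intro C₁ hC₁ hBC₁ hC₁A a x hx hxA h𝔓 hhom
  by_cases hrel : IsRelevant δ (colonElem C₁ x)
  swap
  · exact hasGrowth_of_not_isRelevant hrel D
  classical
  by_contra hng
  obtain ⟨s, hs⟩ := mem_polySaturation.1 hxA.2
  -- Some power of `𝔪` carries `x` into `B`, so each constant `r ∈ 𝔪` lies in the prime. With growth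
  -- `D` excluded, the dichotomy leaves only local nilpotence of `r`.
  have hr : ∀ r ∈ maximalIdeal R, ∃ h ∉ colonElem C₁ x, ∃ k,
      h • (MvPolynomial.C r : MvPolynomial σ R) ^ k • x ∈ C := by
    intro r hr
    refine (hπ.hasGrowth_or_exists_smul_mem hgr hfg hC (hCB.trans hBA) hrel
      (isWeightedHomogeneous_C (dirWeight δ) r) (fun i => le_rfl) ?_ hx hxA.1).resolve_left hng
    refine h𝔓.mem_of_pow_mem s ?_
    rw [mem_colonElem, ← map_pow, ← algebraMap_eq, algebraMap_smul]
    exact hBC₁ (Submodule.mem_sup_left (hs _ (Ideal.pow_mem_pow hr s)))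
  choose! h hh k hk using hr
  obtain ⟨T, hT⟩ : (maximalIdeal R).FG := IsNoetherian.noetherian _
  have hTm : ∀ t ∈ T, t ∈ maximalIdeal R := fun t ht => hT ▸ Submodule.subset_span ht
  let H : MvPolynomial σ R := ∏ t ∈ T, h t
  have hH : H ∉ colonElem C₁ x := by
    intro hcon
    obtain ⟨t, ht, ht'⟩ := h𝔓.prod_mem_iff.1 hcon
    exact hh t (hTm t ht) ht'
  -- The annihilator in `R` of `H • x` modulo `C`; it contains a power of `𝔪`. So `H • x` lies in
  -- the saturation of `C`, hence in `C₁`, although `H` is outside the prime.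
  let 𝔟 : Ideal R := (C.restrictScalars R).comap (LinearMap.toSpanSingleton R N (H • x))
  have hrad : maximalIdeal R ≤ 𝔟.radical := by
    rw [← hT]
    refine Ideal.span_le.2 fun t ht => ⟨k t, ?_⟩
    change t ^ k t • H • x ∈ C
    rw [← algebraMap_smul (MvPolynomial σ R), algebraMap_eq, map_pow, smul_comm]
    simp only [H]
    rw [← Finset.prod_erase_mul _ _ ht, mul_smul]
    exact C.smul_mem _ (hk t (hTm t ht))
  obtain ⟨n, hn⟩ := Ideal.exists_pow_le_of_le_radical_of_fg hrad (IsNoetherian.noetherian _)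
  refine hH (hBC₁ (Submodule.mem_sup_right ⟨A.smul_mem H hxA.1, n, fun a ha => hn ha⟩))

end IsGradingProj

end Additivity

/-! ### Growth and chains of homogeneous primes -/

noncomputable section PrimeChains

set_option linter.unusedSectionVars false

open MvPolynomial IsLocalRing

variable {R σ ι N : Type*} [CommRing R] [IsLocalRing R] [IsNoetherianRing R] [Fintype σ]
  [DecidableEq ι] [Fintype ι] {δ : σ → ι}

theorem relLength_homogPart_lt_top [AddCommGroup N] [Module R N] [Module (MvPolynomial σ R) N]
    [IsScalarTower R (MvPolynomial σ R) N] {π : (ι → ℤ) → N →ₗ[R] N} (hπ : IsGradingProj δ π)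
    {A B : Submodule (MvPolynomial σ R) N} (hA : A.FG) {s : ℕ} (hs : maxPow R σ s • A ≤ B)
    (w : ι → ℤ) : relLength (homogPart π A w) (B.restrictScalars R) < ⊤ :=
  relLength_lt_top (hπ.homogPart_fg hA w) s fun a ha _ hx => maxPow_smul_le.1 hs a ha _ hx.1

theorem idealHilbSam_ne_top (𝔞 : Ideal (MvPolynomial σ R)) (w : ι → ℤ) (s : ℕ) :
    idealHilbSam δ 𝔞 w s ≠ ⊤ := by
  rw [idealHilbSam_eq]
  exact (relLength_homogPart_lt_top (isGradingProj_weightedHomogeneousComponent δ)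
    (IsNoetherian.noetherian _) le_sup_right w).ne

/-- A prime that is not the start of a strict chain of more than `D` relevant homogeneous primes. -/
def PrimeChainBound (δ : σ → ι) : ℕ → Ideal (MvPolynomial σ R) → Prop
  | 0, 𝔓 => ¬ IsRelevant δ 𝔓
  | D + 1, 𝔓 => ¬ IsRelevant δ 𝔓 ∨ ∀ 𝔔 : Ideal (MvPolynomial σ R), 𝔓 < 𝔔 → 𝔔.IsPrime →
      IsHomog (weightedHomogeneousComponent (R := R) (dirWeight δ)) 𝔔 → PrimeChainBound δ D 𝔔

/-- The residue ring of `𝔞 + (f)` is the cokernel of multiplication by `f` on that of `𝔞`. Separate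
exponents `s` and `t` allow for `f` raising the `𝔪`-adic order. -/
theorem idealHilbSam_le_add {𝔞 : Ideal (MvPolynomial σ R)}
    (h𝔞 : IsHomog (weightedHomogeneousComponent (R := R) (dirWeight δ)) 𝔞)
    {f : MvPolynomial σ R} {d : ι → ℤ} (hd : IsWeightedHomogeneous (dirWeight δ) f d) {s t : ℕ}
    (hst : ∀ g ∈ maxPow R σ t, g * f ∈ maxPow R σ s) (w : ι → ℤ) :
    idealHilbSam δ 𝔞 w s ≤
      idealHilbSam δ 𝔞 (w - d) t + idealHilbSam δ (𝔞 ⊔ Ideal.span {f}) w s := by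
  have hπ := isGradingProj_weightedHomogeneousComponent (R := R) δ
  have hf : weightedHomogeneousComponent (dirWeight δ) d f = f :=
    hd.weightedHomogeneousComponent_same
  have h1 : (𝔞 ⊔ maxPow R σ s).restrictScalars R ≤
      ((𝔞 ⊔ Ideal.span {f}) ⊔ maxPow R σ s).restrictScalars R :=
    sup_le_sup_right (α := Ideal (MvPolynomial σ R)) le_sup_left _
  have hmax : IsHomog (weightedHomogeneousComponent (R := R) (dirWeight δ)) (maxPow R σ s) := by
    have := (IsHomog.top (π := weightedHomogeneousComponent (R := R)
      (dirWeight δ))).maxPow_smul (R := R) (σ := σ) s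
    rwa [Ideal.smul_eq_mul, Ideal.mul_top] at this
  rw [idealHilbSam, relLength_add h1, add_comm]
  refine add_le_add ?_ le_rfl
  have e : (𝔞 ⊔ Ideal.span {f}) ⊔ maxPow R σ s = Ideal.span {f} ⊔ (𝔞 ⊔ maxPow R σ s) := by
    rw [sup_comm 𝔞, sup_assoc]
  rw [e, ← homogPart_top]
  refine (relLength_mono_left (hπ.homogPart_inf_sup (hπ.isHomog_span_singleton hf)
    (h𝔞.sup hmax) le_top w)).trans ?_
  rw [relLength_congr (X₂ := homogPart _ (Ideal.span {f}) w) (by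
    rw [sup_assoc]
    congr 1
    exact sup_eq_right.2 fun x hx => hx.2)]
  have h2 := hπ.homogPart_span_singleton hf w
  change relLength (homogPart _ (Submodule.span (MvPolynomial σ R) {f}) w) _ ≤ _
  rw [h2, relLength_map]
  refine relLength_anti ?_
  intro g hg
  obtain ⟨a, ha, m, hm, rfl⟩ := Submodule.mem_sup.1 (show g ∈ 𝔞 ⊔ maxPow R σ t from hg)
  change (a + m) * f ∈ 𝔞 ⊔ maxPow R σ s
  rw [add_mul]
  exact Submodule.add_mem_sup (Ideal.mul_mem_right _ _ ha) (hst m hm)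

/-- Differences in each direction are bounded using residue rings of `𝔓 + (f)` with `f` a variable,
or a constant from `𝔪`, outside `𝔓`. Such rings involve only strictly larger primes, so their order
of growth is one less by induction. -/
theorem PrimeChainBound.hasGrowth {D : ℕ} :
    ∀ {𝔓 : Ideal (MvPolynomial σ R)} [_h𝔓 : 𝔓.IsPrime],
      IsHomog (weightedHomogeneousComponent (R := R) (dirWeight δ)) 𝔓 → PrimeChainBound δ D 𝔓 →
      HasGrowth D (idealHilbSam δ 𝔓) := by
  have hπ := isGradingProj_weightedHomogeneousComponent (R := R) δ
  induction D with
  | zero => exact fun _ h => hasGrowth_of_not_isRelevant h 0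
  | succ D ih =>
    intro 𝔓 h𝔓 hhom hb
    by_cases hrel : IsRelevant δ 𝔓
    swap
    · exact hasGrowth_of_not_isRelevant hrel _
    replace hb := hb.resolve_left (not_not.2 hrel)
    have key : ∀ (f : MvPolynomial σ R) (d : ι → ℤ), IsWeightedHomogeneous (dirWeight δ) f d →
        f ∉ 𝔓 → HasGrowth D (idealHilbSam δ (𝔓 ⊔ Ideal.span {f})) := by
      intro f d hd hf
      have hf' : weightedHomogeneousComponent (dirWeight δ) d f = f :=
        hd.weightedHomogeneousComponent_same
      have := hπ.hasGrowth_hilbSam_of_primes (D := D) (A := ⊤) (B := 𝔓 ⊔ Ideal.span {f})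
        (IsNoetherian.noetherian _) IsHomog.top (hhom.sup (hπ.isHomog_span_singleton hf')) le_top ?_
      · exact this.mono fun w s => (idealHilbSam_eq _ w s).le
      · intro C _ hBC _ a x _ _ hp hch
        -- The prime found by dévissage contains `𝔓` and `f`, hence is strictly larger than `𝔓`.
        have hle : C ≤ colonElem C x := fun g hg => Ideal.mul_mem_right _ C hg
        refine ih hch (hb _ (lt_of_le_of_ne ((le_sup_left.trans hBC).trans hle) ?_) hp hch)
        rintro heq
        refine hf ?_
        rw [heq]
        exact hle (hBC (Submodule.mem_sup_right (Ideal.mem_span_singleton_self f)))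
    refine HasGrowth.of_differences (idealHilbSam_ne_top 𝔓) (fun i => ?_) ?_
    · obtain ⟨j, hj, hj𝔓⟩ := hrel i
      have hX := isWeightedHomogeneous_X R (dirWeight δ) j
      refine ⟨_, key (X j) _ hX hj𝔓, fun w s => ?_⟩
      have := idealHilbSam_le_add hhom hX (s := s) (t := s)
        (fun g hg => Ideal.mul_mem_right _ _ hg) w
      rwa [dirWeight, hj] at this
    -- A constant from `𝔪` outside `𝔓` carries `𝔪^s` into `𝔪^(s+1)`. If there is none, then `𝔪 ⊆ 𝔓`
    -- and the function is independent of `s` for `s ≥ 1`.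
    · by_cases hm : ∃ r ∈ maximalIdeal R, (C r : MvPolynomial σ R) ∉ 𝔓
      · obtain ⟨r, hr, hr𝔓⟩ := hm
        have hC := isWeightedHomogeneous_C (dirWeight δ) r
        refine ⟨_, key (C r) _ hC hr𝔓, fun w s _ => ?_⟩
        have := idealHilbSam_le_add hhom hC (s := s + 1) (t := s) (fun g hg => by
          rw [maxPow_add]
          refine Ideal.mul_mem_mul hg ?_
          rw [maxPow, pow_one]
          exact Ideal.mem_map_of_mem _ hr) w
        rwa [sub_zero] at this
      · push Not at hm
        refine ⟨fun _ _ => 0, HasGrowth.of_eventually_zero ⟨0, fun _ _ _ _ => rfl⟩,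
          fun w s hs => ?_⟩
        rw [add_zero]
        refine relLength_anti ?_
        have h1 : maxPow R σ s ≤ 𝔓 := by
          rw [maxPow, Ideal.map_le_iff_le_comap]
          exact (Ideal.pow_le_self (by omega)).trans hm
        intro g hg
        have : g ∈ 𝔓 := (sup_le le_rfl h1 : 𝔓 ⊔ maxPow R σ s ≤ 𝔓) hg
        exact Submodule.mem_sup_left this

theorem exists_ltSeries_of_not_primeChainBound {D : ℕ} :
    ∀ {𝔓 : Ideal (MvPolynomial σ R)} (h𝔓 : 𝔓.IsPrime)
      (hhom : IsHomog (weightedHomogeneousComponent (R := R) (dirWeight δ)) 𝔓),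
      ¬ PrimeChainBound δ D 𝔓 → ∃ hrel : IsRelevant δ 𝔓,
        ∃ l : LTSeries {𝔔 : Ideal (MvPolynomial σ R) // 𝔔.IsPrime ∧
          IsHomog (weightedHomogeneousComponent (R := R) (dirWeight δ)) 𝔔 ∧ IsRelevant δ 𝔔},
          l.head = ⟨𝔓, h𝔓, hhom, hrel⟩ ∧ l.length = D := by
  induction D with
  | zero =>
    intro 𝔓 h𝔓 hhom hb
    refine ⟨not_not.1 hb, RelSeries.singleton _ ⟨𝔓, h𝔓, hhom, not_not.1 hb⟩, ?_, rfl⟩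
    rfl
  | succ D ih =>
    intro 𝔓 h𝔓 hhom hb
    simp only [PrimeChainBound, not_or, not_not, not_forall] at hb
    obtain ⟨hrel, 𝔔, hlt, hp, hh, hb⟩ := hb
    obtain ⟨hrel', l, hl, hlen⟩ := ih hp hh hb
    refine ⟨hrel, l.cons ⟨𝔓, h𝔓, hhom, hrel⟩ ?_, ?_, ?_⟩
    · rw [hl]
      exact hlt
    · exact RelSeries.head_cons _ _ _
    · rw [RelSeries.cons_length, hlen]

theorem hasGrowth_hilbSam_of_primeChainBound [AddCommGroup N] [Module R N]
    [Module (MvPolynomial σ R) N] [IsScalarTower R (MvPolynomial σ R) N]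
    {π : (ι → ℤ) → N →ₗ[R] N} (hπ : IsGradingProj δ π) {D : ℕ}
    {A : Submodule (MvPolynomial σ R) N} (hfg : A.FG) (hA : IsHomog π A)
    (h : ∀ 𝔓 : Ideal (MvPolynomial σ R), 𝔓.IsPrime →
      IsHomog (weightedHomogeneousComponent (R := R) (dirWeight δ)) 𝔓 →
      (∀ g, (∀ x ∈ A, g • x = 0) → g ∈ 𝔓) → PrimeChainBound δ D 𝔓) :
    HasGrowth D (hilbSam π A ⊥) := by
  refine hπ.hasGrowth_hilbSam_of_primes hfg hA IsHomog.bot bot_le ?_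
  intro C _ _ _ a x _ hxA hp hhom
  refine (h _ hp hhom fun g hg => ?_).hasGrowth hhom
  rw [mem_colonElem, hg x hxA]
  exact C.zero_mem

end PrimeChains

/-! ### Eventually polynomial functions -/

noncomputable section EventuallyPolynomial

open MvPolynomial

variable {ι : Type*}

theorem exists_univariate_antidifference (m : ℕ) :
    ∃ S : Polynomial ℚ, ∀ x : ℚ, S.eval x - S.eval (x - 1) = x ^ m := by
  -- Bernoulli polynomials satisfy `B_{m+1}(1 + x) - B_{m+1}(x) = (m + 1) x ^ m`.
  refine ⟨Polynomial.C ((m + 1 : ℚ)⁻¹) * (Polynomial.bernoulli (m + 1)).comp (1 + Polynomial.X),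
    fun x => ?_⟩
  have h := Polynomial.bernoulli_eval_one_add (m + 1) x
  simp only [Polynomial.eval_mul, Polynomial.eval_C, Polynomial.eval_comp, Polynomial.eval_add,
    Polynomial.eval_one, Polynomial.eval_X, add_sub_cancel]
  rw [h]
  have : (m + 1 : ℚ) ≠ 0 := by positivity
  field_simp
  push_cast
  simp

theorem exists_antidifference [DecidableEq ι] (i : ι) (Q : MvPolynomial ι ℚ) :
    ∃ P : MvPolynomial ι ℚ, ∀ w : ι → ℚ,
      eval w P - eval (w - Pi.single i 1) P = eval w Q := by
  induction Q using MvPolynomial.induction_on' with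
  | add p q hp hq =>
    obtain ⟨P₁, h₁⟩ := hp
    obtain ⟨P₂, h₂⟩ := hq
    refine ⟨P₁ + P₂, fun w => ?_⟩
    rw [map_add, map_add, map_add, ← h₁, ← h₂]
    ring
  | monomial n c =>
    obtain ⟨S, hS⟩ := exists_univariate_antidifference (n i)
    refine ⟨monomial (n.erase i) c * Polynomial.aeval (X i) S, fun w => ?_⟩
    have h1 : ∀ v : ι → ℚ, eval v (Polynomial.aeval (X i : MvPolynomial ι ℚ) S) = S.eval (v i) := by
      intro v
      have := Polynomial.aeval_algHom_apply (aeval v : MvPolynomial ι ℚ →ₐ[ℚ] ℚ) (X i) S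
      rw [aeval_X] at this
      rw [← Polynomial.coe_aeval_eq_eval, this]
      rfl
    have h2 : eval (w - Pi.single i 1) (monomial (n.erase i) c) =
        eval w (monomial (n.erase i) c) := by
      rw [eval_monomial, eval_monomial]
      congr 1
      refine Finset.prod_congr rfl fun k hk => ?_
      have hki : k ≠ i := by
        rintro rfl
        simp at hk
      simp [hki]
    have h3 : monomial n c = monomial (n.erase i) c * X i ^ n i := by
      rw [X_pow_eq_monomial, monomial_mul, mul_one, Finsupp.erase_add_single]
    rw [map_mul, map_mul, h1, h1, h2, ← mul_sub, Pi.sub_apply, Pi.single_eq_same, hS, h3, map_mul,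
      map_pow, eval_X]

/-- A function all of whose partial differences are eventually polynomial is eventually
polynomial. -/
theorem exists_polynomial_of_differences [Fintype ι] [DecidableEq ι] {F : (ι → ℤ) → ℚ} {c : ℤ}
    (h : ∀ i, ∃ Q : MvPolynomial ι ℚ, ∀ w : ι → ℤ, (∀ k, c ≤ w k) →
      F w - F (w - Pi.single i 1) = eval (fun k => (w k : ℚ)) Q) :
    ∃ P : MvPolynomial ι ℚ, ∀ w : ι → ℤ, (∀ k, c ≤ w k) →
      F w = eval (fun k => (w k : ℚ)) P := by
  -- `T` is the set of free coordinates; the remaining ones are frozen at `c`.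
  suffices H : ∀ T : Finset ι, ∃ P : MvPolynomial ι ℚ, ∀ w : ι → ℤ, (∀ k, c ≤ w k) →
      (∀ k ∉ T, w k = c) → F w = eval (fun k => (w k : ℚ)) P by
    obtain ⟨P, hP⟩ := H Finset.univ
    exact ⟨P, fun w hw => hP w hw (by simp)⟩
  intro T
  induction T using Finset.induction_on with
  | empty =>
    refine ⟨C (F fun _ => c), fun w _ hw => ?_⟩
    rw [eval_C]
    congr 1
    exact funext fun k => hw k (by simp)
  | insert i T _ ih =>
    obtain ⟨P, hP⟩ := ih
    obtain ⟨Q, hQ⟩ := h i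
    obtain ⟨A, hA⟩ := exists_antidifference i Q
    -- `A` has the same differences in direction `i` as `F`, so `F - A` does not depend on `w i`. It
    -- may be evaluated at `w i = c`, where `P` applies; the substitution `bind₁` does this.
    refine ⟨A + bind₁ (Function.update X i (C (c : ℚ))) (P - A), fun w hw hwT => ?_⟩
    have key : ∀ n, c ≤ n → F (Function.update w i n) -
        eval (fun k => ((Function.update w i n k : ℤ) : ℚ)) A = F (Function.update w i c) -
        eval (fun k => ((Function.update w i c k : ℤ) : ℚ)) A := by
      intro n hn
      induction n, hn using Int.leInduction with
      | base => rfl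
      | succ n hn ihn =>
        rw [← ihn]
        have hge : ∀ k, c ≤ Function.update w i (n + 1) k := by
          intro k
          by_cases hk : k = i
          · subst hk; simp; omega
          · simp [hk, hw k]
        have h1 := hQ (Function.update w i (n + 1)) hge
        rw [← hA] at h1
        have h2 : Function.update w i (n + 1) - Pi.single i 1 = Function.update w i n := by
          funext k
          by_cases hk : k = i
          · subst hk; simp
          · simp [hk]
        have h3 : (fun k => ((Function.update w i (n + 1) k : ℤ) : ℚ)) - Pi.single i 1 =
            fun k => ((Function.update w i n k : ℤ) : ℚ) := by
          funext k
          by_cases hk : k = i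
          · subst hk; simp
          · simp [hk]
        rw [h2, h3] at h1
        linarith
    have h1 := key (w i) (hw i)
    rw [Function.update_eq_self] at h1
    have h2 := hP (Function.update w i c) (fun k => ?_) (fun k hk => ?_)
    · have h3 : eval (fun k => (w k : ℚ)) (bind₁ (Function.update X i (C (c : ℚ))) (P - A)) =
          eval (fun k => ((Function.update w i c k : ℤ) : ℚ)) (P - A) := by
        have := aeval_bind₁ (R := ℚ) (fun k => (w k : ℚ)) (Function.update X i (C (c : ℚ))) (P - A)
        have hfun : (fun j => aeval (fun k => (w k : ℚ))
            (Function.update X i (C (c : ℚ)) j : MvPolynomial ι ℚ)) =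
            fun k => ((Function.update w i c k : ℤ) : ℚ) := by
          funext k
          by_cases hk : k = i
          · subst hk; simp
          · simp [hk]
        rw [hfun] at this
        rw [← coe_aeval_eq_eval, ← coe_aeval_eq_eval]
        exact this
      rw [map_add, h3, map_sub, ← h2]
      linarith
    · by_cases hk : k = i
      · subst hk; simp
      · simp [hk, hw k]
    · by_cases hki : k = i
      · subst hki; simp
      · simp only [Function.update_of_ne hki]
        exact hwT k (by simp [hki, hk])

/-- A polynomial whose values grow with order `D` has degree less than `D`. -/
theorem sum_lt_of_growthBound [Fintype ι] {P : MvPolynomial ι ℚ} {D C c : ℕ}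
    (h : ∀ w : ι → ℕ, (∀ i, c ≤ w i) →
      |eval (fun i => (w i : ℚ)) P| ≤ C * growthBound D (1 + ∑ i, w i)) {γ : ι →₀ ℕ}
    (hγ : coeff γ P ≠ 0) : ∑ i, γ i < D := by
  by_contra! hD
  have hP : P ≠ 0 := by
    rintro rfl
    simp at hγ
  set d := P.totalDegree with hd
  have hDd : D ≤ d := by
    refine hD.trans ?_
    have := le_totalDegree (mem_support_iff.2 hγ)
    rwa [Finsupp.sum_fintype _ _ fun _ => rfl] at this
  have hH : homogeneousComponent d P = 0 := by
    refine MvPolynomial.funext_set (fun _ => (fun n : ℕ => (n : ℚ)) '' Set.Ici (max c 1))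
      (fun _ => (Set.Ici_infinite _).image Nat.cast_injective.injOn) ?_
    intro x hx
    choose b hb hbx using fun i => hx i (Set.mem_univ i)
    obtain rfl : (fun i => (b i : ℚ)) = x := funext hbx
    rw [map_zero]
    -- The restriction of `P` to the ray through `b`; its coefficient of degree `d` is the top form
    -- of `P` at `b`, which the growth bound forces to vanish.
    let q : Polynomial ℚ := ∑ e ∈ Finset.range (d + 1),
      Polynomial.monomial e (eval (fun i => (b i : ℚ)) (homogeneousComponent e P))
    have hqcoeff : q.coeff d = eval (fun i => (b i : ℚ)) (homogeneousComponent d P) := by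
      simp only [q, Polynomial.finsetSum_coeff, Polynomial.coeff_monomial]
      rw [Finset.sum_ite_eq' (Finset.range (d + 1)) d, if_pos (Finset.self_mem_range_succ d)]
    have hq : ∀ t : ℕ, q.eval (t : ℚ) = eval (fun i => ((t * b i : ℕ) : ℚ)) P := by
      intro t
      conv_rhs => rw [← sum_homogeneousComponent P, map_sum]
      simp only [q, Polynomial.eval_finsetSum, Polynomial.eval_monomial]
      refine Finset.sum_congr rfl fun e _ => ?_
      rw [eval_eq', eval_eq', Finset.sum_mul]
      refine Finset.sum_congr rfl fun m hm => ?_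
      have h1 : ∑ i, m i = e := by
        by_contra hne
        rw [mem_support_iff, coeff_homogeneousComponent, if_neg] at hm
        · exact hm rfl
        · rwa [Finsupp.degree_eq_sum]
      have h2 : ∏ i, ((t * b i : ℕ) : ℚ) ^ m i = (t : ℚ) ^ e * ∏ i, (b i : ℚ) ^ m i := by
        simp only [Nat.cast_mul, mul_pow, Finset.prod_mul_distrib, Finset.prod_pow_eq_pow_sum, h1]
      rw [h2]
      ring
    have hbound : ∀ t : ℕ, 1 ≤ t → |q.eval (t : ℚ)| ≤ C * growthBound D (1 + t * ∑ i, b i) := by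
      intro t ht
      rw [hq, Finset.mul_sum]
      refine h (fun i => t * b i) fun i => ?_
      have h1 : max c 1 ≤ b i := hb i
      calc c ≤ 1 * b i := by omega
        _ ≤ t * b i := Nat.mul_le_mul_right _ ht
    rw [← hqcoeff]
    cases D with
    | zero =>
      have : q = 0 := by
        refine Polynomial.eq_zero_of_infinite_isRoot q
          (((Set.Ici_infinite 1).image (f := fun n : ℕ => (n : ℚ))
            Nat.cast_injective.injOn).mono ?_)
        rintro _ ⟨t, ht, rfl⟩
        have := hbound t ht
        simpa [growthBound] using this
      rw [this, Polynomial.coeff_zero]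
    | succ D =>
      by_contra hne
      have hdeg : (Polynomial.X ^ D : Polynomial ℚ).degree < q.degree := by
        refine lt_of_lt_of_le ?_ (Polynomial.le_degree_of_ne_zero hne)
        rw [Polynomial.degree_X_pow]
        exact_mod_cast hDd
      have ht := (Polynomial.abs_div_tendsto_atTop_atTop_of_degree_gt q (Polynomial.X ^ D) hdeg
        (pow_ne_zero _ Polynomial.X_ne_zero)).comp (tendsto_natCast_atTop_atTop (R := ℚ))
      let K : ℚ := C * (1 + ∑ i, b i : ℕ) ^ D
      obtain ⟨t, ht1, ht2⟩ := ((Filter.eventually_ge_atTop 1).and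
        (ht.eventually_gt_atTop K)).exists
      have h1 := hbound t ht1
      have htpos : (0 : ℚ) < (t : ℚ) ^ D := by positivity
      simp only [Function.comp_apply, Polynomial.eval_pow, Polynomial.eval_X, abs_div,
        abs_of_pos htpos] at ht2
      rw [lt_div_iff₀ htpos] at ht2
      have h2 : (1 + t * ∑ i, b i) ^ D ≤ (1 + ∑ i, b i) ^ D * t ^ D := by
        rw [← mul_pow]
        refine Nat.pow_le_pow_left ?_ D
        nlinarith
      have h3 : (C * growthBound (D + 1) (1 + t * ∑ i, b i) : ℚ) ≤ K * (t : ℚ) ^ D := by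
        simp only [K, growthBound, mul_assoc]
        gcongr
        exact_mod_cast h2
      linarith
  obtain ⟨m, hm, hmd⟩ := Finset.exists_mem_eq_sup P.support (support_nonempty.2 hP)
    fun s => s.sum fun _ e => e
  have h1 := congrArg (coeff m) hH
  rw [coeff_homogeneousComponent, if_pos, coeff_zero] at h1
  · exact mem_support_iff.1 hm h1
  · rw [hd, Finsupp.degree_apply]
    exact hmd.symm

end EventuallyPolynomial

/-! ### Hilbert polynomials of graded modules -/

noncomputable section HilbertPolynomial

open MvPolynomial IsLocalRing

set_option linter.unusedSectionVars false

variable {R σ ι N : Type*} [CommRing R] [IsLocalRing R] [IsNoetherianRing R] [Fintype σ]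
  [DecidableEq ι] [Fintype ι] {δ : σ → ι} [AddCommGroup N] [Module R N]
  [Module (MvPolynomial σ R) N] [IsScalarTower R (MvPolynomial σ R) N]
  {π : (ι → ℤ) → N →ₗ[R] N}

theorem exists_polynomial_shift {ι : Type*} (a : ι → ℚ) (Q : MvPolynomial ι ℚ) :
    ∃ P : MvPolynomial ι ℚ, ∀ w, eval w P = eval (w - a) Q := by
  refine ⟨bind₁ (fun k => X k - C (a k)) Q, fun w => ?_⟩
  have := aeval_bind₁ (R := ℚ) w (fun k => X k - C (a k)) Q
  have hfun : (fun k => aeval w (X k - C (a k) : MvPolynomial ι ℚ)) = w - a := by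
    funext k
    simp
  rw [hfun] at this
  exact this

/-- The submodule of the elements that `X j` multiplies into `B`. -/
def varColon (B : Submodule (MvPolynomial σ R) N) (j : σ) : Submodule (MvPolynomial σ R) N :=
  B.comap (LinearMap.lsmul (MvPolynomial σ R) N (X j))

theorem mem_varColon {B : Submodule (MvPolynomial σ R) N} {j : σ} {x : N} :
    x ∈ varColon B j ↔ (X j : MvPolynomial σ R) • x ∈ B := Iff.rfl

/-- The submodule `X j • A`. -/
def varMul (A : Submodule (MvPolynomial σ R) N) (j : σ) : Submodule (MvPolynomial σ R) N :=
  A.map (LinearMap.lsmul (MvPolynomial σ R) N (X j))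

variable (hπ : IsGradingProj δ π)
include hπ

namespace IsGradingProj

theorem X_smul_proj_sub (j : σ) (w : ι → ℤ) (x : N) :
    (X j : MvPolynomial σ R) • π (w - dirWeight δ j) x = π w ((X j : MvPolynomial σ R) • x) := by
  rw [hπ.X_smul, add_sub_cancel]

theorem isHomog_varColon {B : Submodule (MvPolynomial σ R) N} (hB : IsHomog π B) (j : σ) :
    IsHomog π (varColon B j) := by
  intro w x hx
  rw [mem_varColon, hπ.X_smul]
  exact hB _ _ hx

theorem isHomog_varMul {A : Submodule (MvPolynomial σ R) N} (hA : IsHomog π A) (j : σ) :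
    IsHomog π (varMul A j) := by
  rintro w _ ⟨y, hy, rfl⟩
  exact ⟨π (w - dirWeight δ j) y, hA _ _ hy, hπ.X_smul_proj_sub j w y⟩

/-- The four-term exact sequence of multiplication by `X j` on `A / B`: the difference of two values
is the length of the cokernel minus that of the kernel. -/
theorem relLength_varColon_add {A B : Submodule (MvPolynomial σ R) N} (hA : IsHomog π A)
    (hB : IsHomog π B) (j : σ) (w : ι → ℤ) :
    relLength (homogPart π A w) (B.restrictScalars R) +
        relLength (homogPart π (A ⊓ varColon B j) (w - dirWeight δ j)) (B.restrictScalars R) =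
      relLength (homogPart π A (w - dirWeight δ j)) (B.restrictScalars R) +
        relLength (homogPart π A w) ((B ⊔ varMul A j).restrictScalars R) := by
  let φ : N →ₗ[R] N := (LinearMap.lsmul (MvPolynomial σ R) N (X j)).restrictScalars R
  have hφ : ∀ x, φ x = (X j : MvPolynomial σ R) • x := fun _ => rfl
  have h1 := relLength_add (X := homogPart π A w) (Y := B.restrictScalars R)
    (Z := (B ⊔ varMul A j).restrictScalars R) (fun x hx => Submodule.mem_sup_left hx)
  have h2 := relLength_add (X := homogPart π A (w - dirWeight δ j)) (Y := B.restrictScalars R)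
    (Z := (B.restrictScalars R).comap φ) (fun x hx => B.smul_mem _ hx)
  have h3 : homogPart π A (w - dirWeight δ j) ⊓ (B.restrictScalars R).comap φ =
      homogPart π (A ⊓ varColon B j) (w - dirWeight δ j) := by
    ext x
    exact ⟨fun h => ⟨⟨h.1.1, h.2⟩, h.1.2⟩, fun h => ⟨⟨h.1.1, h.2⟩, h.1.2⟩⟩
  have h4 : relLength (homogPart π A w ⊓ (B ⊔ varMul A j).restrictScalars R)
      (B.restrictScalars R) =
      relLength ((homogPart π A (w - dirWeight δ j)).map φ) (B.restrictScalars R) := by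
    refine relLength_congr (le_antisymm (sup_le ?_ le_sup_right) (sup_le ?_ le_sup_right))
    · rintro x ⟨hx, hx'⟩
      obtain ⟨y, hy, _, ⟨z, hz, rfl⟩, rfl⟩ := Submodule.mem_sup.1 hx'
      have hx2 := (mem_homogPart.1 hx).2
      rw [← hx2, map_add]
      refine Submodule.add_mem _ (Submodule.mem_sup_right (hB _ _ hy)) (Submodule.mem_sup_left ?_)
      exact ⟨π (w - dirWeight δ j) z, ⟨hA _ _ hz, hπ.proj_self _ _⟩, hπ.X_smul_proj_sub j w z⟩
    · rintro _ ⟨z, hz, rfl⟩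
      refine Submodule.mem_sup_left ⟨mem_homogPart.2 ⟨A.smul_mem _ hz.1, ?_⟩,
        Submodule.mem_sup_right ⟨z, hz.1, rfl⟩⟩
      rw [hφ, ← hπ.X_smul_proj_sub, (mem_homogPart.1 hz).2]
  rw [h1, h2, h3, h4, relLength_map]
  ring

/-- If a power of `𝔪` multiplies `A` into `B`, then the length of the homogeneous parts of `A`
modulo `B` is eventually polynomial. -/
theorem exists_polynomial_relLength (n : ℕ) : ∀ {τ : Finset σ} (_ : τ.card = n)
    {A B : Submodule (MvPolynomial σ R) N} (_ : A.FG) (_ : IsHomog π A) (_ : IsHomog π B)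
    {s : ℕ} (_ : maxPow R σ s • A ≤ B)
    (_ : ∀ j ∉ τ, ∀ x ∈ A, (X j : MvPolynomial σ R) • x ∈ B),
    ∃ (P : MvPolynomial ι ℚ) (c : ℕ), ∀ w : ι → ℤ, (∀ i, (c : ℤ) ≤ w i) →
      ((relLength (homogPart π A w) (B.restrictScalars R)).toNat : ℚ) =
        eval (fun i => (w i : ℚ)) P := by
  classical
  -- `n` counts the variables not yet known to annihilate `A / B`. Kernel and cokernel of `X j` are
  -- annihilated by `X j`, so `n` drops, and they compute the difference in the direction of `X j`.
  induction n with
  | zero => ?_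
  | succ n ih => ?_
  all_goals
    intro τ hτ A B hfg hA hB s hs hX
    by_cases hdir : ∃ i, ∀ j ∈ τ, δ j ≠ i
    · obtain ⟨i, hi⟩ := hdir
      obtain ⟨c, hc⟩ := hπ.exists_homogPart_le hA hfg i (B := B) fun j hj x hx =>
        hX j (fun hjτ => hi j hjτ hj) x hx
      refine ⟨0, c, fun w hw => ?_⟩
      rw [relLength_eq_zero_iff.2 (hc w (hw i))]
      simp
    push Not at hdir
    have hfin := relLength_homogPart_lt_top hπ hfg hs
  -- With no variable left, every direction having one means there are no directions, so a constant
  -- polynomial suffices.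
  · have : IsEmpty ι := ⟨fun i => by
      obtain ⟨j, hj, -⟩ := hdir i
      simp [Finset.card_eq_zero.1 hτ] at hj⟩
    obtain ⟨P, hP⟩ := exists_polynomial_of_differences (ι := ι) (c := 0)
      (F := fun w => ((relLength (homogPart π A w) (B.restrictScalars R)).toNat : ℚ))
      fun i => isEmptyElim i
    exact ⟨P, 0, hP⟩
  · choose j hjτ hj using hdir
    have hnoeth : ∀ A₁ : Submodule (MvPolynomial σ R) N, A₁ ≤ A → A₁.FG := fun A₁ h =>
      Submodule.FG.of_le hfg h
    have hcard : ∀ i, (τ.erase (j i)).card = n := fun i => by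
      rw [Finset.card_erase_of_mem (hjτ i), hτ]; rfl
    have hker := fun i => ih (hcard i) (A := A ⊓ varColon B (j i)) (B := B)
      (hnoeth _ inf_le_left) (hA.inf (hπ.isHomog_varColon hB _)) hB (s := s)
      ((Submodule.smul_mono le_rfl inf_le_left).trans hs) (fun k hk x hx => by
        by_cases hkj : k = j i
        · rw [hkj]; exact hx.2
        · exact hX k (fun h => hk (Finset.mem_erase.2 ⟨hkj, h⟩)) x hx.1)
    have hcok := fun i => ih (hcard i) (A := A) (B := B ⊔ varMul A (j i)) hfg hA
      (hB.sup (hπ.isHomog_varMul hA _)) (s := s) (hs.trans le_sup_left) (fun k hk x hx => by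
        by_cases hkj : k = j i
        · rw [hkj]; exact Submodule.mem_sup_right ⟨x, hx, rfl⟩
        · exact Submodule.mem_sup_left (hX k (fun h => hk (Finset.mem_erase.2 ⟨hkj, h⟩)) x hx))
    choose P₁ c₁ hP₁ using hker
    choose P₂ c₂ hP₂ using hcok
    let c : ℕ := Finset.univ.sup c₁ + Finset.univ.sup c₂ + 1
    have hc₁ : ∀ i, c₁ i + 1 ≤ c := fun i => by
      have := Finset.le_sup (f := c₁) (Finset.mem_univ i)
      omega
    have hc₂ : ∀ i, c₂ i ≤ c := fun i => by
      have := Finset.le_sup (f := c₂) (Finset.mem_univ i)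
      omega
    obtain ⟨P, hP⟩ := exists_polynomial_of_differences (ι := ι) (c := c)
      (F := fun w => ((relLength (homogPart π A w) (B.restrictScalars R)).toNat : ℚ)) fun i => by
        obtain ⟨Q, hQ⟩ := exists_polynomial_shift (fun k => ((Pi.single i 1 : ι → ℤ) k : ℚ)) (P₁ i)
        refine ⟨P₂ i - Q, fun w hw => ?_⟩
        have hdw : dirWeight δ (j i) = Pi.single i 1 := by rw [dirWeight, hj]
        have h := hπ.relLength_varColon_add hA hB (j i) w
        rw [hdw] at h
        have h0 := congrArg ENat.toNat h
        rw [ENat.toNat_add (hfin _).ne (relLength_homogPart_lt_top hπ (hnoeth _ inf_le_left)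
            ((Submodule.smul_mono le_rfl inf_le_left).trans hs) _).ne,
          ENat.toNat_add (hfin _).ne (relLength_homogPart_lt_top hπ hfg
            (hs.trans le_sup_left) _).ne] at h0
        have h0' : (_ : ℚ) = _ := congrArg (Nat.cast (R := ℚ)) h0
        push_cast at h0'
        have e2 := hP₂ i w fun k => le_trans (by exact_mod_cast hc₂ i) (hw k)
        have e1 := hP₁ i (w - Pi.single i 1) fun k => by
          have h1 : (Pi.single i 1 : ι → ℤ) k ≤ 1 := by
            by_cases hk : k = i
            · subst hk; simp
            · simp [hk]
          have h2 : (c₁ i : ℤ) + 1 ≤ c := by exact_mod_cast hc₁ i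
          have := hw k
          simp only [Pi.sub_apply]
          omega
        have e3 : (fun k => (((w - Pi.single i 1 : ι → ℤ) k : ℤ) : ℚ)) =
            (fun k => (w k : ℚ)) - fun k => ((Pi.single i 1 : ι → ℤ) k : ℚ) := by
          funext k
          simp
        rw [map_sub, hQ, ← e3, ← e1, ← e2]
        linarith
    exact ⟨P, c, hP⟩

theorem exists_polynomial_torLength {A B : Submodule (MvPolynomial σ R) N} (hfg : A.FG)
    (hA : IsHomog π A) (hB : IsHomog π B) :
    ∃ (P : MvPolynomial ι ℚ) (c : ℕ), ∀ w : ι → ℤ, (∀ i, (c : ℤ) ≤ w i) →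
      ∃ l : ℕ, torLength (homogPart π A w) (B.restrictScalars R) = l ∧
        eval (fun i => (w i : ℚ)) P = l := by
  have h₁ : (A ⊓ _root_.polySaturation B).FG := hfg.of_le inf_le_left
  obtain ⟨s, hs⟩ := exists_maxPow_smul_le h₁ inf_le_right
  obtain ⟨P, c, h⟩ := hπ.exists_polynomial_relLength _ (τ := Finset.univ) rfl h₁
    (hA.inf hB.polySaturation) hB hs (fun j hj => absurd (Finset.mem_univ j) hj)
  refine ⟨P, c, fun w hw => ⟨_, ?_, (h w hw).symm⟩⟩
  rw [torLength, homogPart_inf_polySaturation]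
  exact (ENat.natCast_toNat (relLength_homogPart_lt_top hπ h₁ hs w).ne).symm

end IsGradingProj

end HilbertPolynomial

/-! ### The ambient module of the extended multi-Rees modules -/

noncomputable section ReesAmbient

open MvPolynomial IsLocalRing

set_option linter.unusedSectionVars false

variable {R τ ι M : Type*} [CommRing R] [DecidableEq ι] [Fintype ι]
  [AddCommGroup M] [Module R M] [Module (MvPolynomial τ R) M] [IsScalarTower R (MvPolynomial τ R) M]

/-- The module of the finitely supported families of elements of `M` indexed by the exponents of
the extra variables, one for each direction and one more. The data `d` and `γ` determine the action
of a polynomial ring in `τ` and two copies of `γ`. -/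
@[nolint unusedArguments]
def ReesAmbient (_d : τ → ι) (_γ : Finset τ) (M : Type*) [AddCommGroup M] : Type _ :=
  (Option ι → ℕ) →₀ M

/-- The variables that act on the ambient module. -/
abbrev ReesVar (γ : Finset τ) : Type _ := τ ⊕ (γ ⊕ γ)

/-- The element of `τ` below a variable. -/
def reesBase (γ : Finset τ) : ReesVar γ → τ :=
  Sum.elim id (Sum.elim Subtype.val Subtype.val)

/-- The exponent by which a variable shifts. -/
def reesShift (d : τ → ι) (γ : Finset τ) : ReesVar γ → Option ι → ℕ :=
  Sum.elim 0 (Sum.elim (fun a => Pi.single (some (d a)) 1) fun _ => Pi.single none 1)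

/-- The direction of a variable in the bigrading. -/
def reesDir (d : τ → ι) (γ : Finset τ) : ReesVar γ → ι ⊕ ι :=
  Sum.elim (fun t => .inl (d t)) (Sum.elim (fun a => .inr (d a)) fun a => .inl (d a))

variable {d : τ → ι} {γ : Finset τ}

namespace ReesAmbient

instance : AddCommGroup (ReesAmbient d γ M) := inferInstanceAs (AddCommGroup (_ →₀ M))

instance : Module R (ReesAmbient d γ M) := inferInstanceAs (Module R (_ →₀ M))

/-- The family with a single possibly nonzero entry. -/
def single (κ : Option ι → ℕ) : M →ₗ[R] ReesAmbient d γ M := Finsupp.lsingle κ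

/-- The entry at `κ`. -/
def entry (κ : Option ι → ℕ) : ReesAmbient d γ M →ₗ[R] M := Finsupp.lapply κ

theorem entry_single (κ κ' : Option ι → ℕ) (x : M) :
    entry (R := R) κ' (single (R := R) κ x : ReesAmbient d γ M) = if κ = κ' then x else 0 := by
  classical
  exact Finsupp.single_apply

theorem ext {f g : ReesAmbient d γ M} (h : ∀ κ, entry (R := R) κ f = entry (R := R) κ g) : f = g :=
  Finsupp.ext h

theorem exists_sum_single (f : ReesAmbient d γ M) :
    ∃ s : Finset (Option ι → ℕ), f = ∑ κ ∈ s, single (R := R) κ (entry (R := R) κ f) :=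
  ⟨f.support, f.sum_single.symm⟩

@[elab_as_elim]
theorem induction {motive : ReesAmbient d γ M → Prop} (f : ReesAmbient d γ M) (zero : motive 0)
    (add : ∀ f g, motive f → motive g → motive (f + g))
    (single : ∀ κ x, motive (single (R := R) κ x)) : motive f :=
  Finsupp.induction_linear f zero add single

theorem linearMap_ext {N : Type*} [AddCommGroup N] [Module R N]
    {φ ψ : ReesAmbient d γ M →ₗ[R] N}
    (h : ∀ κ x, φ (single (R := R) κ x) = ψ (single (R := R) κ x)) : φ = ψ :=
  Finsupp.lhom_ext h

/-- The shift of a family by an exponent combined with multiplication by a polynomial. -/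
def shiftMul (d : τ → ι) (γ : Finset τ) (M : Type*) [AddCommGroup M] [Module R M]
    [Module (MvPolynomial τ R) M] [IsScalarTower R (MvPolynomial τ R) M]
    (ρ : Option ι → ℕ) (b : MvPolynomial τ R) : Module.End R (ReesAmbient d γ M) :=
  Finsupp.lsum R fun κ => Finsupp.lsingle (ρ + κ) ∘ₗ DistribSMul.toLinearMap R M b

theorem shiftMul_single (ρ κ : Option ι → ℕ) (b : MvPolynomial τ R) (x : M) :
    shiftMul d γ M ρ b (single (R := R) κ x) = single (R := R) (ρ + κ) (b • x) :=
  Finsupp.lsum_single ..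

/-- The shifts and multiplications as a monoid of endomorphisms. -/
def shiftMulHom (d : τ → ι) (γ : Finset τ) (M : Type*) [AddCommGroup M] [Module R M]
    [Module (MvPolynomial τ R) M] [IsScalarTower R (MvPolynomial τ R) M] :
    Multiplicative (Option ι → ℕ) × MvPolynomial τ R →* Module.End R (ReesAmbient d γ M) where
  toFun a := shiftMul d γ M a.1.toAdd a.2
  map_one' := linearMap_ext fun κ x => by
    rw [shiftMul_single]
    simp
  map_mul' a b := linearMap_ext fun κ x => by
    rw [Module.End.mul_apply, shiftMul_single, shiftMul_single, shiftMul_single]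
    simp [add_assoc, mul_smul]

/-- The exponent and the monomial in `τ` below a monomial. -/
def monomialData (R : Type*) [CommRing R] (d : τ → ι) (γ : Finset τ) :
    Multiplicative (ReesVar γ →₀ ℕ) →* Multiplicative (Option ι → ℕ) × MvPolynomial τ R where
  toFun n := n.toAdd.prod fun j k =>
    ((.ofAdd (reesShift d γ j), X (reesBase γ j)) :
      Multiplicative (Option ι → ℕ) × MvPolynomial τ R) ^ k
  map_one' := Finsupp.prod_zero_index
  map_mul' m n := by
    classical
    rw [toAdd_mul]
    exact Finsupp.prod_add_index' (fun j => pow_zero _) fun j k l => pow_add _ k l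

/-- The action of the monomials on the ambient module. -/
def monomialHom (d : τ → ι) (γ : Finset τ) (M : Type*) [AddCommGroup M] [Module R M]
    [Module (MvPolynomial τ R) M] [IsScalarTower R (MvPolynomial τ R) M] :
    Multiplicative (ReesVar γ →₀ ℕ) →* Module.End R (ReesAmbient d γ M) :=
  (shiftMulHom d γ M).comp (monomialData R d γ)

/-- The action of the polynomial ring on the ambient module. -/
def polyHom (d : τ → ι) (γ : Finset τ) (M : Type*) [AddCommGroup M] [Module R M]
    [Module (MvPolynomial τ R) M] [IsScalarTower R (MvPolynomial τ R) M] :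
    MvPolynomial (ReesVar γ) R →ₐ[R] Module.End R (ReesAmbient d γ M) :=
  AddMonoidAlgebra.lift R _ _ (monomialHom d γ M)

instance : Module (MvPolynomial (ReesVar γ) R) (ReesAmbient d γ M) :=
  Module.compHom _ (polyHom d γ M).toRingHom

instance : IsScalarTower R (MvPolynomial (ReesVar γ) R) (ReesAmbient d γ M) where
  smul_assoc r g f := by
    change polyHom d γ M (r • g) f = r • polyHom d γ M g f
    rw [map_smul]
    rfl

theorem X_smul_single (j : ReesVar γ) (κ : Option ι → ℕ) (x : M) :
    (X j : MvPolynomial (ReesVar γ) R) • (single (R := R) κ x : ReesAmbient d γ M) =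
      single (R := R) (reesShift d γ j + κ) ((X (reesBase γ j) : MvPolynomial τ R) • x) := by
  have h : polyHom d γ M (X j : MvPolynomial (ReesVar γ) R) = shiftMul d γ M (reesShift d γ j) (X (reesBase γ j)) := by
    have h1 : polyHom d γ M (X j : MvPolynomial (ReesVar γ) R) = (1 : R) • monomialHom d γ M (.ofAdd (Finsupp.single j 1)) :=
      AddMonoidAlgebra.lift_single ..
    rw [h1, one_smul]
    have h2 : monomialData R d γ (.ofAdd (Finsupp.single j 1)) =
        (.ofAdd (reesShift d γ j), X (reesBase γ j)) := by
      change Finsupp.prod (Finsupp.single j 1) (fun j k =>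
        ((.ofAdd (reesShift d γ j), X (reesBase γ j)) :
          Multiplicative (Option ι → ℕ) × MvPolynomial τ R) ^ k) = _
      rw [Finsupp.prod_single_index]
      · exact pow_one _
      · exact pow_zero _
    rw [monomialHom, MonoidHom.comp_apply, h2]
    rfl
  change polyHom d γ M (X j : MvPolynomial (ReesVar γ) R) _ = _
  rw [h, shiftMul_single]

theorem C_smul {σ N : Type*} [AddCommGroup N] [Module R N] [Module (MvPolynomial σ R) N]
    [IsScalarTower R (MvPolynomial σ R) N] (r : R) (x : N) :
    (C r : MvPolynomial σ R) • x = r • x := by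
  rw [← algebraMap_eq, algebraMap_smul]

/-- The direction parts of an exponent. -/
def IsAt (w : ι ⊕ ι → ℤ) (κ : Option ι → ℕ) : Prop := ∀ i, (κ (some i) : ℤ) = w (.inr i)

instance (w : ι ⊕ ι → ℤ) (κ : Option ι → ℕ) : Decidable (IsAt w κ) := by
  unfold IsAt; infer_instance

/-- The internal degree of the entries of the elements of bidegree `w`. -/
def totalDeg (w : ι ⊕ ι → ℤ) : ι → ℤ := fun i => w (.inl i) + w (.inr i)

/-- The projections to the bihomogeneous parts of the ambient module. -/
def proj (d : τ → ι) (γ : Finset τ) (q : (ι → ℤ) → M →ₗ[R] M) (w : ι ⊕ ι → ℤ) :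
    ReesAmbient d γ M →ₗ[R] ReesAmbient d γ M :=
  Finsupp.lsum R fun κ => if IsAt w κ then Finsupp.lsingle κ ∘ₗ q (totalDeg w) else 0

variable {q : (ι → ℤ) → M →ₗ[R] M}

theorem proj_single (w : ι ⊕ ι → ℤ) (κ : Option ι → ℕ) (x : M) :
    proj d γ q w (single (R := R) κ x) =
      if IsAt w κ then single (R := R) κ (q (totalDeg w) x) else 0 := by
  refine (Finsupp.lsum_single ..).trans ?_
  split_ifs <;> rfl

theorem entry_proj (w : ι ⊕ ι → ℤ) (κ : Option ι → ℕ) (f : ReesAmbient d γ M) :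
    entry (R := R) κ (proj d γ q w f) =
      if IsAt w κ then q (totalDeg w) (entry (R := R) κ f) else 0 := by
  refine induction (R := R) f ?_ (fun f g hf hg => ?_) fun κ' x => ?_
  · simp
  · rw [map_add, map_add, hf, hg, map_add]
    split_ifs <;> simp
  · rw [proj_single]
    by_cases h : κ' = κ
    · subst h
      split_ifs <;> simp [entry_single]
    · split_ifs <;> simp [entry_single, h]

/-- All three kinds of variables multiply entries by a base variable; they differ only in whether
`v` or `n` absorbs the degree. -/
theorem totalDeg_dirWeight (j : ReesVar γ) :
    totalDeg (dirWeight (reesDir d γ) j) = dirWeight d (reesBase γ j) := by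
  funext i
  rcases j with t | a | a <;>
    simp [totalDeg, dirWeight, reesDir, reesBase, Pi.single_apply]

theorem isAt_add_iff (j : ReesVar γ) (w : ι ⊕ ι → ℤ) (κ : Option ι → ℕ) :
    IsAt (dirWeight (reesDir d γ) j + w) (reesShift d γ j + κ) ↔ IsAt w κ := by
  refine forall_congr' fun i => ?_
  rcases j with t | a | a
  · simp [dirWeight, reesDir, reesShift]
  · simp [dirWeight, reesDir, reesShift, Pi.single_apply]
  · simp [dirWeight, reesDir, reesShift]

theorem isGradingProj (hq : IsGradingProj d q) :
    IsGradingProj (reesDir d γ) (proj d γ q) where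
  proj_self w f := ext (R := R) fun κ => by
    rw [entry_proj, entry_proj]
    split_ifs
    · rw [hq.proj_self]
    · rfl
  proj_ne w w' f h := ext (R := R) fun κ => by
    rw [entry_proj, entry_proj, map_zero]
    split_ifs with h1 h2
    · refine hq.proj_ne _ _ _ fun he => h ?_
      have hr : ∀ i, w (.inr i) = w' (.inr i) := fun i => (h1 i).symm.trans (h2 i)
      funext i
      rcases i with i | i
      · have := congrFun he i
        simp only [totalDeg] at this
        have := hr i
        omega
      · exact hr i
    · rw [map_zero]
    · rfl
  exists_sum f := by
    classical
    suffices h : ∃ s : Finset (ι ⊕ ι → ℤ), (∀ w ∉ s, proj d γ q w f = 0) ∧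
        ∑ w ∈ s, proj d γ q w f = f from ⟨h.choose, h.choose_spec.2⟩
    refine induction (R := R) f ⟨∅, by simp, by simp⟩ (fun f g hf hg => ?_) fun κ x => ?_
    · obtain ⟨s, hs, hs'⟩ := hf
      obtain ⟨t, ht, ht'⟩ := hg
      refine ⟨s ∪ t, fun w hw => ?_, ?_⟩
      · rw [Finset.mem_union, not_or] at hw
        rw [map_add, hs w hw.1, ht w hw.2, add_zero]
      · simp only [map_add, Finset.sum_add_distrib]
        rw [← Finset.sum_subset Finset.subset_union_left fun w _ hw => hs w hw,
          ← Finset.sum_subset Finset.subset_union_right fun w _ hw => ht w hw, hs', ht']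
    · obtain ⟨s, hs⟩ := hq.exists_sum x
      -- The bidegree of an entry of internal degree `u` at `κ`: `n` is read off from `κ`, and `v =
      -- u - n`.
      let e : (ι → ℤ) → ι ⊕ ι → ℤ := fun u =>
        Sum.elim (fun i => u i - κ (some i)) fun i => κ (some i)
      have he : ∀ u, IsAt (e u) κ := fun u i => rfl
      have he' : ∀ u, totalDeg (e u) = u := fun u => funext fun i => by simp [totalDeg, e]
      have hinj : Function.Injective e := Function.LeftInverse.injective he'
      refine ⟨s.image e, fun w hw => ?_, ?_⟩
      · rw [proj_single]
        split_ifs with h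
        · have h1 : e (totalDeg w) = w := by
            funext i
            rcases i with i | i
            · simp only [e, Sum.elim_inl, totalDeg, h i]
              ring
            · exact h i
          have h2 : totalDeg w ∉ s := fun h2 => hw (Finset.mem_image.2 ⟨_, h2, h1⟩)
          rw [← hs, map_sum, Finset.sum_eq_zero, map_zero]
          intro u hu
          exact hq.proj_ne _ _ _ fun hne => h2 (hne ▸ hu)
        · rfl
      · rw [Finset.sum_image hinj.injOn]
        simp only [proj_single, he, he', if_true]
        rw [← map_sum, hs]
  X_smul j w f := by
    refine induction (R := R) f ?_ (fun f g hf hg => ?_) fun κ x => ?_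
    · simp
    · rw [map_add, smul_add, hf, hg, smul_add, map_add]
    · rw [proj_single, X_smul_single, proj_single]
      simp only [isAt_add_iff]
      split_ifs
      · rw [X_smul_single, hq.X_smul]
        congr 3
        funext i
        have := congrFun (totalDeg_dirWeight (d := d) j) i
        simp only [totalDeg, Pi.add_apply] at this ⊢
        omega
      · rw [smul_zero]

end ReesAmbient

end ReesAmbient

/-! ### Submodules of the ambient module given by families of submodules -/

noncomputable section CoordSubmodule

open MvPolynomial IsLocalRing

set_option linter.unusedSectionVars false

variable {R τ ι M : Type*} [CommRing R] [DecidableEq ι] [Fintype ι]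
  [AddCommGroup M] [Module R M] [Module (MvPolynomial τ R) M] [IsScalarTower R (MvPolynomial τ R) M]
  {d : τ → ι} {γ : Finset τ}

/-- The ideals generated by the variables in `γ` of a given direction, and by all variables
in `γ`. -/
def reesIdeal (R : Type*) [CommRing R] (d : τ → ι) (γ : Finset τ) (o : Option ι) :
    Ideal (MvPolynomial τ R) :=
  Ideal.span {f | ∃ t ∈ γ, (∀ i, o = some i → d t = i) ∧ f = X t}

/-- The product of powers of the ideals `reesIdeal`. -/
def reesPow (R : Type*) [CommRing R] (d : τ → ι) (γ : Finset τ) (κ : Option ι → ℕ) :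
    Ideal (MvPolynomial τ R) := ∏ o, reesIdeal R d γ o ^ κ o

theorem reesPow_zero : reesPow R d γ 0 = 1 := by simp [reesPow]

theorem reesPow_add (κ κ' : Option ι → ℕ) :
    reesPow R d γ (κ + κ') = reesPow R d γ κ * reesPow R d γ κ' := by
  simp only [reesPow, Pi.add_apply, pow_add, Finset.prod_mul_distrib]

theorem reesPow_single (o : Option ι) : reesPow R d γ (Pi.single o 1) = reesIdeal R d γ o := by
  rw [reesPow, Finset.prod_eq_single o]
  · simp
  · intro o' _ h
    simp [h]
  · simp

theorem reesPow_anti {κ κ' : Option ι → ℕ} (h : κ ≤ κ') : reesPow R d γ κ' ≤ reesPow R d γ κ := by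
  obtain ⟨ρ, rfl⟩ := exists_add_of_le h
  rw [reesPow_add]
  exact (Ideal.mul_le_left : reesPow R d γ κ * reesPow R d γ ρ ≤ reesPow R d γ κ)

theorem X_mem_reesIdeal {o : Option ι} {t : τ} (ht : t ∈ γ) (h : ∀ i, o = some i → d t = i) :
    (X t : MvPolynomial τ R) ∈ reesIdeal R d γ o := Ideal.subset_span ⟨t, ht, h, rfl⟩

theorem X_mem_reesPow (j : ReesVar γ) :
    (X (reesBase γ j) : MvPolynomial τ R) ∈ reesPow R d γ (reesShift d γ j) := by
  rcases j with t | a | a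
  · simp [reesShift, reesPow_zero]
  · rw [reesShift, Sum.elim_inr, Sum.elim_inl, reesPow_single]
    exact X_mem_reesIdeal a.2 fun i hi => Option.some_injective _ hi
  · rw [reesShift, Sum.elim_inr, Sum.elim_inr, reesPow_single]
    exact X_mem_reesIdeal a.2 fun i hi => by cases hi

theorem exists_reesVar {o : Option ι} {t : τ} (ht : t ∈ γ) (h : ∀ i, o = some i → d t = i) :
    ∃ j : ReesVar γ, reesBase γ j = t ∧ reesShift d γ j = Pi.single o 1 := by
  cases o with
  | none => exact ⟨.inr (.inr ⟨t, ht⟩), rfl, rfl⟩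
  | some i => exact ⟨.inr (.inl ⟨t, ht⟩), rfl, by rw [← h i rfl]; rfl⟩

theorem reesIdeal_smul_le {o : Option ι} {P Q : Submodule (MvPolynomial τ R) M}
    (h : ∀ t ∈ γ, (∀ i, o = some i → d t = i) → ∀ y ∈ Q, (X t : MvPolynomial τ R) • y ∈ P) :
    reesIdeal R d γ o • Q ≤ P := by
  refine Submodule.smul_le.2 fun r hr => ?_
  refine Submodule.span_induction (p := fun r _ => ∀ y ∈ Q, r • y ∈ P) ?_ ?_ ?_ ?_ hr
  · rintro _ ⟨t, ht, hd, rfl⟩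
    exact h t ht hd
  · intro y _
    rw [zero_smul]
    exact P.zero_mem
  · intro a b _ _ ha hb y hy
    rw [add_smul]
    exact P.add_mem (ha y hy) (hb y hy)
  · intro a b _ hb y hy
    rw [smul_eq_mul, mul_smul]
    exact P.smul_mem a (hb y hy)

theorem exponent_induction {P : (Option ι → ℕ) → Prop} (zero : P 0)
    (single_add : ∀ o κ, P κ → P (Pi.single o 1 + κ)) (κ : Option ι → ℕ) : P κ := by
  induction h : ∑ o, κ o generalizing κ with
  | zero =>
    obtain rfl : κ = 0 := funext fun o => by
      simpa using Finset.sum_eq_zero_iff.1 h o (Finset.mem_univ o)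
    exact zero
  | succ n ih =>
    obtain ⟨o, -, ho⟩ : ∃ o ∈ Finset.univ, 0 < κ o := by
      by_contra! h'
      rw [Finset.sum_eq_zero fun o ho => Nat.le_zero.1 (h' o ho)] at h
      omega
    have hle : Pi.single o 1 ≤ κ := fun o' => by
      by_cases h : o' = o
      · subst h; rw [Pi.single_eq_same]; exact ho
      · simp [h]
    obtain ⟨κ, rfl⟩ := exists_add_of_le hle
    refine single_add o κ (ih κ ?_)
    simp only [Pi.add_apply, Finset.sum_add_distrib] at h
    rw [Finset.sum_pi_single' o 1 Finset.univ, if_pos (Finset.mem_univ o)] at h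
    omega

/-- Lets facts about products of ideal powers be checked for one ideal factor at a time, starting
from exponent zero. -/
theorem reesPow_smul_le_of_step {S : (Option ι → ℕ) → Submodule (MvPolynomial τ R) M}
    (h : ∀ o κ, reesIdeal R d γ o • S κ ≤ S (Pi.single o 1 + κ)) {Q : Submodule (MvPolynomial τ R) M}
    (hQ : Q ≤ S 0) (κ : Option ι → ℕ) : reesPow R d γ κ • Q ≤ S κ := by
  induction κ using exponent_induction with
  | zero => rwa [reesPow_zero, one_smul]
  | single_add o κ ih =>
    rw [reesPow_add, reesPow_single, ← smul_eq_mul, smul_assoc]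
    exact (Submodule.smul_mono le_rfl ih).trans (h o κ)

/-- A family of submodules is stable if every variable respects it. -/
def IsStable (d : τ → ι) (γ : Finset τ) (F : (Option ι → ℕ) → Submodule (MvPolynomial τ R) M) :
    Prop :=
  ∀ (j : ReesVar γ) κ, ∀ x ∈ F κ, (X (reesBase γ j) : MvPolynomial τ R) • x ∈
    F (reesShift d γ j + κ)

namespace IsStable

variable {F G : (Option ι → ℕ) → Submodule (MvPolynomial τ R) M}

theorem inf (hF : IsStable d γ F) (hG : IsStable d γ G) : IsStable d γ fun κ => F κ ⊓ G κ :=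
  fun j κ x hx => ⟨hF j κ x hx.1, hG j κ x hx.2⟩

theorem sup (hF : IsStable d γ F) (hG : IsStable d γ G) : IsStable d γ fun κ => F κ ⊔ G κ := by
  intro j κ x hx
  obtain ⟨y, hy, z, hz, rfl⟩ := Submodule.mem_sup.1 hx
  rw [smul_add]
  exact Submodule.add_mem_sup (hF j κ y hy) (hG j κ z hz)

theorem const (Q : Submodule (MvPolynomial τ R) M) : IsStable d γ fun _ => Q :=
  fun _ _ _ hx => Q.smul_mem _ hx

theorem pow (Q : Submodule (MvPolynomial τ R) M) : IsStable d γ fun κ => reesPow R d γ κ • Q := by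
  intro j κ x hx
  beta_reduce at hx ⊢
  rw [reesPow_add, ← smul_eq_mul, smul_assoc]
  exact Submodule.smul_mem_smul (X_mem_reesPow j) hx

theorem shift (hF : IsStable d γ F) (ρ : Option ι → ℕ) : IsStable d γ fun κ => F (κ + ρ) := by
  intro j κ x hx
  have := hF j _ x hx
  rwa [← add_assoc] at this

/-- No variable lowers the last exponent. -/
theorem positive (hF : IsStable d γ F) :
    IsStable d γ fun κ => if κ none = 0 then ⊥ else F κ := by
  intro j κ x hx
  beta_reduce at hx ⊢
  by_cases h : κ none = 0
  · rw [if_pos h, Submodule.mem_bot] at hx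
    rw [hx, smul_zero]
    exact Submodule.zero_mem _
  · rw [if_neg h] at hx
    rw [if_neg (by rw [Pi.add_apply]; omega)]
    exact hF j κ x hx

theorem maxPow [IsLocalRing R] (hF : IsStable d γ F) (s : ℕ) :
    IsStable d γ fun κ => maxPow R τ s • F κ := by
  intro j κ x hx
  refine maxPow_smul_induction (motive := fun y => (X (reesBase γ j) : MvPolynomial τ R) • y ∈
    _root_.maxPow R τ s • F (reesShift d γ j + κ)) hx (fun a ha y hy => ?_) fun y z hy hz => ?_
  · rw [smul_comm]
    exact smul_mem_maxPow_smul ha (hF j κ y hy)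
  · rw [smul_add]
    exact Submodule.add_mem _ hy hz

end IsStable

namespace ReesAmbient

/-- The largest submodule of the ambient module whose elements have their entries in a family of
submodules. -/
def coordSub (d : τ → ι) (γ : Finset τ) (F : (Option ι → ℕ) → Submodule (MvPolynomial τ R) M) :
    Submodule (MvPolynomial (ReesVar γ) R) (ReesAmbient d γ M) where
  carrier := {f | ∀ (g : MvPolynomial (ReesVar γ) R) κ, entry (R := R) κ (g • f) ∈ F κ}
  zero_mem' := fun g κ => by simp
  add_mem' := fun hf hf' g κ => by
    rw [smul_add, map_add]
    exact Submodule.add_mem _ (hf g κ) (hf' g κ)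
  smul_mem' := fun g f hf g' κ => by
    rw [← mul_smul]
    exact hf _ κ

variable {F G : (Option ι → ℕ) → Submodule (MvPolynomial τ R) M}

theorem entry_mem {f : ReesAmbient d γ M} (hf : f ∈ coordSub d γ F) (κ : Option ι → ℕ) :
    entry (R := R) κ f ∈ F κ := by
  have := hf 1 κ
  rwa [one_smul] at this

/-- Stability makes the quantification over all multiples `g • f` in the definition superfluous. -/
theorem mem_coordSub (hF : IsStable d γ F) {f : ReesAmbient d γ M} :
    f ∈ coordSub d γ F ↔ ∀ κ, entry (R := R) κ f ∈ F κ := by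
  refine ⟨entry_mem, fun hf g => ?_⟩
  induction g using MvPolynomial.induction_on generalizing f with
  | C r =>
    intro κ
    rw [C_smul, map_smul]
    exact ((F κ).restrictScalars R).smul_mem r (hf κ)
  | add g g' hg hg' =>
    intro κ
    rw [add_smul, map_add]
    exact Submodule.add_mem _ (hg hf κ) (hg' hf κ)
  | mul_X g j hg =>
    intro κ
    rw [mul_smul]
    refine hg (fun κ => ?_) κ
    obtain ⟨s, hs⟩ := exists_sum_single (R := R) f
    rw [hs, Finset.smul_sum, map_sum]
    refine Submodule.sum_mem _ fun κ' _ => ?_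
    rw [X_smul_single, entry_single]
    split_ifs with h
    · rw [← h]
      exact hF _ _ _ (hf κ')
    · exact Submodule.zero_mem _

theorem single_mem (hF : IsStable d γ F) {κ : Option ι → ℕ} {x : M} (hx : x ∈ F κ) :
    single (R := R) κ x ∈ coordSub d γ F := by
  refine (mem_coordSub hF).2 fun κ' => ?_
  rw [entry_single]
  split_ifs with h
  · exact h ▸ hx
  · exact Submodule.zero_mem _

theorem mem_of_single_mem {P : Submodule (MvPolynomial (ReesVar γ) R) (ReesAmbient d γ M)}
    {f : ReesAmbient d γ M} (h : ∀ κ, single (R := R) κ (entry (R := R) κ f) ∈ P) : f ∈ P := by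
  obtain ⟨s, hs⟩ := exists_sum_single (R := R) f
  rw [hs]
  exact Submodule.sum_mem _ fun κ _ => h κ

theorem coordSub_le {P : Submodule (MvPolynomial (ReesVar γ) R) (ReesAmbient d γ M)}
    (h : ∀ κ, ∀ x ∈ F κ, single (R := R) κ x ∈ P) : coordSub d γ F ≤ P :=
  fun _ hf => mem_of_single_mem fun κ => h κ _ (entry_mem hf κ)

theorem coordSub_mono (h : ∀ κ, F κ ≤ G κ) : coordSub d γ F ≤ coordSub d γ G :=
  fun _ hf g κ => h κ (hf g κ)

theorem coordSub_inf : coordSub d γ (fun κ => F κ ⊓ G κ) = coordSub d γ F ⊓ coordSub d γ G := by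
  ext f
  exact ⟨fun h => ⟨fun g κ => (h g κ).1, fun g κ => (h g κ).2⟩, fun h g κ => ⟨h.1 g κ, h.2 g κ⟩⟩

theorem coordSub_bot : coordSub d γ (fun _ => (⊥ : Submodule (MvPolynomial τ R) M)) = ⊥ := by
  refine eq_bot_iff.2 (coordSub_le fun κ x hx => ?_)
  rw [(Submodule.mem_bot _).1 hx, map_zero]
  exact Submodule.zero_mem _

theorem coordSub_sup (hF : IsStable d γ F) (hG : IsStable d γ G) :
    coordSub d γ (fun κ => F κ ⊔ G κ) = coordSub d γ F ⊔ coordSub d γ G := by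
  refine le_antisymm (coordSub_le fun κ x hx => ?_)
    (sup_le (coordSub_mono fun κ => le_sup_left) (coordSub_mono fun κ => le_sup_right))
  obtain ⟨y, hy, z, hz, rfl⟩ := Submodule.mem_sup.1 hx
  rw [map_add]
  exact Submodule.add_mem_sup (single_mem hF hy) (single_mem hG hz)

theorem le_of_coordSub_le (hF : IsStable d γ F) (h : coordSub d γ F ≤ coordSub d γ G)
    (κ : Option ι → ℕ) : F κ ≤ G κ := fun x hx => by
  have := entry_mem (h (single_mem hF hx)) κ
  rwa [entry_single, if_pos rfl] at this

theorem coordSub_maxPow [IsLocalRing R] (hF : IsStable d γ F) (s : ℕ) :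
    coordSub d γ (fun κ => maxPow R τ s • F κ) = maxPow R (ReesVar γ) s • coordSub d γ F := by
  refine le_antisymm (coordSub_le fun κ x hx => ?_) (maxPow_smul_le.2 fun a ha f hf => ?_)
  · refine maxPow_smul_induction (motive := fun y => single (R := R) κ y ∈
      maxPow R (ReesVar γ) s • coordSub d γ F) hx (fun a ha y hy => ?_) fun y z hy hz => ?_
    · rw [map_smul]
      exact smul_mem_maxPow_smul ha (single_mem hF hy)
    · rw [map_add]
      exact Submodule.add_mem _ hy hz
  · refine (mem_coordSub (hF.maxPow s)).2 fun κ => ?_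
    rw [map_smul]
    exact smul_mem_maxPow_smul ha (entry_mem hf κ)

variable {q : (ι → ℤ) → M →ₗ[R] M}

theorem isHomog_coordSub (hF : IsStable d γ F) (h : ∀ κ, IsHomog q (F κ)) :
    IsHomog (proj d γ q) (coordSub d γ F) := by
  intro w f hf
  refine (mem_coordSub hF).2 fun κ => ?_
  rw [entry_proj]
  split_ifs
  · exact h κ _ _ (entry_mem hf κ)
  · exact Submodule.zero_mem _

/-- The elements of `M` that give elements of `P` when put at `κ`. -/
def slice (P : Submodule (MvPolynomial (ReesVar γ) R) (ReesAmbient d γ M)) (κ : Option ι → ℕ) :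
    Submodule (MvPolynomial τ R) M where
  __ := (P.restrictScalars R).comap (single (R := R) κ)
  smul_mem' := by
    intro g x (hx : single (R := R) κ x ∈ P)
    change single (R := R) κ (g • x) ∈ P
    induction g using MvPolynomial.induction_on generalizing x with
    | C r =>
      rw [C_smul, map_smul]
      exact (P.restrictScalars R).smul_mem r hx
    | add g g' hg hg' =>
      rw [add_smul, map_add]
      exact P.add_mem (hg hx) (hg' hx)
    | mul_X g t hg =>
      rw [mul_smul]
      refine hg ?_
      have h : single (R := R) κ ((X t : MvPolynomial τ R) • x) =
          (X (.inl t) : MvPolynomial (ReesVar γ) R) •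
            (single (R := R) κ x : ReesAmbient d γ M) := by
        rw [X_smul_single]
        simp [reesShift, reesBase]
      rw [h]
      exact P.smul_mem _ hx

theorem mem_slice {P : Submodule (MvPolynomial (ReesVar γ) R) (ReesAmbient d γ M)}
    {κ : Option ι → ℕ} {x : M} : x ∈ slice P κ ↔ single (R := R) κ x ∈ P := Iff.rfl

/-- As for Rees algebras: generators of `Q` placed at exponent zero generate everything, because the
extra variables realize the generators of each ideal factor. -/
theorem fg_coordSub_pow {Q : Submodule (MvPolynomial τ R) M} (hQ : Q.FG) :
    (coordSub d γ fun κ => reesPow R d γ κ • Q).FG := by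
  obtain ⟨T, hT⟩ := hQ
  classical
  refine ⟨T.image (single (R := R) 0), le_antisymm (Submodule.span_le.2 ?_)
    (coordSub_le fun κ x hx => ?_)⟩
  · intro f hf
    obtain ⟨x, hx, rfl⟩ := Finset.mem_image.1 hf
    refine single_mem (IsStable.pow Q) ?_
    rw [reesPow_zero, one_smul, ← hT]
    exact Submodule.subset_span hx
  · refine reesPow_smul_le_of_step (S := slice (Submodule.span (MvPolynomial (ReesVar γ) R)
      ((T.image (single (R := R) 0) : Finset (ReesAmbient d γ M)) : Set (ReesAmbient d γ M))))
      (fun o κ => reesIdeal_smul_le fun t ht hd y hy => ?_) ?_ κ hx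
    · obtain ⟨j, rfl, hj⟩ := exists_reesVar ht hd
      rw [mem_slice, ← hj, ← X_smul_single]
      exact Submodule.smul_mem _ _ hy
    · rw [← hT]
      refine Submodule.span_le.2 fun y hy => ?_
      exact Submodule.subset_span (Finset.mem_image_of_mem _ hy)

end ReesAmbient

end CoordSubmodule

/-! ### Growth of extended multi-Rees modules -/

noncomputable section ReesGrowth

open MvPolynomial IsLocalRing

set_option linter.unusedSectionVars false

variable {R τ ι M : Type*} [CommRing R] [DecidableEq ι] [Fintype ι]
  [AddCommGroup M] [Module R M] [Module (MvPolynomial τ R) M] [IsScalarTower R (MvPolynomial τ R) M]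
  {d : τ → ι} {γ : Finset τ} {q : (ι → ℤ) → M →ₗ[R] M}

/-- The exponent with entries `n` and the last entry `k`. -/
def expo (n : ι → ℕ) (k : ℕ) : Option ι → ℕ := fun o => o.elim k n

theorem expo_injective (n : ι → ℕ) : Function.Injective (expo n) := fun _ _ h => congrFun h none

theorem sum_expo (n : ι → ℕ) (k : ℕ) : ∑ o, expo n k o = k + ∑ i, n i := Fintype.sum_option _

theorem expo_succ (n : ι → ℕ) (k : ℕ) : expo n (k + 1) = expo n k + Pi.single none 1 := by
  funext o
  cases o <;> simp [expo]

namespace ReesAmbient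

variable {F G : (Option ι → ℕ) → Submodule (MvPolynomial τ R) M}

theorem isAt_iff {w : ι ⊕ ι → ℤ} {n : ι → ℕ} (hn : ∀ i, (n i : ℤ) = w (.inr i))
    {κ : Option ι → ℕ} : IsAt w κ ↔ κ = expo n (κ none) := by
  refine ⟨fun h => funext fun o => ?_, fun h i => ?_⟩
  · cases o with
    | none => rfl
    | some i => exact_mod_cast (h i).trans (hn i).symm
  · rw [h, ← hn]
    rfl

theorem entry_eq_proj {w : ι ⊕ ι → ℤ} {κ : Option ι → ℕ} {f : ReesAmbient d γ M}
    (hf : proj d γ q w f = f) :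
    entry (R := R) κ f = if IsAt w κ then q (totalDeg w) (entry (R := R) κ f) else 0 := by
  conv_lhs => rw [← hf]
  rw [entry_proj]

theorem single_mem_homogPart (hF : IsStable d γ F) {w : ι ⊕ ι → ℤ} {κ : Option ι → ℕ}
    (hκ : IsAt w κ) {x : M} (hx : x ∈ homogPart q (F κ) (totalDeg w)) :
    single (R := R) κ x ∈ homogPart (proj d γ q) (coordSub d γ F) w := by
  refine mem_homogPart.2 ⟨single_mem hF (mem_homogPart.1 hx).1, ?_⟩
  rw [proj_single, if_pos hκ, (mem_homogPart.1 hx).2]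

theorem entry_mem_homogPart {w : ι ⊕ ι → ℤ} {κ : Option ι → ℕ} (hκ : IsAt w κ)
    {f : ReesAmbient d γ M} (hf : f ∈ homogPart (proj d γ q) (coordSub d γ F) w) :
    entry (R := R) κ f ∈ homogPart q (F κ) (totalDeg w) := by
  refine mem_homogPart.2 ⟨entry_mem hf.1 κ, ?_⟩
  have h := entry_eq_proj (κ := κ) (mem_homogPart.1 hf).2
  rw [if_pos hκ] at h
  exact h.symm

theorem map_entry_homogPart (hF : IsStable d γ F) {w : ι ⊕ ι → ℤ} {κ : Option ι → ℕ}
    (hκ : IsAt w κ) : (homogPart (proj d γ q) (coordSub d γ F) w).map (entry (R := R) κ) =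
      homogPart q (F κ) (totalDeg w) := by
  refine le_antisymm ?_ fun x hx => ⟨_, single_mem_homogPart hF hκ hx, ?_⟩
  · rintro _ ⟨f, hf, rfl⟩
    exact entry_mem_homogPart hκ hf
  · rw [entry_single, if_pos rfl]

theorem isAt_expo {w : ι ⊕ ι → ℤ} {n : ι → ℕ} (hn : ∀ i, (n i : ℤ) = w (.inr i)) (k : ℕ) :
    IsAt w (expo n k) := (isAt_iff hn).2 rfl

theorem exists_entry_eq (hF : IsStable d γ F) {w : ι ⊕ ι → ℤ} {n : ι → ℕ}
    (hn : ∀ i, (n i : ℤ) = w (.inr i)) (k : ℕ) {f : ReesAmbient d γ M}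
    (hf : f ∈ homogPart (proj d γ q) (coordSub d γ F) w) :
    ∃ f' ∈ homogPart (proj d γ q) (coordSub d γ F) w,
      entry (R := R) (expo n k) f' = entry (R := R) (expo n k) f ∧
      ∀ k', k' ≠ k → entry (R := R) (expo n k') f' = 0 := by
  refine ⟨single (R := R) (expo n k) (entry (R := R) (expo n k) f),
    single_mem_homogPart hF (isAt_expo hn k) (entry_mem_homogPart (isAt_expo hn k) hf), ?_,
    fun k' hk => ?_⟩
  · rw [entry_single, if_pos rfl]
  · rw [entry_single, if_neg fun h => hk (expo_injective n h).symm]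

/-- An element of bidegree `w` lives on the exponents `(n, k)` with `n` fixed by `w`, and entries
with `k ≥ K` satisfy the condition automatically. So only finitely many coordinates matter. -/
theorem mem_coordSub_iff_entries (hG : IsStable d γ G) {w : ι ⊕ ι → ℤ} {n : ι → ℕ}
    (hn : ∀ i, (n i : ℤ) = w (.inr i)) {K : ℕ} (hK : ∀ k, K ≤ k →
      homogPart q (F (expo n k)) (totalDeg w) ≤ (G (expo n k)).restrictScalars R)
    {f : ReesAmbient d γ M} (hf : f ∈ homogPart (proj d γ q) (coordSub d γ F) w) :
    f ∈ (coordSub d γ G).restrictScalars R ↔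
      ∀ k ∈ Finset.range K, entry (R := R) (expo n k) f ∈ (G (expo n k)).restrictScalars R := by
  refine ⟨fun h k _ => entry_mem h _, fun h => (mem_coordSub hG).2 fun κ => ?_⟩
  by_cases hκ : IsAt w κ
  · rw [(isAt_iff hn).1 hκ]
    by_cases hk : κ none < K
    · exact h _ (Finset.mem_range.2 hk)
    · exact hK _ (not_lt.1 hk) (entry_mem_homogPart (isAt_expo hn _) hf)
  · rw [entry_eq_proj (mem_homogPart.1 hf).2, if_neg hκ]
    exact Submodule.zero_mem _

theorem relLength_homogPart_coordSub (hF : IsStable d γ F) (hG : IsStable d γ G) {w : ι ⊕ ι → ℤ}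
    {n : ι → ℕ} (hn : ∀ i, (n i : ℤ) = w (.inr i)) {K : ℕ} (hK : ∀ k, K ≤ k →
      homogPart q (F (expo n k)) (totalDeg w) ≤ (G (expo n k)).restrictScalars R) :
    relLength (homogPart (proj d γ q) (coordSub d γ F) w) ((coordSub d γ G).restrictScalars R) =
      ∑ k ∈ Finset.range K, relLength (homogPart q (F (expo n k)) (totalDeg w))
        ((G (expo n k)).restrictScalars R) := by
  rw [relLength_eq_sum (fun k => entry (R := R) (expo n k))
    (fun k => (G (expo n k)).restrictScalars R) (Finset.range K) _ _
    (fun k _ f hf => exists_entry_eq hF hn k hf)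
    fun f hf => mem_coordSub_iff_entries hG hn hK hf]
  exact Finset.sum_congr rfl fun k _ => by rw [map_entry_homogPart hF (isAt_expo hn k)]

variable [IsLocalRing R]

theorem torLength_homogPart_coordSub (hF : IsStable d γ F) (hG : IsStable d γ G) {w : ι ⊕ ι → ℤ}
    {n : ι → ℕ} (hn : ∀ i, (n i : ℤ) = w (.inr i)) {K : ℕ} (hK : ∀ k, K ≤ k →
      homogPart q (F (expo n k)) (totalDeg w) ≤ (G (expo n k)).restrictScalars R) :
    torLength (homogPart (proj d γ q) (coordSub d γ F) w) ((coordSub d γ G).restrictScalars R) =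
      ∑ k ∈ Finset.range K, torLength (homogPart q (F (expo n k)) (totalDeg w))
        ((G (expo n k)).restrictScalars R) := by
  rw [torLength_eq_sum (fun k => entry (R := R) (expo n k))
    (fun k => (G (expo n k)).restrictScalars R) (Finset.range K) _ _
    (fun k _ f hf => exists_entry_eq hF hn k hf)
    fun f hf => mem_coordSub_iff_entries hG hn hK hf]
  exact Finset.sum_congr rfl fun k _ => by rw [map_entry_homogPart hF (isAt_expo hn k)]

theorem hilbSam_coordSub (hF : IsStable d γ F) (hG : IsStable d γ G) {w : ι ⊕ ι → ℤ}
    {n : ι → ℕ} (hn : ∀ i, (n i : ℤ) = w (.inr i)) {K : ℕ} (hK : ∀ k, K ≤ k →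
      homogPart q (F (expo n k)) (totalDeg w) = ⊥) (s : ℕ) :
    hilbSam (proj d γ q) (coordSub d γ F) (coordSub d γ G) w s =
      ∑ k ∈ Finset.range K, hilbSam q (F (expo n k)) (G (expo n k)) (totalDeg w) s := by
  rw [hilbSam, ← coordSub_maxPow hF, ← coordSub_sup hG (hF.maxPow s),
    relLength_homogPart_coordSub hF (hG.sup (hF.maxPow s)) hn fun k hk => by
      rw [hK k hk]; exact bot_le]
  rfl

end ReesAmbient

section LowDegree

variable [IsLocalRing R] [IsNoetherianRing R] [Fintype τ] (hq : IsGradingProj d q)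

/-- The elements all of whose components of total degree less than `m` vanish. -/
def lowDegree (hq : IsGradingProj d q) (m : ℤ) : Submodule (MvPolynomial τ R) M where
  carrier := {x | ∀ u, ∑ i, u i < m → q u x = 0}
  zero_mem' := fun u _ => map_zero _
  add_mem' := fun hx hy u hu => by rw [map_add, hx u hu, hy u hu, add_zero]
  smul_mem' := by
    intro g x hx
    induction g using MvPolynomial.induction_on generalizing x with
    | C r =>
      intro u hu
      rw [ReesAmbient.C_smul, map_smul, hx u hu, smul_zero]
    | add g g' hg hg' =>
      intro u hu
      rw [add_smul, map_add, hg hx u hu, hg' hx u hu, add_zero]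
    | mul_X g t hg =>
      rw [mul_smul]
      refine hg fun u hu => ?_
      rw [← hq.X_smul_proj_sub, hx, smul_zero]
      simp only [Pi.sub_apply, Finset.sum_sub_distrib, dirWeight]
      rw [Finset.sum_pi_single' (d t) (1 : ℤ) Finset.univ, if_pos (Finset.mem_univ _)]
      omega

include hq

theorem reesPow_smul_le_lowDegree {Q : Submodule (MvPolynomial τ R) M} {m : ℤ}
    (hQ : Q ≤ lowDegree hq m) (κ : Option ι → ℕ) :
    reesPow R d γ κ • Q ≤ lowDegree hq (m + ∑ o, (κ o : ℤ)) := by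
  refine reesPow_smul_le_of_step (S := fun κ => lowDegree hq (m + ∑ o, (κ o : ℤ)))
    (fun o κ => reesIdeal_smul_le fun t _ _ y hy u hu => ?_) (by simpa using hQ) κ
  rw [← hq.X_smul_proj_sub, hy, smul_zero]
  have h1 : ∑ o', ((Pi.single o 1 : Option ι → ℕ) o' : ℤ) = 1 := by
    rw [← Nat.cast_sum, Finset.sum_pi_single' o 1 Finset.univ, if_pos (Finset.mem_univ _)]
    rfl
  simp only [Pi.add_apply, Nat.cast_add, Finset.sum_add_distrib, h1] at hu
  simp only [Pi.sub_apply, Finset.sum_sub_distrib, dirWeight]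
  rw [Finset.sum_pi_single' (d t) (1 : ℤ) Finset.univ, if_pos (Finset.mem_univ _)]
  omega

/-- Degrees in `Q` are bounded below, and every ideal factor raises the total degree by at least
one. This makes the sum over `k` finite in each bidegree. -/
theorem exists_homogPart_reesPow_eq_bot {Q : Submodule (MvPolynomial τ R) M} (hfg : Q.FG)
    (hQ : IsHomog q Q) : ∃ c : ℕ, ∀ (κ : Option ι → ℕ) (u : ι → ℤ),
      ∑ i, u i + c < ∑ o, (κ o : ℤ) → homogPart q (reesPow R d γ κ • Q) u = ⊥ := by
  obtain ⟨c, hc⟩ := hq.exists_homogPart_eq_bot hQ hfg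
  have h : Q ≤ lowDegree hq (-(Fintype.card ι * c : ℕ)) := by
    intro x hx u hu
    obtain ⟨i, hi⟩ : ∃ i, u i < -c := by
      by_contra! h
      have h1 := Finset.sum_le_sum fun i (_ : i ∈ Finset.univ) => h i
      simp at h1 hu
      omega
    have h1 : q u x ∈ homogPart q Q u := ⟨hQ _ _ hx, hq.proj_self _ _⟩
    rwa [hc u i hi] at h1
  refine ⟨Fintype.card ι * c, fun κ u hu => eq_bot_iff.2 fun x hx => ?_⟩
  have h1 := reesPow_smul_le_lowDegree hq h κ (mem_homogPart.1 hx).1 u (by omega)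
  rw [(mem_homogPart.1 hx).2] at h1
  exact h1

end LowDegree

/-- Artin-Rees for the Rees module as a whole gives a constant for each step from `κ` to `κ + e_o`
that does not depend on `κ`; the steps up to `κ` then cost a shift linear in the sum of its entries.
-/
theorem exists_linear_artinRees [IsNoetherianRing R] [IsLocalRing R] [Fintype τ]
    {Q : Submodule (MvPolynomial τ R) M} (hQ : Q.FG) (d : τ → ι) (γ : Finset τ) :
    ∃ c : ℕ, ∀ (κ : Option ι → ℕ) (s : ℕ), maxPow R τ (s + c * ∑ o, κ o) • Q ⊓
      reesPow R d γ κ • Q ≤ maxPow R τ s • (reesPow R d γ κ • Q) := by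
  have hst := IsStable.pow (d := d) (γ := γ) Q
  choose c hc using fun o : Option ι => exists_maxPow_smul_inf_le
    (ReesAmbient.fg_coordSub_pow (d := d) (γ := γ) hQ)
    (ReesAmbient.coordSub d γ fun κ => reesPow R d γ (κ + Pi.single o 1) • Q)
  have hc' : ∀ o κ s, maxPow R τ (s + c o) • (reesPow R d γ κ • Q) ⊓
      reesPow R d γ (κ + Pi.single o 1) • Q ≤
        maxPow R τ s • (reesPow R d γ (κ + Pi.single o 1) • Q) := by
    intro o κ s
    have h := hc o s
    rw [← ReesAmbient.coordSub_maxPow hst, ← ReesAmbient.coordSub_maxPow (hst.shift _),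
      ← ReesAmbient.coordSub_inf] at h
    exact ReesAmbient.le_of_coordSub_le ((hst.maxPow _).inf (hst.shift _)) h κ
  refine ⟨Finset.univ.sup c, fun κ => ?_⟩
  induction κ using exponent_induction with
  | zero =>
    intro s
    rw [reesPow_zero, one_smul]
    simp
  | single_add o κ ih =>
    intro s
    have h1 : ∑ o', (Pi.single o 1 + κ : Option ι → ℕ) o' = ∑ o', κ o' + 1 := by
      simp only [Pi.add_apply, Finset.sum_add_distrib]
      rw [Finset.sum_pi_single' o 1 Finset.univ, if_pos (Finset.mem_univ _), add_comm]
    rw [h1, add_comm _ κ]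
    refine le_trans (le_inf ?_ inf_le_right) (hc' o κ s)
    refine le_trans (le_inf (inf_le_left.trans (Submodule.smul_mono (maxPow_anti ?_) le_rfl))
      (inf_le_right.trans (Submodule.smul_mono (reesPow_anti le_self_add) le_rfl))) (ih (s + c o))
    have := Finset.le_sup (f := c) (Finset.mem_univ o)
    rw [mul_add]
    omega

end ReesGrowth

/-! ### Growth of Rees modules and of their quotients -/

noncomputable section ReesGrowthBounds

open MvPolynomial IsLocalRing

set_option linter.unusedSectionVars false

namespace HasGrowth

variable {ι : Type*} [Fintype ι] {D : ℕ}

theorem natCast_mul {F : (ι → ℤ) → ℕ → ℕ∞} (hF : HasGrowth D F) {L : (ι → ℤ) → ℕ} (b : ℕ)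
    (hL : ∀ w s, L w ≤ b * argSize w s) : HasGrowth (D + 1) fun w s => (L w : ℕ∞) * F w s := by
  obtain ⟨C, c, h⟩ := hF
  refine ⟨b * C, c, fun w s hw hs => ?_⟩
  calc (L w : ℕ∞) * F w s
      ≤ (b * argSize w s : ℕ) * (C * growthBound D (argSize w s) : ℕ) :=
        mul_le_mul' (by exact_mod_cast hL w s) (h w s hw hs)
    _ = (b * C * (argSize w s * growthBound D (argSize w s)) : ℕ) := by push_cast; ring
    _ ≤ _ := by
      exact_mod_cast Nat.mul_le_mul_left _ (mul_growthBound_le D _)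

/-- The substitution produced by linear Artin-Rees: internal degree `v + n`, and a shift of `s`
linear in `v` and `n`. -/
theorem comp_totalDeg {G : (ι → ℤ) → ℕ → ℕ∞} (hG : HasGrowth D G) (c b : ℕ) :
    HasGrowth D fun (w : ι ⊕ ι → ℤ) s => G (ReesAmbient.totalDeg w)
      (s + c * (∑ i, (w (.inl i)).toNat + b + ∑ i, (w (.inr i)).toNat)) := by
  refine hG.comp _ _ (1 + c + c * b) fun c' => ⟨c', fun w s hw hs => ⟨fun i => ?_, ?_, ?_⟩⟩
  · have h1 := hw (.inl i)
    have h2 := hw (.inr i)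
    rw [ReesAmbient.totalDeg]
    omega
  · omega
  · have h1 : ∑ i, (ReesAmbient.totalDeg w i).toNat ≤
        ∑ i, (w (.inl i)).toNat + ∑ i, (w (.inr i)).toNat := by
      rw [← Finset.sum_add_distrib]
      refine Finset.sum_le_sum fun i _ => ?_
      rw [ReesAmbient.totalDeg]
      omega
    rw [argSize, argSize, Fintype.sum_sum_type]
    generalize ∑ i, (w (.inl i)).toNat = x at *
    generalize ∑ i, (w (.inr i)).toNat = y at *
    nlinarith [Nat.zero_le (c * b * (x + y + s)), Nat.zero_le (c * s)]

end HasGrowth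

variable {R τ ι M : Type*} [CommRing R] [IsLocalRing R] [DecidableEq ι] [Fintype ι]
  [AddCommGroup M] [Module R M] [Module (MvPolynomial τ R) M] [IsScalarTower R (MvPolynomial τ R) M]
  {d : τ → ι} {γ : Finset τ} {q : (ι → ℤ) → M →ₗ[R] M}

/-- Telescoping for a descending chain. -/
theorem sum_relLength_sup_le {N : Type*} [AddCommGroup N] [Module R N] (X Y : ℕ → Submodule R N)
    (Z : Submodule R N) (hXY : ∀ k, X k ≤ Y k) (hX : Antitone X) (hY : Antitone Y) (K : ℕ) :
    ∑ k ∈ Finset.range K, relLength (X k) (Y (k + 1) ⊔ Z) ≤ relLength (X 0) (Y K ⊔ Z) := by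
  induction K with
  | zero => simp
  | succ K ih =>
    rw [Finset.sum_range_succ, relLength_add (X := X 0) (Z := Y K ⊔ Z)
      (sup_le_sup_right (hY (Nat.le_succ K)) Z)]
    refine add_le_add ih (relLength_mono_left (le_inf (hX (Nat.zero_le K)) ?_))
    exact (hXY K).trans le_sup_left

/-- Replaces the `𝔪`-adic filtration of `P` by the one induced from `Q`, which does not depend on
the ideal power defining `P`. -/
theorem relLength_sup_le_of_artinRees {Q P P' : Submodule (MvPolynomial τ R) M} (hP' : P' ≤ P)
    {s t : ℕ} (h : maxPow R τ t • Q ⊓ P ≤ maxPow R τ s • P) (u : ι → ℤ) :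
    relLength (homogPart q P u) ((P' ⊔ maxPow R τ s • P).restrictScalars R) ≤
      relLength (homogPart q P u) ((P' ⊔ maxPow R τ t • Q).restrictScalars R) := by
  refine relLength_le le_rfl ?_
  rintro x ⟨hx, hx'⟩
  obtain ⟨a, ha, b, hb, rfl⟩ := Submodule.mem_sup.1 hx'
  refine Submodule.add_mem_sup ha (h ⟨hb, ?_⟩)
  have := P.sub_mem (mem_homogPart.1 hx).1 (hP' ha)
  rwa [add_sub_cancel_left] at this

namespace ReesAmbient

variable [IsNoetherianRing R] [Fintype τ] (hq : IsGradingProj d q)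
  {Q : Submodule (MvPolynomial τ R) M}
include hq

/-- The Rees family of `Q`, its degrees and the linear Artin-Rees property. -/
theorem exists_reesBounds (γ : Finset τ) (hfg : Q.FG) (hQ : IsHomog q Q) :
    ∃ b c : ℕ, ∀ (w : ι ⊕ ι → ℤ) (n : ι → ℕ) (s K t : ℕ), (∀ i, (n i : ℤ) = w (.inr i)) →
      (∀ i, 0 ≤ w (.inl i)) → K = ∑ i, (w (.inl i)).toNat + b →
      t = s + c * (∑ i, (w (.inl i)).toNat + b + ∑ i, (w (.inr i)).toNat) →
      (∀ k, K ≤ k → homogPart q (reesPow R d γ (expo n k) • Q) (totalDeg w) = ⊥) ∧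
      ∀ k < K, maxPow R τ t • Q ⊓ reesPow R d γ (expo n k) • Q ≤
        maxPow R τ s • (reesPow R d γ (expo n k) • Q) := by
  obtain ⟨b, hb⟩ := exists_homogPart_reesPow_eq_bot (γ := γ) hq hfg hQ
  obtain ⟨c, hc⟩ := exists_linear_artinRees hfg d γ
  -- The extra `1` turns the strict inequality in the vanishing bound into `K ≤ k`.
  refine ⟨b + 1, c, fun w n s K t hn hw hK ht => ⟨fun k hk => hb _ _ ?_, fun k hk =>
    le_trans (inf_le_inf (Submodule.smul_mono (maxPow_anti ?_) le_rfl) le_rfl) (hc _ s)⟩⟩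
  · have h1 : ∑ o, (expo n k o : ℤ) = k + ∑ i, (n i : ℤ) := by
      rw [← Nat.cast_sum, sum_expo]
      push_cast
      rfl
    have h2 : ∑ i, totalDeg w i = ∑ i, w (.inl i) + ∑ i, (n i : ℤ) := by
      simp only [totalDeg, hn, Finset.sum_add_distrib]
    have h3 : ((∑ i, (w (.inl i)).toNat : ℕ) : ℤ) = ∑ i, w (.inl i) := by
      rw [Nat.cast_sum]
      exact Finset.sum_congr rfl fun i _ => Int.toNat_of_nonneg (hw i)
    rw [h1, h2, ← h3]
    omega
  · have h1 : ∑ i, n i = ∑ i, (w (.inr i)).toNat :=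
      Finset.sum_congr rfl fun i _ => by rw [← hn]; rfl
    rw [sum_expo, ht, h1]
    refine Nat.add_le_add_left (Nat.mul_le_mul_left c ?_) s
    omega

/-- The Rees module of `Q`. -/
abbrev reesSub (d : τ → ι) (γ : Finset τ) (Q : Submodule (MvPolynomial τ R) M) :
    Submodule (MvPolynomial (ReesVar γ) R) (ReesAmbient d γ M) :=
  coordSub d γ fun κ => reesPow R d γ κ • Q

/-- The number of contributing `k` is linear in `v`, and each contributes at most one value for `Q`;
hence one additional order. -/
theorem hasGrowth_hilbSam_reesSub (hfg : Q.FG) (hQ : IsHomog q Q) {D : ℕ}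
    (h : HasGrowth D (hilbSam q Q ⊥)) :
    HasGrowth (D + 1) (hilbSam (proj d γ q) (reesSub d γ Q) ⊥) := by
  obtain ⟨b, c, hbc⟩ := exists_reesBounds hq γ hfg hQ
  refine ((h.comp_totalDeg c b).natCast_mul (L := fun w => ∑ i, (w (.inl i)).toNat + b) (b + 1)
    fun w s => ?_).of_le ⟨0, fun w s hw _ => ?_⟩
  · rw [argSize, Fintype.sum_sum_type]
    generalize ∑ i, (w (.inl i)).toNat = x
    generalize ∑ i, (w (.inr i)).toNat = y
    nlinarith [Nat.zero_le (b * (x + y + s))]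
  obtain ⟨hbot, har⟩ := hbc w (fun i => (w (.inr i)).toNat) s _ _
    (fun i => Int.toNat_of_nonneg (by simpa using hw (.inr i)))
    (fun i => by simpa using hw (.inl i)) rfl rfl
  rw [← coordSub_bot, hilbSam_coordSub (IsStable.pow Q) (IsStable.const ⊥)
    (fun i => Int.toNat_of_nonneg (by simpa using hw (.inr i))) hbot]
  refine (Finset.sum_le_card_nsmul _ _ _ fun k hk => ?_).trans
    (by rw [Finset.card_range, nsmul_eq_mul])
  refine (relLength_sup_le_of_artinRees bot_le (har k (Finset.mem_range.1 hk)) _).trans ?_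
  exact relLength_mono_left (homogPart_mono (Submodule.smul_le_right))

/-- Only `k = 0` survives in the quotient, so no order is added. -/
theorem hasGrowth_hilbSam_reesSub_positive (hfg : Q.FG) (hQ : IsHomog q Q) {D : ℕ}
    (h : HasGrowth D (hilbSam q Q ⊥)) :
    HasGrowth D (hilbSam (proj d γ q) (reesSub d γ Q)
      (coordSub d γ fun κ => if κ none = 0 then ⊥ else reesPow R d γ κ • Q)) := by
  obtain ⟨b, c, hbc⟩ := exists_reesBounds hq γ hfg hQ
  refine (h.comp_totalDeg c b).of_le ⟨0, fun w s hw _ => ?_⟩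
  obtain ⟨hbot, har⟩ := hbc w (fun i => (w (.inr i)).toNat) s _ _
    (fun i => Int.toNat_of_nonneg (by simpa using hw (.inr i)))
    (fun i => by simpa using hw (.inl i)) rfl rfl
  rw [hilbSam_coordSub (IsStable.pow Q) (IsStable.pow Q).positive
    (fun i => Int.toNat_of_nonneg (by simpa using hw (.inr i))) hbot]
  generalize ∑ i, (w (.inl i)).toNat + b = K at *
  cases K with
  | zero => simp
  | succ K =>
    rw [Finset.sum_range_succ', Finset.sum_eq_zero fun k _ => ?_, zero_add]
    · rw [if_pos (show expo _ 0 none = 0 from rfl)]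
      exact (relLength_sup_le_of_artinRees bot_le (har 0 (Nat.succ_pos K)) _).trans
        (relLength_mono_left (homogPart_mono Submodule.smul_le_right))
    · rw [if_neg (show ¬ expo _ (k + 1) none = 0 from Nat.succ_ne_zero k)]
      exact hilbSam_self _ _ _

/-- The successive quotients in `k` telescope: measured with the filtration induced from `Q`, their
lengths add up to at most one value for `Q`, so no order is added. -/
theorem hasGrowth_hilbSam_reesSub_shift (hfg : Q.FG) (hQ : IsHomog q Q) {D : ℕ}
    (h : HasGrowth D (hilbSam q Q ⊥)) :
    HasGrowth D (hilbSam (proj d γ q) (reesSub d γ Q)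
      (coordSub d γ fun κ => reesPow R d γ (κ + Pi.single none 1) • Q)) := by
  obtain ⟨b, c, hbc⟩ := exists_reesBounds hq γ hfg hQ
  refine (h.comp_totalDeg c b).of_le ⟨0, fun w s hw _ => ?_⟩
  set t := s + c * (∑ i, (w (.inl i)).toNat + b + ∑ i, (w (.inr i)).toNat) with ht
  obtain ⟨hbot, har⟩ := hbc w (fun i => (w (.inr i)).toNat) s _ _
    (fun i => Int.toNat_of_nonneg (by simpa using hw (.inr i)))
    (fun i => by simpa using hw (.inl i)) rfl ht
  rw [hilbSam_coordSub (IsStable.pow Q) ((IsStable.pow Q).shift _)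
    (fun i => Int.toNat_of_nonneg (by simpa using hw (.inr i))) hbot]
  set n := fun i => (w (.inr i)).toNat
  set K := ∑ i, (w (.inl i)).toNat + b
  have hanti : Antitone fun k => reesPow R d γ (expo n k) • Q :=
    antitone_nat_of_succ_le fun k => Submodule.smul_mono
      (by rw [expo_succ]; exact reesPow_anti le_self_add) le_rfl
  calc _ ≤ ∑ k ∈ Finset.range K, relLength (homogPart q (reesPow R d γ (expo n k) • Q) (totalDeg w))
        ((reesPow R d γ (expo n (k + 1)) • Q).restrictScalars R ⊔
          (maxPow R τ t • Q).restrictScalars R) := by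
        refine Finset.sum_le_sum fun k hk => ?_
        refine (relLength_sup_le_of_artinRees (Submodule.smul_mono (reesPow_anti le_self_add) le_rfl)
          (har k (Finset.mem_range.1 hk)) _).trans ?_
        rw [← Submodule.restrictScalars_sup, expo_succ]
    _ ≤ _ := sum_relLength_sup_le
        (fun k => homogPart q (reesPow R d γ (expo n k) • Q) (totalDeg w))
        (fun k => (reesPow R d γ (expo n k) • Q).restrictScalars R) _
        (fun k x hx => (mem_homogPart.1 hx).1) (fun k l hkl => homogPart_mono (hanti hkl))
        (fun k l hkl => hanti hkl) K
    _ ≤ _ := by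
        refine relLength_le (homogPart_mono (Submodule.smul_le_right)) ?_
        rintro x ⟨-, hx⟩
        refine Submodule.mem_sup_right ?_
        rwa [bot_sup_eq] at hx

end ReesAmbient

end ReesGrowthBounds

/-! ### Torsion in the induced Rees module of a submodule -/

noncomputable section TorsionDrop

open MvPolynomial IsLocalRing

set_option linter.unusedSectionVars false

variable {R τ ι M : Type*} [CommRing R] [IsLocalRing R] [IsNoetherianRing R] [Fintype τ]
  [DecidableEq ι] [Fintype ι] [AddCommGroup M] [Module R M] [Module (MvPolynomial τ R) M]
  [IsScalarTower R (MvPolynomial τ R) M]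
  {d : τ → ι} {γ : Finset τ} {q : (ι → ℤ) → M →ₗ[R] M}

namespace ReesAmbient

theorem entry_rename_smul (g : MvPolynomial τ R) (κ : Option ι → ℕ) (f : ReesAmbient d γ M) :
    entry (R := R) κ ((rename Sum.inl g : MvPolynomial (ReesVar γ) R) • f) =
      g • entry (R := R) κ f := by
  induction g using MvPolynomial.induction_on generalizing f with
  | C r => rw [rename_C, C_smul, C_smul, map_smul]
  | add g g' hg hg' => rw [map_add, add_smul, map_add, hg, hg', add_smul]
  | mul_X g t hg =>
    rw [map_mul, rename_X, mul_smul, mul_smul, hg]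
    congr 1
    refine induction (R := R) f ?_ (fun f g hf hg => ?_) fun κ' x => ?_
    · simp
    · rw [smul_add, map_add, hf, hg, map_add, smul_add]
    · rw [X_smul_single, entry_single, entry_single]
      simp only [reesShift, reesBase, Sum.elim_inl, id]
      split_ifs <;> simp

theorem X_pow_smul_single (j : ReesVar γ) (k : ℕ) (κ : Option ι → ℕ) (x : M) :
    (X j ^ k : MvPolynomial (ReesVar γ) R) • (single (R := R) κ x : ReesAmbient d γ M) =
      single (R := R) (κ + k • reesShift d γ j)
        ((X (reesBase γ j) ^ k : MvPolynomial τ R) • x) := by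
  induction k with
  | zero => simp
  | succ k ih =>
    rw [pow_succ', mul_smul, ih, X_smul_single, pow_succ', mul_smul, succ_nsmul]
    congr 2
    abel_nf

/-- The induced Rees module of a submodule. -/
abbrev reesInf (d : τ → ι) (γ : Finset τ) (Q : Submodule (MvPolynomial τ R) M) :
    Submodule (MvPolynomial (ReesVar γ) R) (ReesAmbient d γ M) :=
  coordSub d γ fun κ => reesPow R d γ κ • (⊤ : Submodule (MvPolynomial τ R) M) ⊓ Q

variable {Q : Submodule (MvPolynomial τ R) M}

theorem isStable_inf (Q : Submodule (MvPolynomial τ R) M) : IsStable d γ fun κ =>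
    reesPow R d γ κ • (⊤ : Submodule (MvPolynomial τ R) M) ⊓ Q :=
  (IsStable.pow ⊤).inf (IsStable.const Q)

theorem reesInf_le : reesInf d γ Q ≤ reesSub d γ ⊤ := coordSub_mono fun _ => inf_le_left

theorem reesSub_le_reesInf : reesSub d γ Q ≤ reesInf d γ Q :=
  coordSub_mono fun _ => le_inf (Submodule.smul_mono le_rfl le_top) Submodule.smul_le_right

theorem fg_reesInf (hM : (⊤ : Submodule (MvPolynomial τ R) M).FG) : (reesInf d γ Q).FG :=
  (fg_coordSub_pow hM).of_le reesInf_le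

/-- Artin-Rees for several ideals at once: the induced Rees module is finitely generated, and a
bound `m` on the exponents of its generators limits the loss in each exponent. -/
theorem exists_entry_mem_reesPow_sub (hM : (⊤ : Submodule (MvPolynomial τ R) M).FG) :
    ∃ m : ℕ, ∀ κ, reesPow R d γ κ • (⊤ : Submodule (MvPolynomial τ R) M) ⊓ Q ≤
      reesPow R d γ (fun o => κ o - m) • Q := by
  classical
  obtain ⟨T, hT⟩ := fg_reesInf (d := d) (γ := γ) (Q := Q) hM
  choose s hs using fun f : ReesAmbient d γ M => exists_sum_single (R := R) f
  let m : ℕ := T.sup fun f => (s f).sup fun κ => ∑ o, κ o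
  refine ⟨m, ?_⟩
  have hst : IsStable d γ fun κ => reesPow R d γ (fun o => κ o - m) • Q := by
    intro j κ x hx
    refine Submodule.smul_mono (reesPow_anti fun o => ?_) le_rfl ((IsStable.pow Q) j _ x hx)
    simp only [Pi.add_apply]
    omega
  refine le_of_coordSub_le (isStable_inf Q) (d := d) (γ := γ) ?_
  change reesInf d γ Q ≤ _
  rw [← hT]
  refine Submodule.span_le.2 fun f hf => ?_
  have hf' : f ∈ reesInf d γ Q := hT ▸ Submodule.subset_span hf
  rw [SetLike.mem_coe, hs f]
  refine Submodule.sum_mem _ fun κ hκ => single_mem hst ?_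
  have hκm : ∀ o, κ o ≤ m := fun o =>
    (Finset.single_le_sum (fun o _ => Nat.zero_le (κ o)) (Finset.mem_univ o)).trans
      ((Finset.le_sup (f := fun κ : Option ι → ℕ => ∑ o, κ o) hκ).trans
        (Finset.le_sup (f := fun f => (s f).sup fun κ => ∑ o, κ o) hf))
  have h0 : (fun o => κ o - m) = 0 := funext fun o => Nat.sub_eq_zero_of_le (hκm o)
  rw [h0, reesPow_zero, one_smul]
  exact (entry_mem hf' κ).2

/-- A product of variables of `γ`, one from each direction, lies in all the ideals `reesIdeal` (for
the last one a direction must exist). A high power makes up the loss of `m` in each exponent. -/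
theorem exists_prod_pow_smul_mem [Nonempty ι] (hM : (⊤ : Submodule (MvPolynomial τ R) M).FG) :
    ∃ m : ℕ, ∀ b : ι → τ, (∀ i, b i ∈ γ) → (∀ i, d (b i) = i) → ∀ f ∈ reesInf d γ Q,
      ((∏ i, X (.inl (b i))) ^ m : MvPolynomial (ReesVar γ) R) • f ∈ reesSub d γ Q := by
  obtain ⟨m, hm⟩ := exists_entry_mem_reesPow_sub (d := d) (γ := γ) (Q := Q) hM
  refine ⟨m * Fintype.card (Option ι), fun b hb hdb f hf => ?_⟩
  have hren : ((∏ i, X (.inl (b i))) ^ (m * Fintype.card (Option ι)) :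
      MvPolynomial (ReesVar γ) R) = rename Sum.inl
        ((∏ i, X (b i)) ^ (m * Fintype.card (Option ι)) : MvPolynomial τ R) := by
    simp only [map_pow, map_prod, rename_X]
  rw [hren]
  refine (mem_coordSub (IsStable.pow Q)).2 fun κ => ?_
  rw [entry_rename_smul]
  have hdvd : ∀ i, (∏ i, X (b i) : MvPolynomial τ R) ∈ reesIdeal R d γ (some i) ∧
      (∏ i, X (b i) : MvPolynomial τ R) ∈ reesIdeal R d γ none := fun i =>
    ⟨Ideal.mem_of_dvd _ (Finset.dvd_prod_of_mem _ (Finset.mem_univ i))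
      (X_mem_reesIdeal (hb i) fun i' hi' => by rw [hdb, Option.some_injective _ hi']),
    Ideal.mem_of_dvd _ (Finset.dvd_prod_of_mem _ (Finset.mem_univ i))
      (X_mem_reesIdeal (hb i) fun i' hi' => by cases hi')⟩
  have hmem : (∏ i, X (b i) : MvPolynomial τ R) ^ (m * Fintype.card (Option ι)) ∈
      reesPow R d γ fun _ => m := by
    rw [pow_mul, ← Finset.card_univ, ← Finset.prod_const]
    refine Ideal.prod_mem_prod fun o _ => Ideal.pow_mem_pow ?_ m
    cases o with
    | none => exact (hdvd (Classical.arbitrary ι)).2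
    | some i => exact (hdvd i).1
  have h1 := Submodule.smul_mem_smul hmem (hm κ (entry_mem hf κ))
  rw [← smul_assoc, smul_eq_mul, ← reesPow_add] at h1
  refine Submodule.smul_mono (reesPow_anti fun o => ?_) le_rfl h1
  simp only [Pi.add_apply]
  omega

/-- `X_a` and `X_a T_i` multiply entries by the same polynomial and differ only in position. The
condition on `G` says that moving in direction `i` does not affect membership. -/
theorem X_pow_inr_smul_mem {G : (Option ι → ℕ) → Submodule (MvPolynomial τ R) M}
    (hG : IsStable d γ G)
    (hGshift : ∀ (κ : Option ι → ℕ) (i : ι) (k : ℕ), ∀ x ∈ G κ,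
      x ∈ reesPow R d γ (κ + k • (Pi.single (some i) 1 : Option ι → ℕ)) •
        (⊤ : Submodule (MvPolynomial τ R) M) ⊓ Q →
      x ∈ G (κ + k • (Pi.single (some i) 1 : Option ι → ℕ)))
    {a : γ} {k : ℕ} {y : ReesAmbient d γ M} (hy : y ∈ reesInf d γ Q)
    (hk : (X (.inl a.1) ^ k : MvPolynomial (ReesVar γ) R) • y ∈ coordSub d γ G) :
    (X (.inr (.inl a)) ^ k : MvPolynomial (ReesVar γ) R) • y ∈ coordSub d γ G := by
  obtain ⟨s, hs⟩ := exists_sum_single (R := R) y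
  rw [hs, Finset.smul_sum]
  refine Submodule.sum_mem _ fun κ _ => ?_
  rw [X_pow_smul_single]
  refine single_mem hG (hGshift κ (d a) k _ ?_ ?_)
  · have h1 := entry_mem hk κ
    rw [show (X (.inl a.1) ^ k : MvPolynomial (ReesVar γ) R) =
      rename Sum.inl (X a.1 ^ k : MvPolynomial τ R) by simp, entry_rename_smul] at h1
    exact h1
  · have h1 : (X (.inr (.inl a)) ^ k : MvPolynomial (ReesVar γ) R) •
        (single (R := R) κ (entry (R := R) κ y) : ReesAmbient d γ M) ∈ reesInf d γ Q :=
      Submodule.smul_mem _ _ (single_mem (isStable_inf Q) (entry_mem hy κ))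
    rw [X_pow_smul_single] at h1
    have h2 := entry_mem h1 (κ + k • reesShift d γ (.inr (.inl a)))
    rw [entry_single, if_pos rfl] at h2
    exact h2

variable (hq : IsGradingProj d q)
include hq

/-- Passing from a quotient of the induced Rees module of `Q` to its quotient by the Rees module of
`Q` lowers the order of growth. -/
theorem hasGrowth_hilbSam_reesInf [Nonempty ι] (hM : (⊤ : Submodule (MvPolynomial τ R) M).FG)
    (hA : IsHomog (proj d γ q) (reesInf d γ Q)) (hE : IsHomog (proj d γ q) (reesSub d γ Q))
    {G : (Option ι → ℕ) → Submodule (MvPolynomial τ R) M} (hG : IsStable d γ G)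
    (hGhom : IsHomog (proj d γ q) (coordSub d γ G)) (hGle : coordSub d γ G ≤ reesInf d γ Q)
    (hGshift : ∀ (κ : Option ι → ℕ) (i : ι) (k : ℕ), ∀ x ∈ G κ,
      x ∈ reesPow R d γ (κ + k • (Pi.single (some i) 1 : Option ι → ℕ)) •
        (⊤ : Submodule (MvPolynomial τ R) M) ⊓ Q →
      x ∈ G (κ + k • (Pi.single (some i) 1 : Option ι → ℕ))) {D : ℕ}
    (h : HasGrowth (D + 1) (hilbSam (proj d γ q) (reesInf d γ Q) (coordSub d γ G))) :
    HasGrowth D (hilbSam (proj d γ q) (reesInf d γ Q) (reesSub d γ Q ⊔ coordSub d γ G)) := by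
  have hπ := isGradingProj (γ := γ) hq
  obtain ⟨m, hm⟩ := exists_prod_pow_smul_mem (d := d) (γ := γ) (Q := Q) hM
  refine hπ.hasGrowth_hilbSam_of_primes (fg_reesInf hM) hA (hE.sup hGhom)
    (sup_le reesSub_le_reesInf hGle) fun C hC hBC hCA a x hx hxA hprime hhom => ?_
  by_cases hrel : IsRelevant (reesDir d γ) (colonElem C x)
  swap
  · exact hasGrowth_of_not_isRelevant hrel D
  -- Otherwise a product of variables of `γ`, one per direction, would avoid the prime, although a
  -- power of it carries `x` into the Rees module of `Q`.
  obtain ⟨i, hi⟩ : ∃ i, ∀ t ∈ γ, d t = i →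
      (X (.inl t) : MvPolynomial (ReesVar γ) R) ∈ colonElem C x := by
    by_contra! hcon
    choose b hb hdb hbP using hcon
    have h1 : ((∏ i, X (.inl (b i))) ^ m : MvPolynomial (ReesVar γ) R) ∈ colonElem C x :=
      hBC (Submodule.mem_sup_left (hm b hb hdb x hxA))
    obtain ⟨i, -, hi⟩ := (Ideal.IsPrime.prod_mem_iff (hp := hprime)).1 (hprime.mem_of_pow_mem m h1)
    exact hbP i hi
  -- Relevance in the direction of `n_i` provides a variable `X_a T_i` outside the prime, whereas
  -- `X_a` itself lies in it.
  obtain ⟨j, hj, hjP⟩ := hrel (.inr i)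
  rcases j with t | a' | a'
  · simp [reesDir] at hj
  · have hda : d a' = i := Sum.inr_injective hj
    have hX : (X (.inl a'.1) : MvPolynomial (ReesVar γ) R) ∈ colonElem C x := hi _ a'.2 hda
    rcases hπ.hasGrowth_or_exists_smul_mem h (fg_reesInf hM) hGhom hGle hrel
      (isWeightedHomogeneous_X R (dirWeight (reesDir d γ)) (.inl a'.1)) (fun i => by
        rw [dirWeight, Pi.single_apply]
        split_ifs <;> norm_num) hX hx hxA with hg | ⟨h', hh', k, hk⟩
    · exact hg
    -- If the growth does not drop, `X_a ^ k * h'` carries `x` into the submodule of `G`; then so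
    -- does `(X_a T_i) ^ k * h'`, a product of elements outside the prime.
    · have h0 : (X (.inl a'.1) ^ k : MvPolynomial (ReesVar γ) R) • h' • x ∈ coordSub d γ G := by
        rwa [smul_comm]
      have h1 : (X (.inr (.inl a')) ^ k * h' : MvPolynomial (ReesVar γ) R) ∈ colonElem C x := by
        rw [mem_colonElem, mul_smul]
        exact hBC (Submodule.mem_sup_right (X_pow_inr_smul_mem hG hGshift
          (Submodule.smul_mem _ _ hxA) h0))
      rcases hprime.mem_or_mem h1 with h1 | h1
      · exact absurd (hprime.mem_of_pow_mem k h1) hjP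
      · exact absurd h1 hh'
  · simp [reesDir] at hj

end ReesAmbient

end TorsionDrop

/-! ### Additivity of the torsion lengths up to lower order terms -/

noncomputable section TorsionAdditivity

open MvPolynomial IsLocalRing

set_option linter.unusedSectionVars false

/-- Eliminates `b`, `c` and `x` from the three relations; finiteness of `b + c` permits the
cancellation in `ℕ∞`. -/
theorem add_add_eq_of_relations {a a₁ a₂ b c l x y u v : ℕ∞} (h₁ : a₁ + b = a + u)
    (h₂ : l + c + a₂ = x + v) (h₃ : b + c = x + y) (h : b + c ≠ ⊤) :
    a₁ + a₂ + (l + y) = a + (u + v) := by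
  refine ENat.add_left_injective_of_ne_top h ?_
  calc a₁ + a₂ + (l + y) + (b + c) = (a₁ + b) + (l + c + a₂) + y := by ring
    _ = (a + u) + v + (x + y) := by rw [h₁, h₂]; ring
    _ = a + (u + v) + (b + c) := by rw [h₃]; ring

theorem torLength_sup_left {R N : Type*} [CommRing R] [IsLocalRing R] [AddCommGroup N] [Module R N]
    {X Y Z : Submodule R N} (h : Z ≤ Y) : torLength (Z ⊔ X) Y = torLength X Y := by
  refine relLength_congr (le_antisymm (sup_le ?_ le_sup_right)
    (sup_le_sup_right (inf_le_inf_right _ le_sup_right) _))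
  rintro x ⟨hx, hx'⟩
  obtain ⟨z, hz, y, hy, rfl⟩ := Submodule.mem_sup.1 hx
  refine Submodule.add_mem _ (Submodule.mem_sup_right (h hz)) (Submodule.mem_sup_left ⟨hy, ?_⟩)
  have := (maxSaturation Y).sub_mem hx' (le_maxSaturation Y (h hz))
  rwa [add_sub_cancel_left] at this

section

variable {R σ ι N : Type*} [CommRing R] [IsLocalRing R] [IsNoetherianRing R] [Fintype σ]
  [DecidableEq ι] [Fintype ι] {δ : σ → ι} [AddCommGroup N] [Module R N]
  [Module (MvPolynomial σ R) N] [IsScalarTower R (MvPolynomial σ R) N]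
  {π : (ι → ℤ) → N →ₗ[R] N}

theorem torLength_homogPart_sup {B C : Submodule (MvPolynomial σ R) N} (hB : IsHomog π B)
    (hC : IsHomog π C) (hπ : IsGradingProj δ π) (w : ι → ℤ) :
    torLength (homogPart π (B ⊔ C) w) (B.restrictScalars R) =
      torLength (homogPart π C w) (B.restrictScalars R) := by
  have h : homogPart π (B ⊔ C) w = homogPart π B w ⊔ homogPart π C w := by
    refine le_antisymm ?_ (sup_le (homogPart_mono le_sup_left) (homogPart_mono le_sup_right))
    rintro x ⟨hx, hx'⟩
    obtain ⟨b, hb, c, hc, rfl⟩ := Submodule.mem_sup.1 hx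
    have h1 : π w (b + c) = b + c := hx'
    rw [← h1, map_add]
    exact Submodule.add_mem_sup ⟨hB _ _ hb, hπ.proj_self _ _⟩ ⟨hC _ _ hc, hπ.proj_self _ _⟩
  rw [h, torLength_sup_left fun x hx => (mem_homogPart.1 hx).1]

theorem torLength_homogPart_lt_top (hπ : IsGradingProj δ π)
    {A B : Submodule (MvPolynomial σ R) N} (hA : A.FG) (w : ι → ℤ) :
    torLength (homogPart π A w) (B.restrictScalars R) < ⊤ := by
  have h₁ : (A ⊓ polySaturation B).FG := hA.of_le inf_le_left
  obtain ⟨s, hs⟩ := exists_maxPow_smul_le h₁ inf_le_right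
  rw [torLength, homogPart_inf_polySaturation]
  exact relLength_homogPart_lt_top hπ h₁ hs w

end

variable {R τ ι M : Type*} [CommRing R] [IsLocalRing R] [IsNoetherianRing R] [Fintype τ]
  [DecidableEq ι] [Fintype ι] [AddCommGroup M] [Module R M] [Module (MvPolynomial τ R) M]
  [IsScalarTower R (MvPolynomial τ R) M]
  {d : τ → ι} {γ : Finset τ} {q : (ι → ℤ) → M →ₗ[R] M}

namespace ReesAmbient

variable {Q : Submodule (MvPolynomial τ R) M}

/-- The submodule of the Rees module of `Q` that is generated by the last extra variable times the
ideal generated by `γ`. -/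
abbrev reesShiftSub (d : τ → ι) (γ : Finset τ) (Q : Submodule (MvPolynomial τ R) M) :
    Submodule (MvPolynomial (ReesVar γ) R) (ReesAmbient d γ M) :=
  coordSub d γ fun κ => reesPow R d γ (κ + Pi.single none 1) • Q

/-- The part of the induced Rees module on which the last exponent is positive. -/
abbrev reesInfPositive (d : τ → ι) (γ : Finset τ) (Q : Submodule (MvPolynomial τ R) M) :
    Submodule (MvPolynomial (ReesVar γ) R) (ReesAmbient d γ M) :=
  coordSub d γ fun κ => if κ none = 0 then ⊥ else
    reesPow R d γ κ • (⊤ : Submodule (MvPolynomial τ R) M) ⊓ Q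

theorem reesShiftSub_le : reesShiftSub d γ Q ≤ reesSub d γ Q :=
  coordSub_mono fun _ => Submodule.smul_mono (reesPow_anti le_self_add) le_rfl

theorem reesInfPositive_le : reesInfPositive d γ Q ≤ reesInf d γ Q :=
  coordSub_mono fun _ => by split_ifs; exacts [bot_le, le_rfl]

end ReesAmbient

variable (hq : IsGradingProj d q)

/-- The elements all of whose homogeneous components are in `B`. -/
def homogCore (hq : IsGradingProj d q) (B : Submodule (MvPolynomial τ R) M) :
    Submodule (MvPolynomial τ R) M where
  carrier := {x | ∀ u, q u x ∈ B}
  zero_mem' := fun u => by rw [map_zero]; exact B.zero_mem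
  add_mem' := fun hx hy u => by rw [map_add]; exact B.add_mem (hx u) (hy u)
  smul_mem' := by
    intro g x hx
    induction g using MvPolynomial.induction_on generalizing x with
    | C r =>
      intro u
      rw [ReesAmbient.C_smul, map_smul]
      exact (B.restrictScalars R).smul_mem r (hx u)
    | add g g' hg hg' =>
      intro u
      rw [add_smul, map_add]
      exact B.add_mem (hg hx u) (hg' hx u)
    | mul_X g t hg =>
      rw [mul_smul]
      refine hg fun u => ?_
      rw [← hq.X_smul_proj_sub]
      exact B.smul_mem _ (hx _)

include hq

theorem isHomog_reesPow_smul {Q : Submodule (MvPolynomial τ R) M} (hQ : IsHomog q Q)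
    (κ : Option ι → ℕ) : IsHomog q (reesPow R d γ κ • Q) := by
  intro u x hx
  refine reesPow_smul_le_of_step (S := fun κ => homogCore hq (reesPow R d γ κ • Q))
    (fun o κ => reesIdeal_smul_le fun t ht hd y hy u => ?_)
    (fun x hx u => by rw [reesPow_zero, one_smul]; exact hQ _ _ hx) κ hx u
  rw [← hq.X_smul_proj_sub, reesPow_add, reesPow_single, ← smul_eq_mul, smul_assoc]
  exact Submodule.smul_mem_smul (X_mem_reesIdeal ht hd) (hy _)

namespace ReesAmbient

variable {Q : Submodule (MvPolynomial τ R) M}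

theorem isHomog_reesSub (hQ : IsHomog q Q) : IsHomog (proj d γ q) (reesSub d γ Q) :=
  isHomog_coordSub (IsStable.pow Q) fun κ => isHomog_reesPow_smul hq hQ κ

theorem isHomog_reesInf (hQ : IsHomog q Q) : IsHomog (proj d γ q) (reesInf d γ Q) :=
  isHomog_coordSub (isStable_inf Q) fun κ => (isHomog_reesPow_smul hq IsHomog.top κ).inf hQ

theorem isHomog_reesShiftSub (hQ : IsHomog q Q) : IsHomog (proj d γ q) (reesShiftSub d γ Q) :=
  isHomog_coordSub ((IsStable.pow Q).shift _) fun _ => isHomog_reesPow_smul hq hQ _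

theorem isHomog_reesInfPositive (hQ : IsHomog q Q) :
    IsHomog (proj d γ q) (reesInfPositive d γ Q) := by
  refine isHomog_coordSub (isStable_inf Q).positive fun κ => ?_
  split_ifs
  · exact IsHomog.bot
  · exact (isHomog_reesPow_smul hq IsHomog.top κ).inf hQ

section

variable {D : ℕ} (hM : (⊤ : Submodule (MvPolynomial τ R) M).FG) (hQ : IsHomog q Q)
  (h : HasGrowth D (hilbSam q (⊤ : Submodule (MvPolynomial τ R) M) ⊥))
include hM h hQ

/-- The full Rees module has growth `D + 1`, and dividing the induced one by the Rees module of `Q`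
drops this by one; here `G` is zero. -/
theorem hasGrowth_hilbSam_reesInf_reesSub [Nonempty ι] :
    HasGrowth D (hilbSam (proj d γ q) (reesInf d γ Q) (reesSub d γ Q)) := by
  have h1 := (hasGrowth_hilbSam_reesSub (γ := γ) hq hM IsHomog.top h).hilbSam_of_le
    (fg_coordSub_pow hM) (reesInf_le (Q := Q)) (C₂ := ⊥) inf_le_left
  rw [← coordSub_bot] at h1
  have h2 := hasGrowth_hilbSam_reesInf hq hM (isHomog_reesInf hq hQ) (isHomog_reesSub hq hQ)
    (IsStable.const ⊥) (by rw [coordSub_bot]; exact IsHomog.bot)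
    (by rw [coordSub_bot]; exact bot_le) (fun κ i k x hx _ => hx) h1
  rwa [coordSub_bot, sup_bot_eq] at h2

theorem hasGrowth_hilbSam_reesInf_reesShiftSub [Nonempty ι] :
    HasGrowth D (hilbSam (proj d γ q) (reesInf d γ Q) (reesShiftSub d γ Q)) := by
  have hQ' : HasGrowth D (hilbSam q Q ⊥) := h.hilbSam_of_le hM le_top inf_le_left
  have h1 := hasGrowth_hilbSam_reesInf_reesSub (γ := γ) hq hM hQ h
  have h2 := hasGrowth_hilbSam_reesSub_shift (γ := γ) hq
    (hM.of_le le_top : Q.FG) hQ hQ'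
  exact (h1.add h2).mono fun w s => (isGradingProj (γ := γ) hq).hilbSam_le_add
    (isHomog_reesInf hq hQ) (isHomog_reesSub hq hQ) reesSub_le_reesInf reesShiftSub_le w s

end

/-- The part `k = 0` of the full Rees module grows only like `M`, and dividing by the Rees module of
`Q` saves another order. Positivity of `k` is unaffected by moves in the directions of `n`, as the
drop requires. -/
theorem hasGrowth_hilbSam_reesInf_positive [Nonempty ι] {D : ℕ}
    (hM : (⊤ : Submodule (MvPolynomial τ R) M).FG) (hQ : IsHomog q Q)
    (h : HasGrowth (D + 1) (hilbSam q (⊤ : Submodule (MvPolynomial τ R) M) ⊥)) :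
    HasGrowth D (hilbSam (proj d γ q) (reesInf d γ Q)
      (reesSub d γ Q ⊔ reesInfPositive d γ Q)) := by
  refine hasGrowth_hilbSam_reesInf hq hM (isHomog_reesInf hq hQ) (isHomog_reesSub hq hQ)
    (isStable_inf Q).positive (isHomog_reesInfPositive hq hQ) reesInfPositive_le
    (fun κ i k x hx hx' => ?_) ?_
  · beta_reduce at hx ⊢
    by_cases hκ : κ none = 0
    · rw [if_pos hκ] at hx
      rw [(Submodule.mem_bot _).1 hx]
      exact Submodule.zero_mem _
    · rw [if_neg (by simpa using hκ)]
      exact hx'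
  · refine (hasGrowth_hilbSam_reesSub_positive (γ := γ) hq hM IsHomog.top h).hilbSam_of_le
      (fg_coordSub_pow hM) reesInf_le ?_
    rw [← coordSub_inf]
    refine coordSub_mono fun κ => ?_
    split_ifs
    · exact inf_le_left
    · exact inf_le_right

/-- The part at `k` of the last quotient equals the part at `k + 1` of `reesInf / reesSub`. Only the
part at `k = 0` is left over, which is the first summand; hence `K + 1` exponents on one side and
`K` on the other. -/
theorem torLength_reesInf_reesSub (hM : (⊤ : Submodule (MvPolynomial τ R) M).FG)
    {w : ι ⊕ ι → ℤ} (hw : ∀ i, 0 ≤ w i) :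
    torLength (homogPart (proj d γ q) (reesInf d γ Q) w) ((reesSub d γ Q).restrictScalars R) =
      torLength (homogPart (proj d γ q) (reesInf d γ Q) w)
          ((reesSub d γ Q ⊔ reesInfPositive d γ Q).restrictScalars R) +
        torLength (homogPart (proj d γ q) (reesInf d γ Q ⊓ reesShiftSub d γ ⊤) w)
          ((reesShiftSub d γ Q).restrictScalars R) := by
  obtain ⟨b, c, hbc⟩ := exists_reesBounds hq γ hM IsHomog.top
  have hn : ∀ i, (((w (.inr i)).toNat : ℕ) : ℤ) = w (.inr i) := fun i =>
    Int.toNat_of_nonneg (hw (.inr i))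
  obtain ⟨hbot, -⟩ := hbc w (fun i => (w (.inr i)).toNat) 0 _ _ hn (fun i => hw (.inl i)) rfl rfl
  generalize ∑ i, (w (.inl i)).toNat + b = K at hbot
  have hbot' : ∀ k, K ≤ k → ∀ (P P' : Submodule (MvPolynomial τ R) M),
      P ≤ reesPow R d γ (expo (fun i => (w (.inr i)).toNat) k) • ⊤ →
      homogPart q P (totalDeg w) ≤ P'.restrictScalars R := fun k hk P P' hP =>
    (homogPart_mono hP).trans ((hbot k hk).trans_le bot_le)
  have hst : IsStable d γ fun κ => (reesPow R d γ κ • (⊤ : Submodule (MvPolynomial τ R) M) ⊓ Q) ⊓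
      reesPow R d γ (κ + Pi.single none 1) • (⊤ : Submodule (MvPolynomial τ R) M) :=
    (isStable_inf Q).inf ((IsStable.pow ⊤).shift _)
  rw [← coordSub_inf, ← coordSub_sup (IsStable.pow Q) (isStable_inf Q).positive,
    torLength_homogPart_coordSub (isStable_inf Q) (IsStable.pow Q) hn (K := K + 1)
      (fun k hk => hbot' k (by omega) _ _ inf_le_left),
    torLength_homogPart_coordSub (isStable_inf Q)
      ((IsStable.pow Q).sup (isStable_inf Q).positive) hn (K := K + 1)
      (fun k hk => hbot' k (by omega) _ _ inf_le_left),
    torLength_homogPart_coordSub hst ((IsStable.pow Q).shift _) hn (K := K)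
      (fun k hk => hbot' k hk _ _ (inf_le_left.trans inf_le_left)),
    Finset.sum_range_succ', Finset.sum_range_succ', add_comm, add_comm (Finset.sum _ _)]
  refine congrArg₂ (· + ·) ?_ (Finset.sum_congr rfl fun k _ => ?_)
  · rw [Finset.sum_eq_zero fun k _ => ?_, add_zero, if_pos (show expo _ 0 none = 0 from rfl),
      sup_bot_eq]
    rw [if_neg (show ¬ expo _ (k + 1) none = 0 from Nat.succ_ne_zero k)]
    exact torLength_eq_zero fun x hx => Submodule.mem_sup_right (mem_homogPart.1 hx).1
  · rw [expo_succ]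
    congr 2
    exact le_antisymm (le_inf (le_inf (inf_le_left.trans
      (Submodule.smul_mono (reesPow_anti le_self_add) le_rfl)) inf_le_right) inf_le_left)
      (le_inf inf_le_right (inf_le_left.trans inf_le_right))

/-- With `J` the induced Rees module of `Q`, `A₁` the shifted Rees module of `M` and `E ⊇ E₁` those
of `Q`, compare three chains: `A₁ ⊆ A₁ + J` in the Rees module of `M`, and `E₁ ⊆ E ⊆ J` and `E₁ ⊆ J
∩ A₁ ⊆ J`. Each is additive up to a defect of growth `D`; `J/E` and `(J ∩ A₁)/E₁` cancel up to the
part `k = 0`. -/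
theorem exists_torLength_additivity [Nonempty ι]
    (hM : (⊤ : Submodule (MvPolynomial τ R) M).FG) (hQ : IsHomog q Q) {D : ℕ}
    (h : HasGrowth (D + 1) (hilbSam q (⊤ : Submodule (MvPolynomial τ R) M) ⊥)) :
    ∃ U V : (ι ⊕ ι → ℤ) → ℕ → ℕ∞, HasGrowth D U ∧ HasGrowth D V ∧
      ∀ (w : ι ⊕ ι → ℤ) (s : ℕ), (∀ i, 0 ≤ w i) →
        torLength (homogPart (proj d γ q) (reesSub d γ (⊤ : Submodule (MvPolynomial τ R) M)) w)
            ((reesShiftSub d γ (⊤ : Submodule (MvPolynomial τ R) M) ⊔ reesInf d γ Q).restrictScalars R) +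
          torLength (homogPart (proj d γ q) (reesSub d γ Q) w)
            ((reesShiftSub d γ Q).restrictScalars R) + U w s =
        torLength (homogPart (proj d γ q) (reesSub d γ (⊤ : Submodule (MvPolynomial τ R) M)) w)
            ((reesShiftSub d γ (⊤ : Submodule (MvPolynomial τ R) M)).restrictScalars R) + V w s := by
  have hπ := isGradingProj (γ := γ) hq
  have hfg := fg_coordSub_pow (d := d) (γ := γ) hM
  have hA := isHomog_reesSub (d := d) (γ := γ) hq (Q := ⊤) IsHomog.top
  have hA₁ := isHomog_reesShiftSub (d := d) (γ := γ) hq (Q := ⊤) IsHomog.top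
  have hI := isHomog_reesInf (d := d) (γ := γ) hq hQ
  have hE := isHomog_reesSub (d := d) (γ := γ) hq hQ
  have hE₁ := isHomog_reesShiftSub (d := d) (γ := γ) hq hQ
  have hfgI := fg_reesInf (d := d) (γ := γ) (Q := Q) hM
  have hle : reesShiftSub d γ Q ≤ reesInf d γ Q ⊓ reesShiftSub d γ (⊤ : Submodule (MvPolynomial τ R) M) :=
    le_inf (reesShiftSub_le.trans reesSub_le_reesInf)
      (coordSub_mono fun _ => Submodule.smul_mono le_rfl le_top)
  have g1 := hasGrowth_hilbSam_reesSub_shift (γ := γ) hq hM IsHomog.top h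
  have g2 := hasGrowth_hilbSam_reesInf_reesShiftSub (γ := γ) hq hM hQ h
  have g3 := (hasGrowth_hilbSam_reesInf_positive (γ := γ) hq hM hQ h).torLength hfgI
    (sup_le reesSub_le_reesInf reesInfPositive_le)
  have hB := hA₁.sup hI
  have w1 := hπ.hasGrowth_torLength_defect hfg hA hB hA₁ (sup_le reesShiftSub_le reesInf_le)
    le_sup_left g1
  have w2 := hπ.hasGrowth_torLength_defect hfgI hI hE hE₁ reesSub_le_reesInf reesShiftSub_le g2
  have w3 := hπ.hasGrowth_torLength_defect hfgI hI (hI.inf hA₁) hE₁ inf_le_left hle g2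
  refine ⟨_, _, g3.add w3, w1.add w2, fun w s hw => ?_⟩
  have e1 := hπ.torLength_add hA hB hA₁ (sup_le reesShiftSub_le reesInf_le) le_sup_left w
  have e2 := hπ.torLength_add hI hE hE₁ reesSub_le_reesInf reesShiftSub_le w
  have e3 := hπ.torLength_add hI (hI.inf hA₁) hE₁ inf_le_left hle w
  have e4 := torLength_reesInf_reesSub (d := d) (γ := γ) (Q := Q) hq hM hw
  rw [torLength_homogPart_sup hA₁ hI hπ] at e1
  have e5 : torLength (homogPart (proj d γ q) (reesInf d γ Q) w)
      ((reesShiftSub d γ (⊤ : Submodule (MvPolynomial τ R) M)).restrictScalars R) =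
      torLength (homogPart (proj d γ q) (reesInf d γ Q) w)
        ((reesInf d γ Q ⊓ reesShiftSub d γ (⊤ : Submodule (MvPolynomial τ R) M)).restrictScalars R) :=
    torLength_congr_right (le_antisymm (fun x hx => ⟨hx.1, (mem_homogPart.1 hx.1).1, hx.2⟩)
      (fun x hx => ⟨hx.1, hx.2.2⟩))
  rw [e5] at e1
  rw [e4] at e2
  have f1 := torLength_homogPart_lt_top hπ hfgI (B := reesInf d γ Q ⊓ reesShiftSub d γ (⊤ : Submodule (MvPolynomial τ R) M)) w
  have f2 := torLength_homogPart_lt_top hπ (hfgI.of_le (inf_le_left :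
    reesInf d γ Q ⊓ reesShiftSub d γ (⊤ : Submodule (MvPolynomial τ R) M) ≤ reesInf d γ Q)) (B := reesShiftSub d γ Q) w
  exact add_add_eq_of_relations e1 e2 e3 (WithTop.add_ne_top.2 ⟨f1.ne, f2.ne⟩)

end ReesAmbient

end TorsionAdditivity

/-! ### Hilbert polynomials of the torsion of Rees modules -/

noncomputable section TorsionPolynomials

open MvPolynomial IsLocalRing

set_option linter.unusedSectionVars false

theorem coeff_eq_zero_of_hasGrowth {κ : Type*} [Fintype κ] {D : ℕ} {F : (κ → ℤ) → ℕ → ℕ∞}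
    (hF : HasGrowth D F) {P : MvPolynomial κ ℚ} {c : ℕ}
    (hP : ∀ w : κ → ℕ, (∀ i, c ≤ w i) → ∀ s l : ℕ, F (fun i => w i) s ≤ l →
      |eval (fun i => (w i : ℚ)) P| ≤ l) {ρ : κ →₀ ℕ} (hρ : D ≤ ∑ i, ρ i) : coeff ρ P = 0 := by
  by_contra hne
  obtain ⟨C, c', h⟩ := hF
  -- The bound on `F` needs `s ≥ c'`; freezing `s = c'` enlarges the size by a factor of at most `c'
  -- + 1`, which accounts for the constant.
  refine absurd (sum_lt_of_growthBound (D := D) (C := C * (c' + 2) ^ D) (c := max c c')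
    (fun w hw => ?_) hne) (not_lt.2 hρ)
  refine (hP w (fun i => (le_max_left _ _).trans (hw i)) c' _ (h _ c'
    (fun i => by exact_mod_cast (le_max_right _ _).trans (hw i)) le_rfl)).trans ?_
  have h1 : argSize (fun i => (w i : ℤ)) c' ≤ (c' + 1) * (1 + ∑ i, w i) := by
    simp only [argSize, Int.toNat_natCast]
    nlinarith [Nat.zero_le (c' * ∑ i, w i)]
  have h2 := (growthBound_mono D h1).trans (growthBound_mul_le D _ _)
  have h3 : C * growthBound D (argSize (fun i => (w i : ℤ)) c') ≤
      C * (c' + 2) ^ D * growthBound D (1 + ∑ i, w i) := by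
    rw [mul_assoc]
    exact Nat.mul_le_mul_left C h2
  exact_mod_cast h3

variable {R τ ι M : Type*} [CommRing R] [IsLocalRing R] [IsNoetherianRing R] [Fintype τ]
  [DecidableEq ι] [Fintype ι] [AddCommGroup M] [Module R M] [Module (MvPolynomial τ R) M]
  [IsScalarTower R (MvPolynomial τ R) M]
  {d : τ → ι} {γ : Finset τ} {q : (ι → ℤ) → M →ₗ[R] M}

/-- The function of the lengths of the torsion of `A` modulo `B`. -/
def torFunction {σ ι N : Type*} [AddCommGroup N] [Module R N] [Module (MvPolynomial σ R) N]
    [IsScalarTower R (MvPolynomial σ R) N] (π : (ι → ℤ) → N →ₗ[R] N)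
    (A B : Submodule (MvPolynomial σ R) N) (w : ι → ℕ) : ℕ∞ :=
  torLength (homogPart π A fun i => w i) (B.restrictScalars R)

theorem exists_isHilbertPolynomial_torFunction {σ ι N : Type*} [Fintype σ] [Fintype ι]
    [DecidableEq ι] {δ : σ → ι} [AddCommGroup N] [Module R N]
    [Module (MvPolynomial σ R) N] [IsScalarTower R (MvPolynomial σ R) N]
    {π : (ι → ℤ) → N →ₗ[R] N} (hπ : IsGradingProj δ π) {A B : Submodule (MvPolynomial σ R) N}
    (hfg : A.FG) (hA : IsHomog π A) (hB : IsHomog π B) (hBA : B ≤ A) {D : ℕ}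
    (h : HasGrowth D (hilbSam π A B)) :
    ∃ P, IsHilbertPolynomial (torFunction π A B) P ∧ ∀ ρ, D ≤ ∑ i, ρ i → coeff ρ P = 0 := by
  obtain ⟨P, c, hP⟩ := hπ.exists_polynomial_torLength hfg hA hB
  have hP' : ∀ w : ι → ℕ, (∀ i, c ≤ w i) → ∃ l : ℕ, torFunction π A B w = (l : ℕ∞) ∧
      eval (fun i => (w i : ℚ)) P = l := fun w hw => by
    obtain ⟨l, hl, hl'⟩ := hP (fun i => w i) fun i => by exact_mod_cast hw i
    exact ⟨l, hl, by simpa using hl'⟩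
  refine ⟨P, ⟨c, hP'⟩, fun ρ hρ => coeff_eq_zero_of_hasGrowth (h.torLength hfg hBA) (c := c)
    (fun w hw s l hl => ?_) hρ⟩
  obtain ⟨l', h1, h2⟩ := hP' w hw
  change torFunction π A B w ≤ l at hl
  rw [h1] at hl
  rw [h2, Nat.abs_cast]
  exact_mod_cast hl

open ReesAmbient in
/-- The Hilbert polynomials of the torsion of the modules attached to `M`, to a submodule `Q` and to
the quotient by it. -/
theorem exists_hilbertPolynomials [Nonempty ι] (hq : IsGradingProj d q)
    (hM : (⊤ : Submodule (MvPolynomial τ R) M).FG) {Q : Submodule (MvPolynomial τ R) M}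
    (hQ : IsHomog q Q) {D : ℕ}
    (h : HasGrowth (D + 1) (hilbSam q (⊤ : Submodule (MvPolynomial τ R) M) ⊥)) :
    ∃ P P₁ P₂ : MvPolynomial (ι ⊕ ι) ℚ,
      IsHilbertPolynomial (torFunction (proj d γ q)
        (reesSub d γ (⊤ : Submodule (MvPolynomial τ R) M)) (reesShiftSub d γ ⊤)) P ∧
      IsHilbertPolynomial (torFunction (proj d γ q) (reesSub d γ Q) (reesShiftSub d γ Q)) P₁ ∧
      IsHilbertPolynomial (torFunction (proj d γ q)
        (reesSub d γ (⊤ : Submodule (MvPolynomial τ R) M))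
        (reesShiftSub d γ ⊤ ⊔ reesInf d γ Q)) P₂ ∧
      (∀ ρ, D < ∑ i, ρ i → coeff ρ P = 0 ∧ coeff ρ P₁ = 0 ∧ coeff ρ P₂ = 0) ∧
      ∀ ρ, D ≤ ∑ i, ρ i → coeff ρ P = coeff ρ P₁ + coeff ρ P₂ := by
  have hπ := isGradingProj (γ := γ) hq
  have hQfg : Q.FG := hM.of_le le_top
  have g := hasGrowth_hilbSam_reesSub_shift (γ := γ) hq hM IsHomog.top h
  have g₁ := hasGrowth_hilbSam_reesSub_shift (γ := γ) hq hQfg hQ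
    (h.hilbSam_of_le hM le_top inf_le_left)
  have hle : reesShiftSub d γ ⊤ ⊔ reesInf d γ Q ≤ reesSub d γ ⊤ := sup_le reesShiftSub_le reesInf_le
  have hA := isHomog_reesSub (d := d) (γ := γ) hq (Q := ⊤) IsHomog.top
  have hA₁ := isHomog_reesShiftSub (d := d) (γ := γ) hq (Q := ⊤) IsHomog.top
  have hI := isHomog_reesInf (d := d) (γ := γ) hq hQ
  have hfg := fg_coordSub_pow (d := d) (γ := γ) hM
  have g₂ := g.hilbSam_of_le (C₂ := reesShiftSub d γ ⊤ ⊔ reesInf d γ Q) hfg le_rfl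
    (inf_le_left.trans le_sup_left)
  obtain ⟨P, ⟨c, hP⟩, hPd⟩ := exists_isHilbertPolynomial_torFunction hπ hfg hA hA₁
    reesShiftSub_le g
  obtain ⟨P₁, ⟨c₁, hP₁⟩, hPd₁⟩ := exists_isHilbertPolynomial_torFunction hπ
    (fg_coordSub_pow (d := d) (γ := γ) hQfg) (isHomog_reesSub (d := d) (γ := γ) hq hQ)
    (isHomog_reesShiftSub (d := d) (γ := γ) hq hQ) reesShiftSub_le g₁
  obtain ⟨P₂, ⟨c₂, hP₂⟩, hPd₂⟩ := exists_isHilbertPolynomial_torFunction hπ hfg hA (hA₁.sup hI)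
    hle g₂
  refine ⟨P, P₁, P₂, ⟨c, hP⟩, ⟨c₁, hP₁⟩, ⟨c₂, hP₂⟩, fun ρ hρ => ⟨hPd ρ hρ, hPd₁ ρ hρ, hPd₂ ρ hρ⟩,
    fun ρ hρ => ?_⟩
  obtain ⟨U, V, hU, hV, hUV⟩ := exists_torLength_additivity (γ := γ) hq hM hQ h
  -- The defects bound the values of `P - P₁ - P₂` in absolute value by `U + V`, which has growth
  -- `D`.
  have key : coeff ρ (P - P₁ - P₂) = 0 := by
    refine coeff_eq_zero_of_hasGrowth (hU.add hV) (c := max c (max c₁ c₂))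
      (fun w hw s l hl => ?_) hρ
    obtain ⟨x, hx, hx'⟩ := hP w fun i => (le_max_left _ _).trans (hw i)
    obtain ⟨x₁, hx₁, hx₁'⟩ := hP₁ w fun i =>
      ((le_max_left _ _).trans (le_max_right _ _)).trans (hw i)
    obtain ⟨x₂, hx₂, hx₂'⟩ := hP₂ w fun i =>
      ((le_max_right _ _).trans (le_max_right _ _)).trans (hw i)
    have e := hUV (fun i => w i) s fun i => Int.natCast_nonneg _
    simp only [torFunction] at hx hx₁ hx₂
    rw [hx, hx₁, hx₂] at e
    have hU' : U (fun i => w i) s ≠ ⊤ := ne_top_of_le_ne_top (ENat.natCast_ne_top l)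
      (le_self_add.trans hl)
    have hV' : V (fun i => w i) s ≠ ⊤ := ne_top_of_le_ne_top (ENat.natCast_ne_top l)
      (le_add_self.trans hl)
    obtain ⟨u, hu⟩ := ENat.ne_top_iff_exists.1 hU'
    obtain ⟨v, hv⟩ := ENat.ne_top_iff_exists.1 hV'
    rw [← hu, ← hv] at e hl
    have e' : x₂ + x₁ + u = x + v := by exact_mod_cast e
    have hl' : u + v ≤ l := by exact_mod_cast hl
    have e'' : (x₂ : ℚ) + x₁ + u = x + v := by exact_mod_cast e'
    have hl'' : (u : ℚ) + v ≤ l := by exact_mod_cast hl'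
    rw [map_sub, map_sub, hx', hx₁', hx₂', abs_le]
    have := Nat.cast_nonneg (α := ℚ) u
    have := Nat.cast_nonneg (α := ℚ) v
    constructor <;> linarith
  rw [coeff_sub, coeff_sub] at key
  linarith

end TorsionPolynomials

/-! ### Growth and the dimension of the support -/

noncomputable section SupportDimension

open MvPolynomial IsLocalRing

set_option linter.unusedSectionVars false

/-- Strict specializations give a strictly descending chain of point closures, hence the passage to
the order dual. -/
theorem natCast_le_topologicalKrullDim {T : Type*} [TopologicalSpace T] {n : ℕ} (x : Fin (n + 1) → T)
    (h : ∀ i : Fin n, x i.castSucc ⤳ x i.succ ∧ ¬ x i.succ ⤳ x i.castSucc) :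
    (n : WithBot ℕ∞) ≤ topologicalKrullDim T := by
  let c : T → TopologicalSpace.IrreducibleCloseds T := fun y =>
    ⟨closure {y}, isIrreducible_singleton.closure, isClosed_closure⟩
  have hc : ∀ y z, c y ≤ c z ↔ z ⤳ y := fun y z => specializes_iff_closure_subset.symm
  let l : LTSeries (TopologicalSpace.IrreducibleCloseds T)ᵒᵈ :=
    { length := n
      toFun := fun i => OrderDual.toDual (c (x i))
      step := fun i => by
        change c (x i.succ) < c (x i.castSucc)
        rw [lt_iff_le_not_ge, hc, hc]
        exact h i }
  have := Order.LTSeries.length_le_krullDim l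
  rwa [Order.krullDim_orderDual] at this

variable {p : ℕ} {R B M τ : Type*} [CommRing R] [IsNoetherianRing R] [IsLocalRing R] [CommRing B]
  [Algebra R B] {𝒜 : (Fin p → ℕ) → Submodule R B} [GradedAlgebra 𝒜] [Fintype τ]
  [Algebra (MvPolynomial τ R) B] [IsScalarTower R (MvPolynomial τ R) B]
  [AddCommGroup M] [Module R M] [Module B M] [IsScalarTower R B M] [Module.Finite B M]
  [Module (MvPolynomial τ R) M] [IsScalarTower R (MvPolynomial τ R) M]
  [IsScalarTower (MvPolynomial τ R) B M] {d : τ → Fin p}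

theorem algebraMap_mem_of_isWeightedHomogeneous
    (hX : ∀ t, algebraMap (MvPolynomial τ R) B (X t) ∈ 𝒜 (Pi.single (d t) 1))
    {g : MvPolynomial τ R} {u : Fin p → ℤ} (hg : IsWeightedHomogeneous (dirWeight d) g u) :
    algebraMap (MvPolynomial τ R) B g ∈ 𝒜 fun i => (u i).toNat := by
  rw [g.as_sum, map_sum]
  refine Submodule.sum_mem _ fun n hn => ?_
  have hu : ∑ t, n t • (Pi.single (d t) 1 : Fin p → ℕ) = fun i => (u i).toNat := by
    rw [← hg (mem_support_iff.1 hn)]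
    funext i
    have h1 : Finsupp.weight (dirWeight d) n i = ((∑ t, if d t = i then n t else 0 : ℕ) : ℤ) := by
      rw [weight_dirWeight_apply]
      push_cast
      rfl
    rw [h1, Int.toNat_natCast, Finset.sum_apply]
    refine Finset.sum_congr rfl fun t _ => ?_
    simp [Pi.single_apply, eq_comm]
  have h2 : monomial n (coeff n g) = coeff n g • ∏ t, (X t : MvPolynomial τ R) ^ n t := by
    rw [monomial_eq, Finsupp.prod_fintype _ _ fun t => pow_zero _, smul_eq_C_mul]
  rw [h2, ← hu, Algebra.smul_def, map_mul, ← IsScalarTower.algebraMap_apply, ← Algebra.smul_def,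
    map_prod]
  refine Submodule.smul_mem _ _ ?_
  simp only [map_pow]
  exact SetLike.prod_pow_mem_graded 𝒜 _ _ _ fun t _ => hX t

variable (hX : ∀ t, algebraMap (MvPolynomial τ R) B (X t) ∈ 𝒜 (Pi.single (d t) 1))
  (hsurj : Function.Surjective (algebraMap (MvPolynomial τ R) B))
include hX

theorem isHomogeneous_map {𝔔 : Ideal (MvPolynomial τ R)}
    (h𝔔 : IsHomog (weightedHomogeneousComponent (R := R) (dirWeight d)) 𝔔) :
    (𝔔.map (algebraMap (MvPolynomial τ R) B)).IsHomogeneous 𝒜 := by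
  have h : 𝔔 = Ideal.span {g | g ∈ 𝔔 ∧ ∃ u, IsWeightedHomogeneous (dirWeight d) g u} := by
    refine le_antisymm (fun g hg => ?_) (Ideal.span_le.2 fun g hg => hg.1)
    obtain ⟨s, hs⟩ := (isGradingProj_weightedHomogeneousComponent (R := R) d).exists_sum g
    rw [← hs]
    exact Submodule.sum_mem _ fun u _ => Ideal.subset_span ⟨h𝔔 u g hg, u,
      weightedHomogeneousComponent_isWeightedHomogeneous _ _⟩
  rw [h, Ideal.map_span]
  refine Ideal.homogeneous_span 𝒜 _ ?_
  rintro _ ⟨g, ⟨-, u, hu⟩, rfl⟩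
  exact ⟨_, algebraMap_mem_of_isWeightedHomogeneous hX hu⟩

theorem not_irrelevantIdeal_le {𝔔 : Ideal (MvPolynomial τ R)} [h𝔔 : 𝔔.IsPrime]
    (hrel : IsRelevant d 𝔔) {J : Ideal B} (hJ : J.comap (algebraMap (MvPolynomial τ R) B) ≤ 𝔔) :
    ¬ irrelevantIdeal 𝒜 ≤ J := by
  choose t ht htQ using hrel
  intro hle
  have h1 : ∏ i, X (t i) ∈ 𝔔 := by
    refine hJ (hle (Ideal.subset_span ⟨∑ i, Pi.single i 1, fun i => ?_, ?_⟩))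
    · rw [Finset.sum_apply, Finset.sum_pi_single i (fun _ => 1) Finset.univ]
      simp
    · rw [map_prod]
      refine SetLike.prod_mem_graded 𝒜 _ _ fun i _ => ?_
      have := hX (t i)
      rwa [ht] at this
  obtain ⟨i, -, hi⟩ := (Ideal.IsPrime.prod_mem_iff (hp := h𝔔)).1 h1
  exact htQ i hi

include hsurj

/-- The kernel of `S → B` annihilates `M`, so it lies in every prime of a chain above `𝔓`. A chain
of `D + 1` strict inclusions of relevant homogeneous primes would therefore map to one in the
support of the sheaf, of dimension at most `D`. -/
theorem primeChainBound_of_dimSheafSupport_le {D : ℕ}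
    (hD : dimSheafSupport M 𝒜 ≤ (D : WithBot ℕ∞)) {𝔓 : Ideal (MvPolynomial τ R)} (h𝔓 : 𝔓.IsPrime)
    (hhom : IsHomog (weightedHomogeneousComponent (R := R) (dirWeight d)) 𝔓)
    (hann : ∀ g : MvPolynomial τ R, (∀ x : M, g • x = 0) → g ∈ 𝔓) : PrimeChainBound d (D + 1) 𝔓 := by
  by_contra hcon
  obtain ⟨hrel, l, hl, hlen⟩ := exists_ltSeries_of_not_primeChainBound h𝔓 hhom hcon
  have hge : ∀ i, 𝔓 ≤ (l i).1 := fun i => by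
    have := l.head_le i
    rw [hl] at this
    exact this
  have hker : ∀ i, RingHom.ker (algebraMap (MvPolynomial τ R) B) ≤ (l i).1 := fun i g hg =>
    hge i (hann g fun x => by
      rw [← algebraMap_smul B g x, (RingHom.mem_ker).1 hg, zero_smul])
  have hcomap : ∀ i, ((l i).1.map (algebraMap (MvPolynomial τ R) B)).comap
      (algebraMap (MvPolynomial τ R) B) = (l i).1 := fun i => by
    rw [Ideal.comap_map_of_surjective' _ hsurj, sup_eq_left.2 (hker i)]
  have hprime : ∀ i, ((l i).1.map (algebraMap (MvPolynomial τ R) B)).IsPrime := fun i =>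
    have := (l i).2.1
    Ideal.map_isPrime_of_surjective hsurj (hker i)
  let x : Fin (l.length + 1) → sheafSupport M 𝒜 := fun i => ⟨⟨_, hprime i⟩,
    ⟨isHomogeneous_map hX (l i).2.2.1, by
      have := (l i).2.1
      exact not_irrelevantIdeal_le hX (l i).2.2.2 (hcomap i).le⟩, by
    rw [Module.mem_support_iff_of_finite]
    intro b hb
    obtain ⟨g, rfl⟩ := hsurj b
    refine Ideal.mem_map_of_mem _ (hge i (hann g fun x => ?_))
    rw [← algebraMap_smul B g x]
    exact Module.mem_annihilator.1 hb x⟩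
  have hx : ∀ i j, x i ⤳ x j ↔ (l i).1 ≤ (l j).1 := fun i j => by
    rw [subtype_specializes_iff, ← PrimeSpectrum.le_iff_specializes]
    refine ⟨fun h => ?_, fun h => Ideal.map_mono h⟩
    rw [← hcomap i, ← hcomap j]
    exact Ideal.comap_mono h
  have h1 := natCast_le_topologicalKrullDim x fun i => by
    rw [hx, hx]
    exact lt_iff_le_not_ge.1 (l.step i)
  have h2 := h1.trans hD
  rw [hlen] at h2
  have h3 : D + 1 ≤ D := by exact_mod_cast h2
  omega

theorem fg_top_of_surjective : (⊤ : Submodule (MvPolynomial τ R) M).FG := by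
  have : Module.Finite (MvPolynomial τ R) B := Module.Finite.of_surjective
    (Algebra.linearMap (MvPolynomial τ R) B) hsurj
  have : Module.Finite (MvPolynomial τ R) M := Module.Finite.trans B M
  exact Module.Finite.fg_top

theorem hasGrowth_hilbSam_of_dimSheafSupport_le {D : ℕ}
    (hD : dimSheafSupport M 𝒜 ≤ (D : WithBot ℕ∞)) {q : (Fin p → ℤ) → M →ₗ[R] M}
    (hq : IsGradingProj d q) :
    HasGrowth (D + 1) (hilbSam q (⊤ : Submodule (MvPolynomial τ R) M) ⊥) :=
  hasGrowth_hilbSam_of_primeChainBound hq (fg_top_of_surjective hX hsurj) IsHomog.top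
    fun _ hp hh hann => primeChainBound_of_dimSheafSupport_le (M := M) hX hsurj hD hp hh
      fun g hg => hann g fun x _ => hg x

end SupportDimension

/-! ### Gradings and their projections -/

noncomputable section GradingProjections

set_option linter.unusedSectionVars false

section Proj

variable {R M ι : Type*} [CommRing R] [AddCommGroup M] [Module R M] [DecidableEq ι]
  {ℳ : ι → Submodule R M} (h : DirectSum.IsInternal ℳ)

/-- The projections to the parts of an internal direct sum. -/
def gradingProj (w : ι) : M →ₗ[R] M :=
  (ℳ w).subtype ∘ₗ DirectSum.component R ι (fun i => ℳ i) w ∘ₗ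
    (LinearEquiv.ofBijective (DirectSum.coeLinearMap ℳ) h).symm.toLinearMap

theorem gradingProj_mem (w : ι) (x : M) : gradingProj h w x ∈ ℳ w := Subtype.prop _

theorem gradingProj_eq_ite {v : ι} {x : M} (hx : x ∈ ℳ v) (w : ι) :
    gradingProj h w x = if v = w then x else 0 := by
  have h1 : (LinearEquiv.ofBijective (DirectSum.coeLinearMap ℳ) h).symm x =
      DirectSum.lof R ι (fun i => ℳ i) v ⟨x, hx⟩ := by
    rw [LinearEquiv.symm_apply_eq]
    exact (DirectSum.coeLinearMap_lof ℳ v ⟨x, hx⟩).symm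
  change (((LinearEquiv.ofBijective (DirectSum.coeLinearMap ℳ) h).symm x) w : M) = _
  rw [h1]
  split_ifs with hv
  · subst hv
    rw [DirectSum.lof_apply]
  · rw [DirectSum.lof_eq_of, DirectSum.of_eq_of_ne _ _ _ (Ne.symm hv), ZeroMemClass.coe_zero]

theorem gradingProj_eq_self_iff {w : ι} {x : M} : gradingProj h w x = x ↔ x ∈ ℳ w :=
  ⟨fun hx => hx ▸ gradingProj_mem h w x, fun hx => by rw [gradingProj_eq_ite h hx, if_pos rfl]⟩

theorem exists_sum_gradingProj (x : M) : ∃ s : Finset ι, ∑ w ∈ s, gradingProj h w x = x := by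
  classical
  let y := (LinearEquiv.ofBijective (DirectSum.coeLinearMap ℳ) h).symm x
  refine ⟨DFinsupp.support y, ?_⟩
  have h1 : DirectSum.coeLinearMap ℳ y = x :=
    (LinearEquiv.ofBijective (DirectSum.coeLinearMap ℳ) h).apply_symm_apply x
  conv_rhs => rw [← h1, ← DirectSum.sum_support_of y]
  rw [map_sum]
  exact Finset.sum_congr rfl fun w _ => (DirectSum.coeLinearMap_lof ℳ w (y w)).symm

/-- The map is merely additive and may move degrees by `e`, so as to cover both multiplication by a
variable and degree-preserving homomorphisms. -/
theorem gradingProj_comm {M₂ : Type*} [AddCommGroup M₂] [Module R M₂] {ℳ₂ : ι → Submodule R M₂}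
    (h₂ : DirectSum.IsInternal ℳ₂) (φ : M →+ M₂) (e : ι → ι) (he : Function.Injective e)
    (hφ : ∀ v, ∀ x ∈ ℳ v, φ x ∈ ℳ₂ (e v)) (w : ι) (x : M) :
    gradingProj h₂ (e w) (φ x) = φ (gradingProj h w x) := by
  obtain ⟨s, hs⟩ := exists_sum_gradingProj h x
  rw [← hs]
  simp only [map_sum]
  refine Finset.sum_congr rfl fun v _ => ?_
  rw [gradingProj_eq_ite h₂ (hφ v _ (gradingProj_mem h v x)),
    gradingProj_eq_ite h (gradingProj_mem h v x)]
  simp only [he.eq_iff]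
  split_ifs <;> simp

end Proj

theorem isGradingProj_gradingProj {p : ℕ} {R B M τ : Type*} [CommRing R] [CommRing B] [Algebra R B]
    [Algebra (MvPolynomial τ R) B] [AddCommGroup M] [Module R M] [Module B M] [IsScalarTower R B M]
    [Module (MvPolynomial τ R) M] [IsScalarTower (MvPolynomial τ R) B M]
    {𝒜 : (Fin p → ℕ) → Submodule R B} {ℳ : (Fin p → ℤ) → Submodule R M}
    (hℳ : IsGradedModule 𝒜 ℳ) {d : τ → Fin p}
    (hX : ∀ t, algebraMap (MvPolynomial τ R) B (MvPolynomial.X t) ∈ 𝒜 (Pi.single (d t) 1)) :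
    IsGradingProj d (gradingProj hℳ.isInternal) where
  proj_self w x := (gradingProj_eq_self_iff _).2 (gradingProj_mem _ w x)
  proj_ne w w' x hne := by
    rw [gradingProj_eq_ite _ (gradingProj_mem _ w' x), if_neg (Ne.symm hne)]
  exists_sum := exists_sum_gradingProj _
  X_smul j w x := by
    refine (gradingProj_comm hℳ.isInternal hℳ.isInternal
      (DistribSMul.toAddMonoidHom M (MvPolynomial.X j : MvPolynomial τ R))
      (fun v => dirWeight d j + v) (add_right_injective _) (fun v x hx => ?_) w x).symm
    have h1 := hℳ.smul_mem _ v _ x (hX j) hx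
    rw [algebraMap_smul] at h1
    have h2 : (fun i => ((Pi.single (d j) 1 : Fin p → ℕ) i : ℤ) + v i) = dirWeight d j + v := by
      funext i
      simp [dirWeight, Pi.single_apply]
    rwa [h2] at h1

end GradingProjections

/-! ### The Hilbert function of the joint blow-up module -/

noncomputable section BlowupHilbert

variable {p : ℕ} {R B M : Type*} [CommRing R] [CommRing B] [Algebra R B]
  [AddCommGroup M] [Module R M] [Module B M] [IsScalarTower R B M] (H : Fin p → Submodule R B)

/-- The ideal `I^k I_1^{n_1} ⋯ I_p^{n_p}`. -/
def blowupIdeal (n : Fin p → ℕ) (k : ℕ) : Ideal B := totalIdeal H ^ k * ∏ i, formIdeal H i ^ n i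

variable {H}

omit [Module R M] [IsScalarTower R B M] in
theorem single_mem_reesFiltration {n : Fin p → ℕ} {k : ℕ} {x : M} :
    Finsupp.single n x ∈ reesFiltration M H k ↔ x ∈ blowupIdeal H n k • (⊤ : Submodule B M) := by
  rw [blowupIdeal, ← smul_eq_mul, smul_assoc, reesFiltration]
  constructor
  · intro h
    have h1 := Submodule.mem_map_of_mem (f := Finsupp.lapply (R := B) n) h
    rw [Submodule.map_smul'', Finsupp.lapply_apply, Finsupp.single_eq_same] at h1
    refine Submodule.smul_mono le_rfl ?_ h1
    rintro _ ⟨y, hy, rfl⟩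
    exact hy n
  · intro h
    have h1 := Submodule.mem_map_of_mem (f := Finsupp.lsingle (R := B) n) h
    rw [Submodule.map_smul''] at h1
    refine Submodule.smul_mono le_rfl ?_ h1
    rintro _ ⟨y, hy, rfl⟩ m
    by_cases hm : n = m
    · subst hm
      rwa [Finsupp.lsingle_apply, Finsupp.single_eq_same]
    · rw [Finsupp.lsingle_apply, Finsupp.single_eq_of_ne (Ne.symm hm)]
      exact Submodule.zero_mem _

theorem torLength_assocGradedComponent [IsLocalRing R] (ℳ : (Fin p → ℤ) → Submodule R M) (k : ℕ)
    (v : Fin p → ℤ) (n : Fin p → ℕ) :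
    torLength (assocGradedComponent H ℳ k v n) ⊥ =
      torLength (ℳ (fun i => v i + n i) ⊓ (blowupIdeal H n k • ⊤ : Submodule B M).restrictScalars R)
        ((blowupIdeal H n (k + 1) • ⊤ : Submodule B M).restrictScalars R) := by
  have h1 : Submodule.comap ((AssocGradedPiece.mk M H k).restrictScalars R) ⊥ =
      ((reesFiltration M H (k + 1)).restrictScalars R).comap
        ((reesFiltration M H k).subtype.restrictScalars R) := by
    ext x
    exact (Submodule.Quotient.mk_eq_zero _)
  rw [assocGradedComponent, torLength_map, h1, ← torLength_map]
  have h2 : Submodule.map ((reesFiltration M H k).subtype.restrictScalars R)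
      (((ℳ fun i => v i + n i).map (Finsupp.lsingle n : M →ₗ[R] ((Fin p → ℕ) →₀ M))).comap
        ((reesFiltration M H k).subtype.restrictScalars R)) =
      (ℳ (fun i => v i + n i) ⊓
        (blowupIdeal H n k • ⊤ : Submodule B M).restrictScalars R).map (Finsupp.lsingle n) := by
    ext y
    constructor
    · rintro ⟨⟨y, hy⟩, ⟨x, hx, hxy⟩, rfl⟩
      refine ⟨x, ⟨hx, ?_⟩, hxy⟩
      refine single_mem_reesFiltration.1 ?_
      have h3 : Finsupp.single n x = y := hxy
      rwa [h3]
    · rintro ⟨x, ⟨hx, hxk⟩, rfl⟩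
      exact ⟨⟨_, single_mem_reesFiltration.2 hxk⟩, ⟨x, hx, rfl⟩, rfl⟩
  rw [h2, torLength_map]
  congr 1
  ext x
  exact single_mem_reesFiltration

theorem assocGradedComponent_eq_bot {ℳ : (Fin p → ℤ) → Submodule R M} {k : ℕ}
    {v : Fin p → ℤ} {n : Fin p → ℕ} (h : ℳ (fun i => v i + n i) ⊓
      (blowupIdeal H n k • ⊤ : Submodule B M).restrictScalars R = ⊥) :
    assocGradedComponent H ℳ k v n = ⊥ := by
  rw [eq_bot_iff]
  rintro _ ⟨⟨y, hy⟩, ⟨x, hx, hxy⟩, rfl⟩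
  have h3 : Finsupp.single n x = y := hxy
  subst h3
  have h4 : x = 0 := (Submodule.mem_bot R).1 (h ▸ ⟨hx, single_mem_reesFiltration.1 hy⟩)
  subst h4
  have h5 : (⟨Finsupp.single n 0, hy⟩ : reesFiltration M H k) = 0 :=
    Subtype.ext (Finsupp.single_zero n)
  rw [h5]
  exact Submodule.zero_mem _

/-- Torsion of a direct sum is computed summand by summand, and for `k ≥ K` the components of the
given bidegree vanish. -/
theorem jHilbertFunction_eq_sum [IsLocalRing R] {ℳ : (Fin p → ℤ) → Submodule R M}
    {w : Fin p ⊕ Fin p → ℕ} {K : ℕ} (hK : ∀ k, K ≤ k →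
      ℳ (fun i => (w (.inl i) : ℤ) + w (.inr i)) ⊓
        (blowupIdeal H (fun i => w (.inr i)) k • ⊤ : Submodule B M).restrictScalars R = ⊥) :
    jHilbertFunction H ℳ w = ∑ k ∈ Finset.range K,
      torLength (ℳ (fun i => (w (.inl i) : ℤ) + w (.inr i)) ⊓
        (blowupIdeal H (fun i => w (.inr i)) k • ⊤ : Submodule B M).restrictScalars R)
        ((blowupIdeal H (fun i => w (.inr i)) (k + 1) • ⊤ : Submodule B M).restrictScalars R) := by
  have hsingle : ∀ k, ∀ y ∈ assocGradedComponent H ℳ k (fun i => w (.inl i)) (fun i => w (.inr i)),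
      DirectSum.lof R ℕ (AssocGradedPiece M H) k y ∈
        jointBlowupComponent H ℳ (fun i => w (.inl i)) fun i => w (.inr i) := by
    intro k y hy k'
    by_cases hk : k = k'
    · subst hk
      rwa [DirectSum.lof_apply]
    · rw [DirectSum.lof_eq_of, DirectSum.of_eq_of_ne _ _ _ (Ne.symm hk)]
      exact Submodule.zero_mem _
  rw [jHilbertFunction, ← torLength_bot, torLength_eq_sum
    (fun k => DirectSum.component R ℕ (AssocGradedPiece M H) k) (fun _ => ⊥) (Finset.range K)]
  · refine Finset.sum_congr rfl fun k _ => ?_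
    rw [← torLength_assocGradedComponent]
    congr 1
    refine le_antisymm ?_ fun y hy => ⟨_, hsingle k y hy, DirectSum.lof_apply R k y⟩
    rintro _ ⟨x, hx, rfl⟩
    exact hx k
  · intro k _ x hx
    refine ⟨DirectSum.lof R ℕ (AssocGradedPiece M H) k (x k), hsingle k _ (hx k),
      DirectSum.lof_apply R k _, fun k' hk' => ?_⟩
    exact DirectSum.of_eq_of_ne _ _ _ hk'
  · intro x hx
    rw [Submodule.mem_bot]
    refine ⟨fun h k _ => by rw [h, map_zero]; exact Submodule.zero_mem _, fun h => ?_⟩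
    refine DFinsupp.ext fun k => ?_
    by_cases hk : k < K
    · exact (Submodule.mem_bot R).1 (h k (Finset.mem_range.2 hk))
    · have h1 := hx k
      rw [assocGradedComponent_eq_bot (hK k (not_lt.1 hk))] at h1
      exact (Submodule.mem_bot R).1 h1

end BlowupHilbert

/-! ### Joint blow-up modules as Rees modules -/

noncomputable section BlowupRees

open MvPolynomial IsLocalRing ReesAmbient

set_option linter.unusedSectionVars false

/-- The variables are of two sorts: algebra generators of `B`, and finitely many elements of each
`H_i` generating `I_i`, which exist because `B` is Noetherian. The second sort is `γ`. -/
theorem exists_reesData {p : ℕ} {R B : Type*} [CommRing R] [IsNoetherianRing R] [CommRing B]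
    [Algebra R B] {𝒜 : (Fin p → ℕ) → Submodule R B} [GradedAlgebra 𝒜] (h𝒜 : IsStandardGraded 𝒜)
    {H : Fin p → Submodule R B} (hH : ∀ i, H i ≤ 𝒜 (Pi.single i 1)) :
    ∃ (m : ℕ) (d : Fin m → Fin p) (γ : Finset (Fin m)) (b : Fin m → B),
      (∀ t, b t ∈ 𝒜 (Pi.single (d t) 1)) ∧ Function.Surjective (aeval (R := R) b) ∧
      ∀ i, Ideal.span {x | ∃ t ∈ γ, d t = i ∧ x = b t} = formIdeal H i := by
  classical
  obtain ⟨S, hS, hadj⟩ := h𝒜.exists_generators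
  have : Algebra.FiniteType R B := ⟨S, hadj⟩
  have : IsNoetherianRing B := Algebra.FiniteType.isNoetherianRing R B
  have hG : ∀ i, ∃ G : Finset B, (G : Set B) ⊆ H i ∧ formIdeal H i = Ideal.span G := fun i =>
    (Submodule.fg_span_iff_fg_span_finset_subset (R := B) (H i : Set B)).1
      (IsNoetherian.noetherian (formIdeal H i))
  choose G hGH hG using hG
  choose e he using fun s : ↥S => hS s s.2
  let τ := ↥S ⊕ (Σ i, ↥(G i))
  let σ : Fin (Fintype.card τ) ≃ τ := (Fintype.equivFin τ).symm
  let d : τ → Fin p := Sum.elim e Sigma.fst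
  let b : τ → B := Sum.elim (fun s => s) fun s => s.2
  refine ⟨_, d ∘ σ, Finset.univ.filter fun t => ∃ s, σ t = .inr s, b ∘ σ, fun t => ?_, ?_,
    fun i => ?_⟩
  · rcases h : σ t with s | s
    · simpa [h, b, d] using he s
    · simpa [h, b, d] using hH s.1 (hGH s.1 s.2.2)
  · rw [← AlgHom.range_eq_top, ← Algebra.adjoin_range_eq_range_aeval, EquivLike.range_comp,
      eq_top_iff, ← hadj]
    exact Algebra.adjoin_mono fun s hs => ⟨.inl ⟨s, hs⟩, rfl⟩
  · rw [hG]
    refine le_antisymm (Ideal.span_mono ?_) (Ideal.span_mono fun x hx => ?_)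
    · rintro _ ⟨t, ht, rfl, rfl⟩
      obtain ⟨s, hs⟩ := (Finset.mem_filter.1 ht).2
      simp [hs, b, d]
    · refine ⟨σ.symm (.inr ⟨i, x, hx⟩), Finset.mem_filter.2 ⟨Finset.mem_univ _, _,
        σ.apply_symm_apply _⟩, ?_, ?_⟩
      · simp [d]
      · simp [b]

variable {p : ℕ} {R B M τ : Type*} [CommRing R] [CommRing B]
  [Algebra R B] {H : Fin p → Submodule R B}
  [Algebra (MvPolynomial τ R) B]
  [AddCommGroup M] [Module R M] [Module B M] [IsScalarTower R B M]
  [Module (MvPolynomial τ R) M] [IsScalarTower R (MvPolynomial τ R) M]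
  [IsScalarTower (MvPolynomial τ R) B M] {d : τ → Fin p} {γ : Finset τ}

theorem map_reesPow_expo (h : ∀ i, Ideal.span
    {x | ∃ t ∈ γ, d t = i ∧ x = algebraMap (MvPolynomial τ R) B (X t)} = formIdeal H i)
    (n : Fin p → ℕ) (k : ℕ) :
    (reesPow R d γ (expo n k)).map (algebraMap (MvPolynomial τ R) B) = blowupIdeal H n k := by
  have h1 : ∀ i, (reesIdeal R d γ (some i)).map (algebraMap (MvPolynomial τ R) B) =
      formIdeal H i := fun i => by
    rw [← h, reesIdeal, Ideal.map_span]
    congr 1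
    ext x
    constructor
    · rintro ⟨_, ⟨t, ht, hd, rfl⟩, rfl⟩
      exact ⟨t, ht, hd i rfl, rfl⟩
    · rintro ⟨t, ht, hd, rfl⟩
      exact ⟨_, ⟨t, ht, fun j hj => hd.trans (Option.some_injective _ hj), rfl⟩, rfl⟩
  have h2 : (reesIdeal R d γ none).map (algebraMap (MvPolynomial τ R) B) = totalIdeal H := by
    have h3 : reesIdeal R d γ none = ⨆ i, reesIdeal R d γ (some i) := by
      refine le_antisymm (Ideal.span_le.2 ?_) (iSup_le fun i => Ideal.span_mono ?_)
      · rintro _ ⟨t, ht, -, rfl⟩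
        exact Ideal.mem_iSup_of_mem (d t) (X_mem_reesIdeal ht fun i hi => Option.some_injective _ hi)
      · rintro _ ⟨t, ht, -, rfl⟩
        exact ⟨t, ht, by simp, rfl⟩
    rw [h3, Ideal.map_iSup, totalIdeal]
    exact iSup_congr h1
  have h4 : ∀ J : Ideal (MvPolynomial τ R), J.map (algebraMap (MvPolynomial τ R) B) =
      Ideal.mapHom (algebraMap (MvPolynomial τ R) B) J := fun _ => rfl
  rw [reesPow, Fintype.prod_option, h4, map_mul, map_prod, map_pow, ← h4, h2, blowupIdeal]
  congr 1
  refine Finset.prod_congr rfl fun i _ => ?_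
  rw [map_pow, ← h4, h1]
  rfl

variable {𝒜 : (Fin p → ℕ) → Submodule R B} {ℳ : (Fin p → ℤ) → Submodule R M}
  (hℳ : IsGradedModule 𝒜 ℳ) (hmap : ∀ n k, (reesPow R d γ (expo n k)).map
    (algebraMap (MvPolynomial τ R) B) = blowupIdeal H n k)

include hmap in
theorem reesPow_expo_smul (n : Fin p → ℕ) (k : ℕ) (Y : Submodule B M) :
    reesPow R d γ (expo n k) • Y.restrictScalars (MvPolynomial τ R) =
      (blowupIdeal H n k • Y).restrictScalars (MvPolynomial τ R) := by
  rw [← hmap, Ideal.smul_restrictScalars]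

theorem homogPart_gradingProj (Y : Submodule B M) (u : Fin p → ℤ) :
    homogPart (gradingProj hℳ.isInternal) (Y.restrictScalars (MvPolynomial τ R)) u =
      ℳ u ⊓ Y.restrictScalars R := by
  ext x
  rw [mem_homogPart, gradingProj_eq_self_iff, and_comm]
  rfl

theorem restrictScalars_restrictScalars (Y : Submodule B M) :
    (Y.restrictScalars (MvPolynomial τ R)).restrictScalars R = Y.restrictScalars R := rfl

variable [IsLocalRing R] [IsNoetherianRing R] [Fintype τ]

include hmap in
theorem torFunction_reesSub_eq_sum (Y : Submodule B M) {w : Fin p ⊕ Fin p → ℕ} {K : ℕ}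
    (hK : ∀ k, K ≤ k → ℳ (fun i => (w (.inl i) : ℤ) + w (.inr i)) ⊓
      (blowupIdeal H (fun i => w (.inr i)) k • Y).restrictScalars R = ⊥) :
    torFunction (proj d γ (gradingProj hℳ.isInternal))
      (reesSub d γ (Y.restrictScalars (MvPolynomial τ R)))
      (reesShiftSub d γ (Y.restrictScalars (MvPolynomial τ R))) w =
    ∑ k ∈ Finset.range K, torLength (ℳ (fun i => (w (.inl i) : ℤ) + w (.inr i)) ⊓
        (blowupIdeal H (fun i => w (.inr i)) k • Y).restrictScalars R)
      ((blowupIdeal H (fun i => w (.inr i)) (k + 1) • Y).restrictScalars R) := by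
  have h1 : ∀ k, homogPart (gradingProj hℳ.isInternal)
      (reesPow R d γ (expo (fun i => w (.inr i)) k) • Y.restrictScalars (MvPolynomial τ R))
      (totalDeg fun i => w i) = ℳ (fun i => (w (.inl i) : ℤ) + w (.inr i)) ⊓
        (blowupIdeal H (fun i => w (.inr i)) k • Y).restrictScalars R := fun k => by
    rw [reesPow_expo_smul hmap, homogPart_gradingProj hℳ]
    rfl
  rw [torFunction, torLength_homogPart_coordSub (IsStable.pow _) ((IsStable.pow _).shift _)
    (n := fun i => w (.inr i)) (fun _ => rfl) (K := K) fun k hk => by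
      rw [h1, hK k hk]; exact bot_le]
  refine Finset.sum_congr rfl fun k _ => ?_
  rw [h1, ← expo_succ, reesPow_expo_smul hmap, restrictScalars_restrictScalars]

include hmap in
theorem torFunction_reesSub_sup_eq_sum (Y : Submodule B M) {w : Fin p ⊕ Fin p → ℕ} {K : ℕ}
    (hK : ∀ k, K ≤ k → ℳ (fun i => (w (.inl i) : ℤ) + w (.inr i)) ⊓
      (blowupIdeal H (fun i => w (.inr i)) k • ⊤ : Submodule B M).restrictScalars R = ⊥) :
    torFunction (proj d γ (gradingProj hℳ.isInternal))
      (reesSub d γ (⊤ : Submodule (MvPolynomial τ R) M))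
      (reesShiftSub d γ ⊤ ⊔ reesInf d γ (Y.restrictScalars (MvPolynomial τ R))) w =
    ∑ k ∈ Finset.range K, torLength (ℳ (fun i => (w (.inl i) : ℤ) + w (.inr i)) ⊓
        (blowupIdeal H (fun i => w (.inr i)) k • ⊤ : Submodule B M).restrictScalars R)
      ((blowupIdeal H (fun i => w (.inr i)) (k + 1) • ⊤ ⊔ Y).restrictScalars R) := by
  have h0 : (⊤ : Submodule (MvPolynomial τ R) M) =
    (⊤ : Submodule B M).restrictScalars (MvPolynomial τ R) := rfl
  have h1 : ∀ k, homogPart (gradingProj hℳ.isInternal)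
      (reesPow R d γ (expo (fun i => w (.inr i)) k) • (⊤ : Submodule (MvPolynomial τ R) M))
      (totalDeg fun i => w i) = ℳ (fun i => (w (.inl i) : ℤ) + w (.inr i)) ⊓
        (blowupIdeal H (fun i => w (.inr i)) k • ⊤ : Submodule B M).restrictScalars R := fun k => by
    rw [h0, reesPow_expo_smul hmap, homogPart_gradingProj hℳ]
    rfl
  rw [torFunction, ← coordSub_sup ((IsStable.pow _).shift _) (isStable_inf _),
    torLength_homogPart_coordSub (IsStable.pow _)
    (((IsStable.pow _).shift _).sup (isStable_inf _))
    (n := fun i => w (.inr i)) (fun _ => rfl) (K := K) fun k hk => by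
      rw [h1, hK k hk]; exact bot_le]
  refine Finset.sum_congr rfl fun k _ => ?_
  rw [h1, ← expo_succ, h0, reesPow_expo_smul hmap, reesPow_expo_smul hmap]
  -- Modular law: inside `I^k I^n M`, adding its intersection with `Y` to `I^{k+1} I^n M` has the
  -- same effect as adding all of `Y`.
  refine torLength_congr_right (le_antisymm (inf_le_inf le_rfl fun x hx => ?_) ?_)
  · obtain ⟨y, hy, z, hz, rfl⟩ := Submodule.mem_sup.1 hx
    exact Submodule.add_mem_sup hy hz.2
  · rintro x ⟨⟨hx, hxk⟩, hxs⟩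
    refine ⟨⟨hx, hxk⟩, ?_⟩
    obtain ⟨y, hy, z, hz, rfl⟩ := Submodule.mem_sup.1
      (show x ∈ blowupIdeal H (fun i => w (.inr i)) (k + 1) • ⊤ ⊔ Y from hxs)
    refine Submodule.add_mem_sup hy ⟨?_, hz⟩
    have hle : (blowupIdeal H (fun i => w (.inr i)) (k + 1) • ⊤ : Submodule B M) ≤
        blowupIdeal H (fun i => w (.inr i)) k • ⊤ := by
      refine Submodule.smul_mono (Ideal.mul_mono_left (Ideal.pow_le_pow_right (Nat.le_succ k))) le_rfl
    exact ((blowupIdeal H (fun i => w (.inr i)) k • ⊤ : Submodule B M).add_mem_iff_right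
      (hle hy)).1 hxk

include hmap in
theorem exists_inf_blowupIdeal_smul_eq_bot
    (hq : IsGradingProj d (gradingProj hℳ.isInternal))
    (hM : (⊤ : Submodule (MvPolynomial τ R) M).FG) (w : Fin p ⊕ Fin p → ℕ) :
    ∃ K, ∀ k, K ≤ k → ℳ (fun i => (w (.inl i) : ℤ) + w (.inr i)) ⊓
      (blowupIdeal H (fun i => w (.inr i)) k • ⊤ : Submodule B M).restrictScalars R = ⊥ := by
  obtain ⟨b, c, h⟩ := exists_reesBounds hq γ hM IsHomog.top
  refine ⟨∑ i, (w (.inl i) : ℤ).toNat + b, fun k hk => ?_⟩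
  have h1 := (h (fun i => w i) (fun i => w (.inr i)) 0 _ _ (fun _ => rfl)
    (fun i => Int.natCast_nonneg _) rfl rfl).1 k hk
  have h0 : (⊤ : Submodule (MvPolynomial τ R) M) =
    (⊤ : Submodule B M).restrictScalars (MvPolynomial τ R) := rfl
  rw [h0, reesPow_expo_smul hmap, homogPart_gradingProj hℳ] at h1
  exact h1

variable {M₂ : Type*} [AddCommGroup M₂] [Module R M₂] [Module B M₂] [IsScalarTower R B M₂]
  {ℳ₂ : (Fin p → ℤ) → Submodule R M₂} (hℳ₂ : IsGradedModule 𝒜 ℳ₂)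

theorem gradingProj_map (φ : M₂ →ₗ[B] M) (hφ : ∀ v, ∀ x ∈ ℳ₂ v, φ x ∈ ℳ v) (u : Fin p → ℤ)
    (x : M₂) : gradingProj hℳ.isInternal u (φ x) = φ (gradingProj hℳ₂.isInternal u x) :=
  gradingProj_comm hℳ₂.isInternal hℳ.isInternal φ.toAddMonoidHom id Function.injective_id hφ u x

-- Transport along the injective graded map `f`, which carries `I^k I^n M₂` to the same ideal times
-- its range and reflects homogeneity.
include hmap hℳ₂ in
theorem jHilbertFunction_eq_torFunction_range
    (hq : IsGradingProj d (gradingProj hℳ.isInternal))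
    (hM : (⊤ : Submodule (MvPolynomial τ R) M).FG) (f : M₂ →ₗ[B] M)
    (hf : ∀ v, ∀ x ∈ ℳ₂ v, f x ∈ ℳ v) (hinj : Function.Injective f) :
    jHilbertFunction H ℳ₂ = torFunction (proj d γ (gradingProj hℳ.isInternal))
      (reesSub d γ ((LinearMap.range f).restrictScalars (MvPolynomial τ R)))
      (reesShiftSub d γ ((LinearMap.range f).restrictScalars (MvPolynomial τ R))) := by
  funext w
  obtain ⟨K, hK⟩ := exists_inf_blowupIdeal_smul_eq_bot hℳ hmap hq hM w
  have h1 : ∀ n k, Submodule.map (f.restrictScalars R)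
      ((blowupIdeal H n k • ⊤ : Submodule B M₂).restrictScalars R) =
      (blowupIdeal H n k • LinearMap.range f).restrictScalars R := fun n k => by
    rw [LinearMap.range_eq_map, ← Submodule.map_smul'']
    rfl
  have h2 : ∀ n k u, Submodule.map (f.restrictScalars R)
      (ℳ₂ u ⊓ (blowupIdeal H n k • ⊤ : Submodule B M₂).restrictScalars R) =
      ℳ u ⊓ (blowupIdeal H n k • LinearMap.range f).restrictScalars R := fun n k u => by
    rw [← h1]
    ext y
    constructor
    · rintro ⟨x, ⟨hx, hxk⟩, rfl⟩
      exact ⟨hf u x hx, x, hxk, rfl⟩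
    · rintro ⟨hy, x, hx, rfl⟩
      refine ⟨x, ⟨(gradingProj_eq_self_iff hℳ₂.isInternal).1 (hinj ?_), hx⟩, rfl⟩
      rw [← gradingProj_map hℳ hℳ₂ f hf]
      exact (gradingProj_eq_self_iff hℳ.isInternal).2 hy
  have hK₁ : ∀ k, K ≤ k → ℳ (fun i => (w (.inl i) : ℤ) + w (.inr i)) ⊓
      (blowupIdeal H (fun i => w (.inr i)) k • LinearMap.range f).restrictScalars R = ⊥ :=
    fun k hk => by
      have hle : blowupIdeal H (fun i => w (.inr i)) k • LinearMap.range f ≤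
          blowupIdeal H (fun i => w (.inr i)) k • ⊤ := Submodule.smul_mono le_rfl le_top
      rw [eq_bot_iff, ← hK k hk]
      exact fun x hx => ⟨hx.1, hle hx.2⟩
  rw [torFunction_reesSub_eq_sum hℳ hmap _ hK₁, jHilbertFunction_eq_sum (K := K)]
  · refine Finset.sum_congr rfl fun k _ => ?_
    rw [← h2, ← h1, torLength_map_of_injective (f.restrictScalars R) hinj]
  · intro k hk
    refine Submodule.map_injective_of_injective (f := f.restrictScalars R) hinj ?_
    rw [h2, hK₁ k hk, Submodule.map_bot]

include hmap in
theorem jHilbertFunction_eq_torFunction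
    (hq : IsGradingProj d (gradingProj hℳ.isInternal))
    (hM : (⊤ : Submodule (MvPolynomial τ R) M).FG) :
    jHilbertFunction H ℳ = torFunction (proj d γ (gradingProj hℳ.isInternal))
      (reesSub d γ (⊤ : Submodule (MvPolynomial τ R) M)) (reesShiftSub d γ ⊤) := by
  rw [jHilbertFunction_eq_torFunction_range hℳ hmap hℳ hq hM LinearMap.id (fun _ _ hx => hx)
    Function.injective_id, LinearMap.range_id]
  rfl

-- Torsion lengths in the quotient `M₂` are those in `M` modulo preimages, which adds the kernel of
-- `g` to the denominators.
include hmap hℳ₂ in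
theorem jHilbertFunction_eq_torFunction_ker
    (hq : IsGradingProj d (gradingProj hℳ.isInternal))
    (hM : (⊤ : Submodule (MvPolynomial τ R) M).FG) (g : M →ₗ[B] M₂)
    (hg : ∀ v, ∀ x ∈ ℳ v, g x ∈ ℳ₂ v) (hsurj : Function.Surjective g) :
    jHilbertFunction H ℳ₂ = torFunction (proj d γ (gradingProj hℳ.isInternal))
      (reesSub d γ (⊤ : Submodule (MvPolynomial τ R) M))
      (reesShiftSub d γ ⊤ ⊔ reesInf d γ ((LinearMap.ker g).restrictScalars (MvPolynomial τ R))) := by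
  funext w
  obtain ⟨K, hK⟩ := exists_inf_blowupIdeal_smul_eq_bot hℳ hmap hq hM w
  have h0 : ∀ n k, (blowupIdeal H n k • ⊤ : Submodule B M).map g = blowupIdeal H n k • ⊤ :=
    fun n k => by rw [Submodule.map_smul'', Submodule.map_top, LinearMap.range_eq_top.2 hsurj]
  have h1 : ∀ n k, Submodule.comap (g.restrictScalars R)
      ((blowupIdeal H n k • ⊤ : Submodule B M₂).restrictScalars R) =
      (blowupIdeal H n k • ⊤ ⊔ LinearMap.ker g).restrictScalars R := fun n k => by
    rw [← Submodule.comap_map_eq, h0]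
    rfl
  have h2 : ∀ n k u, Submodule.map (g.restrictScalars R)
      (ℳ u ⊓ (blowupIdeal H n k • ⊤ : Submodule B M).restrictScalars R) =
      ℳ₂ u ⊓ (blowupIdeal H n k • ⊤ : Submodule B M₂).restrictScalars R := fun n k u => by
    rw [← h0]
    ext y
    constructor
    · rintro ⟨x, ⟨hx, hxk⟩, rfl⟩
      exact ⟨hg u x hx, x, hxk, rfl⟩
    · rintro ⟨hy, x, hx, rfl⟩
      -- An arbitrary lift is replaced by its component of degree `u`, which stays in the
      -- homogeneous submodule `I^k I^n M` and has the same image.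
      refine ⟨gradingProj hℳ.isInternal u x, ⟨gradingProj_mem _ u x, ?_⟩, ?_⟩
      · have h3 := isHomog_reesPow_smul (γ := γ) hq IsHomog.top (expo n k) u x
        have h4 : (⊤ : Submodule (MvPolynomial τ R) M) =
          (⊤ : Submodule B M).restrictScalars (MvPolynomial τ R) := rfl
        rw [h4, reesPow_expo_smul hmap] at h3
        exact h3 hx
      · change g _ = g x
        rw [← gradingProj_map hℳ₂ hℳ g hg]
        exact (gradingProj_eq_self_iff hℳ₂.isInternal).2 hy
  rw [torFunction_reesSub_sup_eq_sum hℳ hmap _ hK, jHilbertFunction_eq_sum (K := K)]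
  · refine Finset.sum_congr rfl fun k _ => ?_
    rw [← h2, torLength_map, h1]
  · intro k hk
    rw [← h2, hK k hk, Submodule.map_bot]

end BlowupRees

/-! ### Additivity -/

section Additivity

theorem mixedMultiplicity_eq {σ : Type*} [Fintype σ] {F : (σ → ℕ) → ℕ∞} {P : MvPolynomial σ ℚ}
    (hP : IsHilbertPolynomial F P) (ρ : σ → ℕ) : mixedMultiplicity F ρ =
      (∏ i, ((ρ i).factorial : ℚ)) * MvPolynomial.coeff (Finsupp.equivFunOnFinite.symm ρ) P := by
  have h : ∃ P, IsHilbertPolynomial F P := ⟨P, hP⟩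
  rw [mixedMultiplicity, dif_pos h, h.choose_spec.unique hP]

theorem totalDegree_le_of_coeff {σ : Type*} [Fintype σ] {P : MvPolynomial σ ℚ} {D : ℕ}
    (h : ∀ ρ : σ →₀ ℕ, D < ∑ i, ρ i → MvPolynomial.coeff ρ P = 0) : P.totalDegree ≤ D := by
  refine Finset.sup_le fun ρ hρ => ?_
  by_contra hlt
  refine MvPolynomial.mem_support_iff.1 hρ (h ρ ?_)
  rw [Finsupp.sum_fintype _ _ fun _ => rfl] at hlt
  exact not_le.1 hlt

end Additivity

theorem mainTheorem7 {p : ℕ} (hp : 1 ≤ p)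
    {R B : Type*} [CommRing R] [IsNoetherianRing R] [IsLocalRing R] [CommRing B] [Algebra R B]
    (𝒜 : (Fin p → ℕ) → Submodule R B) [GradedAlgebra 𝒜] (h𝒜 : IsStandardGraded 𝒜)
    (H : Fin p → Submodule R B) (hH : ∀ i, H i ≤ 𝒜 (Pi.single i 1)) (hH0 : ∀ i, H i ≠ ⊥)
    {M' M M'' : Type*}
    [AddCommGroup M'] [Module R M'] [Module B M'] [IsScalarTower R B M'] [Module.Finite B M']
    [AddCommGroup M] [Module R M] [Module B M] [IsScalarTower R B M] [Module.Finite B M]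
    [AddCommGroup M''] [Module R M''] [Module B M''] [IsScalarTower R B M''] [Module.Finite B M'']
    (ℳ' : (Fin p → ℤ) → Submodule R M') (hℳ' : IsGradedModule 𝒜 ℳ')
    (ℳ : (Fin p → ℤ) → Submodule R M) (hℳ : IsGradedModule 𝒜 ℳ)
    (ℳ'' : (Fin p → ℤ) → Submodule R M'') (hℳ'' : IsGradedModule 𝒜 ℳ'')
    (f : M' →ₗ[B] M) (hf : ∀ v, ∀ x ∈ ℳ' v, f x ∈ ℳ v)
    (g : M →ₗ[B] M'') (hg : ∀ v, ∀ x ∈ ℳ v, g x ∈ ℳ'' v)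
    (hf_inj : Function.Injective f) (hfg : Function.Exact f g) (hg_surj : Function.Surjective g)
    (α β : Fin p → ℕ)
    (hr : dimSheafSupport M 𝒜 ≤ ((∑ i, α i + ∑ i, β i : ℕ) : WithBot ℕ∞)) :
    MixedJMultiplicityExists H ℳ' α β ∧
    MixedJMultiplicityExists H ℳ α β ∧
    MixedJMultiplicityExists H ℳ'' α β ∧
    mixedJMultiplicity H ℳ α β = mixedJMultiplicity H ℳ' α β + mixedJMultiplicity H ℳ'' α β := by
  obtain ⟨m, d, γ, b, hb, hsurj, hspan⟩ := exists_reesData h𝒜 hH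
  -- Only `M` is made a module over the polynomial ring; `M'` and `M''` enter through the range of
  -- `f` and the kernel of `g`, which coincide.
  let : Algebra (MvPolynomial (Fin m) R) B := (MvPolynomial.aeval b).toRingHom.toAlgebra
  let : Module (MvPolynomial (Fin m) R) M :=
    Module.compHom M (algebraMap (MvPolynomial (Fin m) R) B)
  have hbX : ∀ t, algebraMap (MvPolynomial (Fin m) R) B (MvPolynomial.X t) = b t :=
    fun t => MvPolynomial.aeval_X b t
  have : IsScalarTower R (MvPolynomial (Fin m) R) B :=
    IsScalarTower.of_algebraMap_eq fun r => ((MvPolynomial.aeval b).commutes r).symm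
  have : IsScalarTower (MvPolynomial (Fin m) R) B M := ⟨fun c y x => by
    rw [Algebra.smul_def, mul_smul]
    rfl⟩
  have : IsScalarTower R (MvPolynomial (Fin m) R) M := ⟨fun r c x => by
    change algebraMap (MvPolynomial (Fin m) R) B (r • c) • x =
      r • algebraMap (MvPolynomial (Fin m) R) B c • x
    rw [Algebra.smul_def, map_mul, ← IsScalarTower.algebraMap_apply, mul_smul, algebraMap_smul]⟩
  have : Nonempty (Fin p) := ⟨⟨0, hp⟩⟩
  have hX : ∀ t, algebraMap (MvPolynomial (Fin m) R) B (MvPolynomial.X t) ∈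
      𝒜 (Pi.single (d t) 1) := fun t => hbX t ▸ hb t
  have hmap := map_reesPow_expo (R := R) (H := H) (d := d) (γ := γ) fun i => by
    simpa only [hbX] using hspan i
  have hq := isGradingProj_gradingProj hℳ hX
  have hM := fg_top_of_surjective (M := M) hX hsurj
  have hrange : LinearMap.range f = LinearMap.ker g := (LinearMap.exact_iff.1 hfg).symm
  have hQ : IsHomog (gradingProj hℳ.isInternal)
      ((LinearMap.range f).restrictScalars (MvPolynomial (Fin m) R)) := by
    rintro w _ ⟨x, rfl⟩
    exact ⟨_, (gradingProj_map hℳ hℳ' f hf w x).symm⟩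
  obtain ⟨P, P₁, P₂, hP, hP₁, hP₂, hdeg, hadd⟩ := exists_hilbertPolynomials (γ := γ) hq hM hQ
    (hasGrowth_hilbSam_of_dimSheafSupport_le hX hsurj hr hq)
  rw [← jHilbertFunction_eq_torFunction hℳ hmap hq hM] at hP
  rw [← jHilbertFunction_eq_torFunction_range hℳ hmap hℳ' hq hM f hf hf_inj] at hP₁
  rw [hrange, ← jHilbertFunction_eq_torFunction_ker hℳ hmap hℳ'' hq hM g hg hg_surj] at hP₂
  refine ⟨⟨P₁, hP₁, totalDegree_le_of_coeff fun ρ hρ => (hdeg ρ hρ).2.1⟩,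
    ⟨P, hP, totalDegree_le_of_coeff fun ρ hρ => (hdeg ρ hρ).1⟩,
    ⟨P₂, hP₂, totalDegree_le_of_coeff fun ρ hρ => (hdeg ρ hρ).2.2⟩, ?_⟩
  rw [mixedJMultiplicity, mixedJMultiplicity, mixedJMultiplicity, mixedMultiplicity_eq hP,
    mixedMultiplicity_eq hP₁, mixedMultiplicity_eq hP₂, hadd _ ?_, mul_add]
  simp [Fintype.sum_sum_type]
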